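/- **Setting.** Let $n,m,p,q\ge 0$, $K\ge 1$, $0<\tau_1\le\dots\le\tau_K$, and consider, with zero history $x(s)=0$ for $s\in[-\tau_K,0]$, the multi-delay system $$\dot x(t)=A_0x(t)+\sum_{i=1}^K A_i x(t-\tau_i)+B_1w(t)+B_2u(t),\qquad y(t)=C_0x(t)+\sum_{i=1}^K C_i x(t-\tau_i)+D_1w(t)+D_2u(t),$$ with $x(t)\in\mathbb R^n$, $w(t)\in\mathbb R^m$, $u(t)\in\mathbb R^p$, $y(t)\in\mathbb R^q$ and real matrices of matching sizes. For $r\ge 0$ let $Z_{r,n,K}=\mathbb R^r\times L_2^n[-\tau_1,0]\times\dots\times L_2^n[-\tau_K,0]$ with inner product $$\langle (y,\psi_i),(x,\phi_i)\rangle=\tau_K y^Tx+\sum_{i}\int_{-\tau_i}^0\psi_i(s)^T\phi_i(s)\,ds,$$ let $Z_{n,K}=Z_{n,n,K}$, and let $X$ be the set of $(x,\phi_i)\in Z_{n,K}$ with $\phi_i\in W^{1,2}([-\tau_i,0];\mathbb R^n)$ and $\phi_i(0)=x$ for all $i$. For a matrix $P$ and matrix functions $Q_i(s)$, $S_i(s)$,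 $R_{ij}(s,\theta)$, the operator $\mathcal P_{\{P,Q_i,S_i,R_{ij}\}}$ maps $(x,\phi_i)$ to the element with components $$Px+\sum_i\int_{-\tau_i}^0Q_i(s)\phi_i(s)\,ds,\qquad \tau_KQ_i(s)^Tx+\tau_KS_i(s)\phi_i(s)+\sum_j\int_{-\tau_j}^0R_{ij}(s,\theta)\phi_j(\theta)\,d\theta .$$ **Hypotheses.** Let $\gamma\in\mathbb R$ and $\epsilon>0$. Let $P\in\mathbb R^{n\times n}$, let $Q_i,S_i\in W^{1,2}([-\tau_i,0];\mathbb R^{n\times n})$ and $R_{ij}\in W^{1,2}([-\tau_i,0]\times[-\tau_j,0];\mathbb R^{n\times n})$ satisfy, for all $i,j$, $$S_i(s)=S_i(s)^T,\quad R_{ij}(s,\theta)=R_{ji}(\theta,s)^T,\quad P=\tau_KQ_i(0)^T+\tau_KS_i(0),\quad Q_j(s)=R_{ij}(0,s)$$ (identities for $R_{ij}$ and its traces hold almost everywhere). Let $Z_0,Z_{1i}\in\mathbb R^{p\times n}$, $Z_{2i}\in W^{1,2}([-\tau_i,0];\mathbb R^{p\times n})$ and $$\mathcal Z(x,\phi_i)=Z_0x+\sum_iZ_{1i}\phi_i(-\tau_i)+\sum_i\int_{-\tau_i}^0Z_{2i}(s)\phi_i(s)\,ds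 .$$ Put $$L_0=A_0P+\sum_i\Big(\tau_KA_iQ_i(-\tau_i)^T+\tfrac12S_i(0)\Big)+B_2Z_0,\qquad L_1=\tfrac1{\tau_K}C_0P+\sum_iC_iQ_i(-\tau_i)^T+\tfrac1{\tau_K}D_2Z_0,$$ $$L_{2i}=C_iS_i(-\tau_i)+\tfrac1{\tau_K}D_2Z_{1i},\qquad L_{3i}=\tau_KA_iS_i(-\tau_i)+B_2Z_{1i},$$ $$D=\begin{bmatrix}-\frac{\gamma}{\tau_K}I&\frac1{\tau_K}D_1&L_1&L_{21}&\cdots&L_{2K}\\ *^T&-\frac{\gamma}{\tau_K}I&B_1^T&0&\cdots&0\\ *^T&*^T&L_0+L_0^T&L_{31}&\cdots&L_{3K}\\ *^T&*^T&*^T&-S_1(-\tau_1)&\cdots&0\\ \vdots&\vdots&\vdots&\vdots&\ddots&\vdots\\ *^T&*^T&*^T&*^T&\cdots&-S_K(-\tau_K)\end{bmatrix}$$ ($*^T$ denotes symmetric completion), $$E_i(s)=\frac1{\tau_K}\begin{bmatrix}C_0Q_i(s)+\sum_jC_jR_{ji}(-\tau_j,s)+D_2Z_{2i}(s)\\0\\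 \tau_K\big(A_0Q_i(s)+\dot Q_i(s)+\sum_jA_jR_{ji}(-\tau_j,s)+B_2Z_{2i}(s)\big)\\0\\ \vdots\\0\end{bmatrix},$$ $$G_{ij}(s,\theta)=\frac{\partial}{\partial s}R_{ij}(s,\theta)+\frac{\partial}{\partial\theta}\big(R_{ji}(\theta,s)^T\big).$$ Suppose that $\langle \mathbf x,\mathcal P_{\{P,Q_i,S_i,R_{ij}\}}\mathbf x\rangle\ge\epsilon\|\mathbf x\|^2$ for all $\mathbf x\in Z_{n,K}$, and that, with $\mathcal D=\mathcal P_{\{D,E_i,\dot S_i,G_{ij}\}}$, $$\Big\langle \mathbf h,\mathcal D\,\mathbf h\Big\rangle\le-\epsilon\,\|(y_1,\phi_i)\|^2_{Z_{n,K}}$$ for all $\mathbf h=((v,w,y_1,y_2),\phi_i)\in Z_{q+m+n(K+1),n,K}$, with $v\in\mathbb R^q$, $w\in\mathbb R^m$, $y_1\in\mathbb R^n$, $y_2\in\mathbb R^{nK}$, such that $\mathcal D\mathbf h\in Z_{q+m+n(K+1),n,K}$ (this last restriction is void when the $\dot S_i$ are bounded). **Conclusion.** For $\mathcal P=\mathcal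 P_{\{P,Q_i,S_i,R_{ij}\}}$, every element of $X$ is $\mathcal P\mathbf z$ for exactly one $\mathbf z\in X$, so that $\mathcal P^{-1}:X\to X$ is defined. Moreover, for every $w\in L_2([0,\infty);\mathbb R^m)$, if $x$ (absolutely continuous on bounded intervals), $u$ and $y$ satisfy the system equations for almost every $t\ge0$, with zero history and with $$u(t)=\mathcal Z\,\mathcal P^{-1}\big(x(t),x(t+\cdot),\dots,x(t+\cdot)\big)\qquad\text{for all }t\ge0,$$ the state $(x(t),x(t+\cdot),\dots,x(t+\cdot))$ lying in $X$, then $y\in L_2$ and $\|y\|_{L_2}\le\gamma\|w\|_{L_2}$. -/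

import Mathlib

open MeasureTheory Set

namespace MultiDelay

noncomputable section

/-- Membership in the Sobolev space `W^{1,2}[a,b]` of a real function of one variable, through its
absolutely continuous representative: `f` is absolutely continuous on `[a,b]` and its (almost
everywhere defined) derivative is square integrable. -/
def W12 (a b : ℝ) (f : ℝ → ℝ) : Prop :=
  AbsolutelyContinuousOnInterval f a b ∧ MemLp (deriv f) 2 (volume.restrict (Icc a b))

/-- Membership in `W^{1,2}([a,b] × [c,d])` of a real function of two variables, through its
representative that is absolutely continuous on almost every line parallel to an axis: `f` and its
two partial derivatives are square integrable on the rectangle. For such a representative the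
trace on an edge, say `θ ↦ f 0 θ` with `b = 0`, is given for almost every `θ` by evaluation. -/
def W12Rect (a b c d : ℝ) (f : ℝ → ℝ → ℝ) : Prop :=
  (∀ᵐ θ ∂(volume.restrict (Icc c d)), AbsolutelyContinuousOnInterval (fun s => f s θ) a b) ∧
  (∀ᵐ s ∂(volume.restrict (Icc a b)), AbsolutelyContinuousOnInterval (fun θ => f s θ) c d) ∧
  MemLp (fun p : ℝ × ℝ => f p.1 p.2) 2 (volume.restrict (Icc a b ×ˢ Icc c d)) ∧
  MemLp (fun p : ℝ × ℝ => deriv (fun s => f s p.2) p.1) 2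
    (volume.restrict (Icc a b ×ˢ Icc c d)) ∧
  MemLp (fun p : ℝ × ℝ => deriv (fun θ => f p.1 θ) p.2) 2
    (volume.restrict (Icc a b ×ˢ Icc c d))

/-- The entrywise derivative of a matrix-valued function. -/
def matDeriv {ι κ : Type*} (M : ℝ → Matrix ι κ ℝ) (s : ℝ) : Matrix ι κ ℝ :=
  Matrix.of fun a b => deriv (fun t => M t a b) s

/-- The largest delay `τ_K`, the delays being listed in increasing order. -/
def tauMax {K : ℕ} [NeZero K] (τ : Fin K → ℝ) : ℝ := τ ⊤

/-! ### The spaces `Z` and `X` -/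

/-- The elements `(x, φ_1, …, φ_K)` of `ℝ^ι × L_2^n[-τ_1,0] × ⋯ × L_2^n[-τ_K,0]` are represented
by functions `φ_i`, of which only the restriction to `[-τ_i,0]` matters; see `MemZ` and `EqZ`. -/
abbrev ZVec (ι : Type*) (n K : ℕ) : Type _ := (ι → ℝ) × (Fin K → ℝ → Fin n → ℝ)

/-- `z` is an element of `Z_{ι,n,K}`: every `φ_i` is square integrable on `[-τ_i,0]`. -/
def MemZ {ι : Type*} {n K : ℕ} (τ : Fin K → ℝ) (z : ZVec ι n K) : Prop :=
  ∀ i, MemLp (z.2 i) 2 (volume.restrict (Icc (-τ i) 0))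

/-- `z` and `z'` are the same element of `Z_{ι,n,K}`. -/
def EqZ {ι : Type*} {n K : ℕ} (τ : Fin K → ℝ) (z z' : ZVec ι n K) : Prop :=
  z.1 = z'.1 ∧ ∀ i, z.2 i =ᵐ[volume.restrict (Icc (-τ i) 0)] z'.2 i

/-- The inner product `τ_K yᵀ x + ∑ i, ∫_{-τ_i}^0 ψ_i(s)ᵀ φ_i(s) ds` of `Z_{ι,n,K}`. -/
def innerZ {ι : Type*} [Fintype ι] {n K : ℕ} [NeZero K] (τ : Fin K → ℝ) (z z' : ZVec ι n K) : ℝ :=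
  tauMax τ * (z.1 ⬝ᵥ z'.1) + ∑ i, ∫ s in (-τ i)..0, z.2 i s ⬝ᵥ z'.2 i s

/-- `‖z‖²` in `Z_{ι,n,K}`. -/
def normSqZ {ι : Type*} [Fintype ι] {n K : ℕ} [NeZero K] (τ : Fin K → ℝ) (z : ZVec ι n K) : ℝ :=
  innerZ τ z z

/-- The state space `X`: every `φ_i` is in `W^{1,2}[-τ_i,0]` and `φ_i(0) = x`. -/
def MemX {n K : ℕ} (τ : Fin K → ℝ) (z : ZVec (Fin n) n K) : Prop :=
  ∀ i, (∀ a, W12 (-τ i) 0 (fun s => z.2 i s a)) ∧ z.2 i 0 = z.1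

/-! ### Operators of the class `P_{P,Q_i,S_i,R_ij}` -/

/-- The parameters `P`, `Q_i`, `S_i`, `R_ij` of an operator on `Z_{ι,n,K}`. -/
structure PQRS (ι : Type*) (n K : ℕ) where
  P : Matrix ι ι ℝ
  Q : Fin K → ℝ → Matrix ι (Fin n) ℝ
  S : Fin K → ℝ → Matrix (Fin n) (Fin n) ℝ
  R : Fin K → Fin K → ℝ → ℝ → Matrix (Fin n) (Fin n) ℝ

/-- The operator `P_{P,Q_i,S_i,R_ij}`. -/
def PQRS.op {ι : Type*} [Fintype ι] {n K : ℕ} [NeZero K] (τ : Fin K → ℝ) (ρ : PQRS ι n K)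
    (z : ZVec ι n K) : ZVec ι n K :=
  (ρ.P.mulVec z.1 + ∑ i, ∫ s in (-τ i)..0, (ρ.Q i s).mulVec (z.2 i s),
   fun i s => tauMax τ • (ρ.Q i s).transpose.mulVec z.1 + tauMax τ • (ρ.S i s).mulVec (z.2 i s)
      + ∑ j, ∫ θ in (-τ j)..0, (ρ.R i j s θ).mulVec (z.2 j θ))

/-- `Q_i`, `S_i` and `R_ij` belong to the Sobolev spaces `W_2[-τ_i,0]`, `W_2[-τ_i,0]` and
`W_2([-τ_i,0] × [-τ_j,0])`. -/
def PQRS.IsSobolev {n K : ℕ} (τ : Fin K → ℝ) (ρ : PQRS (Fin n) n K) : Prop :=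
  (∀ i a b, W12 (-τ i) 0 (fun s => ρ.Q i s a b)) ∧
  (∀ i a b, W12 (-τ i) 0 (fun s => ρ.S i s a b)) ∧
  (∀ i j a b, W12Rect (-τ i) 0 (-τ j) 0 (fun s θ => ρ.R i j s θ a b))

/-- The symmetry and boundary conditions
`S_i(s) = S_i(s)ᵀ`, `R_ij(s,θ) = R_ji(θ,s)ᵀ`, `P = τ_K Q_i(0)ᵀ + τ_K S_i(0)`, `Q_j(s) = R_ij(0,s)`.
The identities for `R_ij`, which is an element of an `L_2` space, and for its trace hold almost
everywhere. -/
structure PQRS.Compatible {n K : ℕ} [NeZero K] (τ : Fin K → ℝ) (ρ : PQRS (Fin n) n K) :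
    Prop where
  S_symm : ∀ i, ∀ s ∈ Icc (-τ i) 0, ρ.S i s = (ρ.S i s).transpose
  R_symm : ∀ i j, ∀ᵐ p : ℝ × ℝ ∂(volume.restrict (Icc (-τ i) 0 ×ˢ Icc (-τ j) 0)),
    ρ.R i j p.1 p.2 = (ρ.R j i p.2 p.1).transpose
  P_eq : ∀ i, ρ.P = tauMax τ • (ρ.Q i 0).transpose + tauMax τ • ρ.S i 0
  Q_eq : ∀ i j, ∀ᵐ s ∂(volume.restrict (Icc (-τ j) 0)), ρ.Q j s = ρ.R i j 0 s

/-- The parameters of `Z : (ψ, φ_i) ↦ Z_0 ψ + ∑ i, Z_{1i} φ_i(-τ_i) + ∑ i, ∫ Z_{2i} φ_i`. -/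
structure ZParam (p n K : ℕ) where
  Z0 : Matrix (Fin p) (Fin n) ℝ
  Z1 : Fin K → Matrix (Fin p) (Fin n) ℝ
  Z2 : Fin K → ℝ → Matrix (Fin p) (Fin n) ℝ

/-- The operator `Z`, to be applied to elements of `X`, whose components are continuous. -/
def ZParam.op {p n K : ℕ} (τ : Fin K → ℝ) (ζ : ZParam p n K) (z : ZVec (Fin n) n K) :
    Fin p → ℝ :=
  ζ.Z0.mulVec z.1 + ∑ i, (ζ.Z1 i).mulVec (z.2 i (-τ i))
    + ∑ i, ∫ s in (-τ i)..0, (ζ.Z2 i s).mulVec (z.2 i s)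

/-! ### The multi-delay system and its closed loop -/

/-- The matrices of the system
`x'(t) = A_0 x(t) + ∑ i, A_i x(t - τ_i) + B_1 w(t) + B_2 u(t)`,
`y(t) = C_0 x(t) + ∑ i, C_i x(t - τ_i) + D_1 w(t) + D_2 u(t)`. -/
structure System (n m p q K : ℕ) where
  A0 : Matrix (Fin n) (Fin n) ℝ
  A : Fin K → Matrix (Fin n) (Fin n) ℝ
  B1 : Matrix (Fin n) (Fin m) ℝ
  B2 : Matrix (Fin n) (Fin p) ℝ
  C0 : Matrix (Fin q) (Fin n) ℝ
  C : Fin K → Matrix (Fin q) (Fin n) ℝ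
  D1 : Matrix (Fin q) (Fin m) ℝ
  D2 : Matrix (Fin q) (Fin p) ℝ

/-- The state `(x(t), x(t + ·), …, x(t + ·))` of the delay system at time `t`. -/
def stateAt {n : ℕ} (K : ℕ) (x : ℝ → Fin n → ℝ) (t : ℝ) : ZVec (Fin n) n K :=
  (x t, fun _ s => x (t + s))

/-- `(x, u, y)` is a solution, in the sense of Carathéodory, of the system with disturbance `w` on
`t ≥ 0` and zero history: `x` is absolutely continuous on bounded intervals and the equations hold
almost everywhere. -/
structure System.IsSolution {n m p q K : ℕ} [NeZero K] (sys : System n m p q K) (τ : Fin K → ℝ)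
    (w : ℝ → Fin m → ℝ) (u : ℝ → Fin p → ℝ) (x : ℝ → Fin n → ℝ) (y : ℝ → Fin q → ℝ) : Prop where
  history : ∀ s ∈ Icc (-tauMax τ) 0, x s = 0
  absCont : ∀ T > 0, ∀ a, AbsolutelyContinuousOnInterval (fun t => x t a) 0 T
  state_eq : ∀ᵐ t ∂(volume.restrict (Ici (0 : ℝ))),
    HasDerivAt x (sys.A0.mulVec (x t) + ∑ i, (sys.A i).mulVec (x (t - τ i))
      + sys.B1.mulVec (w t) + sys.B2.mulVec (u t)) t
  output_eq : ∀ᵐ t ∂(volume.restrict (Ici (0 : ℝ))),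
    y t = sys.C0.mulVec (x t) + ∑ i, (sys.C i).mulVec (x (t - τ i))
      + sys.D1.mulVec (w t) + sys.D2.mulVec (u t)

/-- The control law `u(t) = Z P⁻¹ (x(t), x(t + ·))` for `t ≥ 0`, where `P⁻¹ : X → X`: one has
`u(t) = Z z` for an element `z` of `X` with `P z = (x(t), x(t + ·))`. -/
def IsFeedback {n p K : ℕ} [NeZero K] (τ : Fin K → ℝ) (ρ : PQRS (Fin n) n K)
    (ζ : ZParam p n K) (x : ℝ → Fin n → ℝ) (u : ℝ → Fin p → ℝ) : Prop :=
  ∀ t, 0 ≤ t → ∃ z, MemX τ z ∧ EqZ τ (ρ.op τ z) (stateAt K x t) ∧ u t = ζ.op τ z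

/-! ### The operator `P_{D,E_i,Ṡ_i,G_ij}` of the synthesis condition -/

section Synthesis

variable {n m p q K : ℕ} [NeZero K] (sys : System n m p q K) (τ : Fin K → ℝ)
  (ρ : PQRS (Fin n) n K) (ζ : ZParam p n K)

def L0 : Matrix (Fin n) (Fin n) ℝ :=
  sys.A0 * ρ.P + ∑ i, (tauMax τ • (sys.A i * (ρ.Q i (-τ i)).transpose) + (1 / 2 : ℝ) • ρ.S i 0)
    + sys.B2 * ζ.Z0

def L1 : Matrix (Fin q) (Fin n) ℝ :=
  (1 / tauMax τ) • (sys.C0 * ρ.P) + ∑ i, sys.C i * (ρ.Q i (-τ i)).transpose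
    + (1 / tauMax τ) • (sys.D2 * ζ.Z0)

def L2 (i : Fin K) : Matrix (Fin q) (Fin n) ℝ :=
  sys.C i * ρ.S i (-τ i) + (1 / tauMax τ) • (sys.D2 * ζ.Z1 i)

def L3 (i : Fin K) : Matrix (Fin n) (Fin n) ℝ :=
  tauMax τ • (sys.A i * ρ.S i (-τ i)) + sys.B2 * ζ.Z1 i

/-- The index set of the vectors `(v, w, y_1, y_2) ∈ ℝ^{q+m+n(K+1)}`, where `y_2` consists of `K`
blocks of size `n`. -/
abbrev HIdx (n m q K : ℕ) : Type := Fin q ⊕ Fin m ⊕ Fin n ⊕ (Fin n × Fin K)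

/-- The row `[M_1 ⋯ M_K]` of blocks. -/
def blockRow {r n K : ℕ} (M : Fin K → Matrix (Fin r) (Fin n) ℝ) :
    Matrix (Fin r) (Fin n × Fin K) ℝ :=
  Matrix.of fun a b => M b.2 a b.1

/-- The symmetric block matrix `[[a, b], [bᵀ, c]]`. -/
def symBlocks {α β : Type*} (a : Matrix α α ℝ) (b : Matrix α β ℝ) (c : Matrix β β ℝ) :
    Matrix (α ⊕ β) (α ⊕ β) ℝ :=
  Matrix.fromBlocks a b b.transpose c

def Dmat (γ : ℝ) : Matrix (HIdx n m q K) (HIdx n m q K) ℝ :=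
  symBlocks (-(γ / tauMax τ) • (1 : Matrix (Fin q) (Fin q) ℝ))
    (Matrix.fromCols ((1 / tauMax τ) • sys.D1)
      (Matrix.fromCols (L1 sys τ ρ ζ) (blockRow (L2 sys τ ρ ζ))))
    (symBlocks (-(γ / tauMax τ) • (1 : Matrix (Fin m) (Fin m) ℝ))
      (Matrix.fromCols sys.B1.transpose 0)
      (symBlocks (L0 sys τ ρ ζ + (L0 sys τ ρ ζ).transpose)
        (blockRow (L3 sys τ ρ ζ))
        (Matrix.blockDiagonal fun i => -ρ.S i (-τ i))))

def Emat (i : Fin K) (s : ℝ) : Matrix (HIdx n m q K) (Fin n) ℝ :=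
  (1 / tauMax τ) •
    Matrix.fromRows (sys.C0 * ρ.Q i s + ∑ j, sys.C j * ρ.R j i (-τ j) s + sys.D2 * ζ.Z2 i s)
      (Matrix.fromRows 0
        (Matrix.fromRows
          (tauMax τ • (sys.A0 * ρ.Q i s + matDeriv (ρ.Q i) s
            + ∑ j, sys.A j * ρ.R j i (-τ j) s + sys.B2 * ζ.Z2 i s))
          0))

/-- `G_ij(s,θ) = ∂/∂s R_ij(s,θ) + ∂/∂θ (R_ji(θ,s)ᵀ)`. -/
def Gmat (i j : Fin K) (s θ : ℝ) : Matrix (Fin n) (Fin n) ℝ :=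
  matDeriv (fun σ => ρ.R i j σ θ) s + matDeriv (fun σ => (ρ.R j i σ s).transpose) θ

/-- The parameters `{D, E_i, Ṡ_i, G_ij}`. -/
def synthesisParam (γ : ℝ) : PQRS (HIdx n m q K) n K where
  P := Dmat sys τ ρ ζ γ
  Q := Emat sys τ ρ ζ
  S := fun i => matDeriv (ρ.S i)
  R := Gmat ρ

end Synthesis

/-- The element `((v, w, y_1, y_2), φ_i)` of `Z_{q+m+n(K+1),n,K}`. -/
def bigVec {n m q K : ℕ} (v : Fin q → ℝ) (w : Fin m → ℝ) (y₁ : Fin n → ℝ)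
    (y₂ : Fin n × Fin K → ℝ) (φ : Fin K → ℝ → Fin n → ℝ) : ZVec (HIdx n m q K) n K :=
  (Sum.elim v (Sum.elim w (Sum.elim y₁ y₂)), φ)

/-! ### Signals -/

/-- `f ∈ L_2([0,∞); ℝ^r)`. -/
def MemL2 {r : ℕ} (f : ℝ → Fin r → ℝ) : Prop :=
  MemLp (fun t => WithLp.toLp 2 (f t)) 2 (volume.restrict (Ici (0 : ℝ)))

/-- The norm of `L_2([0,∞); ℝ^r)`, for the Euclidean norm on `ℝ^r`, with values in `[0,∞]`. -/
def l2Norm {r : ℕ} (f : ℝ → Fin r → ℝ) : ENNReal :=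
  eLpNorm (fun t => WithLp.toLp 2 (f t)) 2 (volume.restrict (Ici (0 : ℝ)))

end

end MultiDelay

open MultiDelay

namespace MultiDelay

/-! ### Square integrable functions -/

/-! The storage function is V(t) = ⟨𝐱(t), 𝒫⁻¹𝐱(t)⟩, where 𝐱(t) is the state. Put 𝐳 = 𝒫⁻¹𝐱 = (z,
φ_i). State, control and output are then linear in 𝐳 and w, and integration by parts in the delay
variable shows that the form of 𝒟 at ((v, w, z, φ_i(-τ_i)), φ_i) equals V̇ + 2vᵀy - γ|v|² - γ|w|²
(`innerZ_synthesisVec`). Its nonpositivity gives V̇ ≤ γ|v|² + γ|w|² - 2vᵀy for every v. For γ > 0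
the choice v = y/γ yields |y|² ≤ γ²|w|² - γV̇, and integrating from V(0) = 0 with V ≥ 0 gives the
gain. For γ = 0 the freedom of v forces y = 0; for γ < 0 the condition can hold only if q = 0.

The inverse comes from Hilbert space theory: 𝒫 is symmetric and coercive, so it has a bounded
symmetric inverse on a model of Z (`exists_hilbert_inverse`). Symmetry of P follows from a
comparison of traces of R_ii at the corner (0,0) (`W12Rect.corner_eq`). That 𝒫⁻¹ preserves X rests
on the pointwise bound ε|v|² ≤ τ_K vᵀS_i(s)v (`le_dotProduct_S`), found by testing coercivity on
shrinking intervals: φ_i can then be solved for pointwise and inherits W^{1,2} regularity from the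
remaining terms (`exists_memX_op_eq`).

Regularity in time is the last obstacle, since w is only square integrable. The inverse makes 𝐳(t)
continuous in the Hilbert norm, but 𝒵 contains the point values φ_i(-τ_i), which are recovered from
the equation 𝒫𝐳 = 𝐱 (`continuousOn_feedback`). Hence u is continuous, x is locally W^{1,2}, and V is
absolutely continuous (`absCont_storage`). Its derivative at almost every t is computed against the
frozen element 𝐳(t) of X, with a quadratic remainder (`hasDerivAt_storage`). -/

theorem intervalIntegral_eq_setIntegral_Icc {E : Type*} [NormedAddCommGroup E] [NormedSpace ℝ E]
    {a b : ℝ} (hab : a ≤ b) (f : ℝ → E) : ∫ s in a..b, f s = ∫ s in Icc a b, f s := by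
  rw [intervalIntegral.integral_of_le hab, integral_Icc_eq_integral_Ioc]

theorem MemLp.integrable_mul_two {α : Type*} [MeasurableSpace α] {μ : Measure α} {f g : α → ℝ}
    (hf : MemLp f 2 μ) (hg : MemLp g 2 μ) : Integrable (fun x => f x * g x) μ :=
  hf.integrable_mul hg

/-- The quadratic t ↦ ∫ (f + t g)² is nonnegative, so its discriminant is nonpositive. -/
theorem sq_integral_mul_le {α : Type*} [MeasurableSpace α] {μ : Measure α} {f g : α → ℝ}
    (hf : MemLp f 2 μ) (hg : MemLp g 2 μ) :
    (∫ x, f x * g x ∂μ) ^ 2 ≤ (∫ x, f x ^ 2 ∂μ) * ∫ x, g x ^ 2 ∂μ := by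
  have hfg := MemLp.integrable_mul_two hf hg
  have key : ∀ t : ℝ, 0 ≤ (∫ x, g x ^ 2 ∂μ) * (t * t) + (2 * ∫ x, f x * g x ∂μ) * t
      + ∫ x, f x ^ 2 ∂μ := by
    intro t
    have h : ∫ x, (f x + t * g x) ^ 2 ∂μ = (∫ x, g x ^ 2 ∂μ) * (t * t)
        + (2 * ∫ x, f x * g x ∂μ) * t + ∫ x, f x ^ 2 ∂μ := by
      have : (fun x => (f x + t * g x) ^ 2)
          = fun x => ((t * t) * g x ^ 2 + (2 * t) * (f x * g x)) + f x ^ 2 := by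
        funext x; ring
      have hi : Integrable (fun x => (t * t) * g x ^ 2 + (2 * t) * (f x * g x)) μ :=
        (hg.integrable_sq.const_mul _).add (hfg.const_mul _)
      rw [this, integral_add hi hf.integrable_sq, integral_add (hg.integrable_sq.const_mul _) (hfg.const_mul _),
        integral_const_mul, integral_const_mul]
      ring
    rw [← h]
    exact integral_nonneg fun x => sq_nonneg _
  have := discrim_le_zero key
  rw [discrim] at this
  nlinarith

theorem memLp_prod_mul {α β : Type*} [MeasurableSpace α] [MeasurableSpace β] {μ : Measure α}
    {ν : Measure β} [SFinite μ] [SFinite ν] {f : α → ℝ} {g : β → ℝ}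
    (hf : MemLp f 2 μ) (hg : MemLp g 2 ν) :
    MemLp (fun p : α × β => f p.1 * g p.2) 2 (μ.prod ν) := by
  rw [memLp_two_iff_integrable_sq]
  · simpa only [mul_pow] using hf.integrable_sq.mul_prod hg.integrable_sq
  · exact hf.1.comp_fst.mul hg.1.comp_snd

theorem integrable_mul_kernel_mul {α β : Type*} [MeasurableSpace α] [MeasurableSpace β]
    {μ : Measure α} {ν : Measure β} [SFinite μ] [SFinite ν] {k : α × β → ℝ} {f : α → ℝ} {g : β → ℝ}
    (hk : MemLp k 2 (μ.prod ν)) (hf : MemLp f 2 μ) (hg : MemLp g 2 ν) :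
    Integrable (fun p : α × β => f p.1 * (k p * g p.2)) (μ.prod ν) := by
  have := MemLp.integrable_mul_two hk (memLp_prod_mul hf hg)
  refine this.congr (Filter.Eventually.of_forall fun p => ?_)
  simp only
  ring

theorem memLp_slice {α β : Type*} [MeasurableSpace α] [MeasurableSpace β]
    {μ : Measure α} {ν : Measure β} [SFinite μ] [SFinite ν] {k : α × β → ℝ}
    (hk : MemLp k 2 (μ.prod ν)) : ∀ᵐ s ∂μ, MemLp (fun θ => k (s, θ)) 2 ν := by
  have h1 := hk.integrable_sq.prod_right_ae
  have h2 := hk.1.prodMk_left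
  filter_upwards [h1, h2] with s hs1 hs2
  exact (memLp_two_iff_integrable_sq hs2).2 hs1

/-- Hilbert–Schmidt bound: Cauchy–Schwarz on almost every slice dominates the square of the integral
by ‖k(s,·)‖² ‖f‖², which is integrable in s. -/
theorem memLp_integral_kernel {α β : Type*} [MeasurableSpace α] [MeasurableSpace β]
    {μ : Measure α} {ν : Measure β} [SFinite μ] [SFinite ν] {k : α × β → ℝ} {f : β → ℝ}
    (hk : MemLp k 2 (μ.prod ν)) (hf : MemLp f 2 ν) :
    MemLp (fun s => ∫ θ, k (s, θ) * f θ ∂ν) 2 μ := by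
  have hm : AEStronglyMeasurable (fun s => ∫ θ, k (s, θ) * f θ ∂ν) μ :=
    (hk.1.mul hf.1.comp_snd).integral_prod_right'
  rw [memLp_two_iff_integrable_sq hm]
  refine (hk.integrable_sq.integral_prod_left.mul_const (∫ θ, f θ ^ 2 ∂ν)).mono' (hm.pow 2) ?_
  filter_upwards [memLp_slice hk] with s hs
  rw [Real.norm_of_nonneg (sq_nonneg _)]
  exact sq_integral_mul_le hs hf

/-! ### Absolutely continuous functions and `W^{1,2}` -/

/-- Total variation over a family of short intervals is dominated termwise. This comparison later
gives absolute continuity of products, of solutions of linear systems and of the storage function.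
-/
theorem absolutelyContinuousOnInterval_of_abs_sub_le {ι : Type*} (t : Finset ι) {f : ℝ → ℝ}
    {g : ι → ℝ → ℝ} {C a b : ℝ} (hg : ∀ k ∈ t, AbsolutelyContinuousOnInterval (g k) a b)
    (h : ∀ s ∈ uIcc a b, ∀ s' ∈ uIcc a b, |f s - f s'| ≤ C * ∑ k ∈ t, |g k s - g k s'|) :
    AbsolutelyContinuousOnInterval f a b := by
  have hlim : Filter.Tendsto (fun E : ℕ × (ℕ → ℝ × ℝ) => C * ∑ k ∈ t,
      ∑ i ∈ Finset.range E.1, dist (g k (E.2 i).1) (g k (E.2 i).2))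
      (AbsolutelyContinuousOnInterval.totalLengthFilter ⊓
        Filter.principal (AbsolutelyContinuousOnInterval.disjWithin a b)) (nhds 0) := by
    have := (tendsto_finsetSum t fun k hk => hg k hk).const_mul C
    simpa using this
  refine squeeze_zero' (Filter.Eventually.of_forall fun E =>
    Finset.sum_nonneg fun i _ => dist_nonneg) ?_ hlim
  refine Filter.Eventually.filter_mono inf_le_right ?_
  rw [Filter.eventually_principal]
  intro E hE
  rw [Finset.sum_comm, Finset.mul_sum]
  refine Finset.sum_le_sum fun i hi => ?_
  simpa [Real.dist_eq] using h _ (hE.1 i hi).1 _ (hE.1 i hi).2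

/-- Pass to the limit in difference quotients. Differentiability of f is not needed, because `deriv`
is 0 where it fails. -/
theorem abs_deriv_le_of_abs_sub_le {ι : Type*} (t : Finset ι) {f : ℝ → ℝ} {g : ι → ℝ → ℝ}
    {C s : ℝ} {U : Set ℝ} (hU : U ∈ nhds s) (hC : 0 ≤ C)
    (hg : ∀ k ∈ t, DifferentiableAt ℝ (g k) s)
    (h : ∀ s' ∈ U, |f s' - f s| ≤ C * ∑ k ∈ t, |g k s' - g k s|) :
    |deriv f s| ≤ C * ∑ k ∈ t, |deriv (g k) s| := by
  by_cases hf : DifferentiableAt ℝ f s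
  · have h1 : Filter.Tendsto (fun s' => |slope f s s'|) (nhdsWithin s {s}ᶜ)
        (nhds |deriv f s|) := (hasDerivAt_iff_tendsto_slope.1 hf.hasDerivAt).abs
    have h2 : Filter.Tendsto (fun s' => C * ∑ k ∈ t, |slope (g k) s s'|) (nhdsWithin s {s}ᶜ)
        (nhds (C * ∑ k ∈ t, |deriv (g k) s|)) :=
      (tendsto_finsetSum t fun k hk =>
        (hasDerivAt_iff_tendsto_slope.1 (hg k hk).hasDerivAt).abs).const_mul C
    refine le_of_tendsto_of_tendsto h1 h2 ?_
    filter_upwards [nhdsWithin_le_nhds hU] with s' hs'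
    have := mul_le_mul_of_nonneg_left (h s' hs') (abs_nonneg (s' - s)⁻¹)
    simp only [slope, vsub_eq_sub, smul_eq_mul, abs_mul, ← Finset.mul_sum]
    linarith
  · rw [deriv_zero_of_not_differentiableAt hf, abs_zero]
    exact mul_nonneg hC (Finset.sum_nonneg fun _ _ => abs_nonneg _)

theorem ae_mem_Ioo (a b : ℝ) : ∀ᵐ s ∂(volume.restrict (Icc a b)), s ∈ Ioo a b := by
  rw [← Measure.restrict_congr_set (Ioo_ae_eq_Icc (a := a) (b := b) (μ := volume))]
  exact ae_restrict_mem measurableSet_Ioo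

theorem ae_differentiableAt_of_absCont {f : ℝ → ℝ} {a b : ℝ} (hab : a ≤ b)
    (hf : AbsolutelyContinuousOnInterval f a b) :
    ∀ᵐ s ∂(volume.restrict (Icc a b)), DifferentiableAt ℝ f s := by
  rw [ae_restrict_iff' measurableSet_Icc]
  simpa [uIcc_of_le hab] using hf.ae_differentiableAt

/-! ### Closure properties of one-dimensional Sobolev functions -/

namespace W12

variable {a b : ℝ} {f g : ℝ → ℝ}

theorem continuousOn (hab : a ≤ b) (hf : W12 a b f) : ContinuousOn f (Icc a b) := by
  simpa [uIcc_of_le hab] using hf.1.continuousOn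

theorem exists_bound (hab : a ≤ b) (hf : W12 a b f) :
    ∃ C, 0 ≤ C ∧ ∀ s ∈ Icc a b, |f s| ≤ C := by
  obtain ⟨C, hC⟩ := hf.1.exists_bound
  rw [uIcc_of_le hab] at hC
  exact ⟨C, (norm_nonneg _).trans (hC a (left_mem_Icc.2 hab)), hC⟩

theorem _root_.MultiDelay.memLp_of_continuousOn_Icc {f : ℝ → ℝ} {a b : ℝ}
    (hf : ContinuousOn f (Icc a b)) (p : ENNReal) : MemLp f p (volume.restrict (Icc a b)) := by
  obtain ⟨C, hC⟩ := isCompact_Icc.exists_bound_of_continuousOn hf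
  refine MemLp.of_bound (hf.aestronglyMeasurable measurableSet_Icc) C ?_
  filter_upwards [ae_restrict_mem measurableSet_Icc] with s hs using hC s hs

theorem memLp (hab : a ≤ b) (hf : W12 a b f) : MemLp f 2 (volume.restrict (Icc a b)) :=
  memLp_of_continuousOn_Icc (hf.continuousOn hab) 2

/-- One domination principle for both halves of membership: increments control absolute continuity,
and their quotients control the derivative in L². The algebraic closure properties below are
instances. -/
theorem of_abs_sub_le {ι : Type*} (t : Finset ι) {g : ι → ℝ → ℝ} {C : ℝ} (hab : a ≤ b)
    (hC : 0 ≤ C) (hg : ∀ k ∈ t, W12 a b (g k))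
    (h : ∀ s ∈ Icc a b, ∀ s' ∈ Icc a b, |f s - f s'| ≤ C * ∑ k ∈ t, |g k s - g k s'|) :
    W12 a b f := by
  refine ⟨absolutelyContinuousOnInterval_of_abs_sub_le t (fun k hk => (hg k hk).1)
    (by simpa [uIcc_of_le hab] using h), ?_⟩
  have hsum : MemLp (fun s => C * ∑ k ∈ t, |deriv (g k) s|) 2 (volume.restrict (Icc a b)) :=
    (memLp_finsetSum t fun k hk => (hg k hk).2.abs).const_mul C
  refine hsum.mono' (aestronglyMeasurable_deriv f _) ?_
  have hd : ∀ᵐ s ∂(volume.restrict (Icc a b)), ∀ k ∈ t, DifferentiableAt ℝ (g k) s := by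
    rw [Filter.eventually_all_finset]
    exact fun k hk => ae_differentiableAt_of_absCont hab (hg k hk).1
  filter_upwards [hd, ae_mem_Ioo a b] with s hs hs'
  exact abs_deriv_le_of_abs_sub_le t (Ioo_mem_nhds hs'.1 hs'.2) hC hs fun s'' h'' =>
    h s'' (Ioo_subset_Icc_self h'') s (Ioo_subset_Icc_self hs')

theorem const (hab : a ≤ b) (c : ℝ) : W12 a b (fun _ => c) :=
  of_abs_sub_le (∅ : Finset (Fin 0)) (C := 0) (g := fun _ _ => 0) hab le_rfl (by simp) (by simp)

theorem sum {ι : Type*} (t : Finset ι) {g : ι → ℝ → ℝ} (hab : a ≤ b)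
    (hg : ∀ k ∈ t, W12 a b (g k)) : W12 a b (fun s => ∑ k ∈ t, g k s) := by
  refine of_abs_sub_le t hab zero_le_one hg fun s _ s' _ => ?_
  rw [← Finset.sum_sub_distrib, one_mul]
  exact Finset.abs_sum_le_sum_abs _ _

theorem add (hab : a ≤ b) (hf : W12 a b f) (hg : W12 a b g) : W12 a b (fun s => f s + g s) := by
  have := sum (Finset.univ : Finset (Fin 2)) (g := ![f, g]) hab
    (by simp [Fin.forall_fin_two, hf, hg])
  simpa using this

theorem mul (hab : a ≤ b) (hf : W12 a b f) (hg : W12 a b g) : W12 a b (fun s => f s * g s) := by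
  obtain ⟨C, hC0, hC⟩ := hf.exists_bound hab
  obtain ⟨D, hD0, hD⟩ := hg.exists_bound hab
  refine of_abs_sub_le (Finset.univ : Finset (Fin 2)) (g := ![f, g]) (C := C + D) hab
    (by positivity) (by simp [Fin.forall_fin_two, hf, hg]) fun s hs s' hs' => ?_
  simp only [Fin.sum_univ_two, Matrix.cons_val_zero, Matrix.cons_val_one]
  have e : f s * g s - f s' * g s' = f s * (g s - g s') + (f s - f s') * g s' := by ring
  have h1 := abs_add_le (f s * (g s - g s')) ((f s - f s') * g s')
  rw [abs_mul, abs_mul] at h1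
  rw [e]
  have := mul_le_mul_of_nonneg_right (hC s hs) (abs_nonneg (g s - g s'))
  have := mul_le_mul_of_nonneg_left (hD s' hs') (abs_nonneg (f s - f s'))
  nlinarith [mul_nonneg hC0 (abs_nonneg (f s - f s')), mul_nonneg hD0 (abs_nonneg (g s - g s'))]

theorem const_mul (hab : a ≤ b) (c : ℝ) (hf : W12 a b f) : W12 a b (fun s => c * f s) :=
  mul hab (const hab c) hf

theorem congr (hab : a ≤ b) (hf : W12 a b f) (h : ∀ s ∈ Icc a b, f s = g s) : W12 a b g := by
  refine of_abs_sub_le (Finset.univ : Finset (Fin 1)) (g := fun _ => f) hab zero_le_one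
    (fun _ _ => hf) fun s hs s' hs' => ?_
  simp [h s hs, h s' hs']

theorem ae_differentiableAt (hab : a ≤ b) (hf : W12 a b f) :
    ∀ᵐ s ∂(volume.restrict (Icc a b)), DifferentiableAt ℝ f s :=
  ae_differentiableAt_of_absCont hab hf.1

end W12

/-! ### Primitives of square integrable functions -/

theorem intervalIntegrable_of_memLp_two {f : ℝ → ℝ} {a b : ℝ} (hab : a ≤ b)
    (hf : MemLp f 2 (volume.restrict (Icc a b))) : IntervalIntegrable f volume a b := by
  rw [intervalIntegrable_iff_integrableOn_Icc_of_le hab]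
  exact hf.integrable (by norm_num)

/-- Lebesgue differentiation, with the primitive based at the right endpoint b because the traces of
the kernels are prescribed at 0. -/
theorem ae_hasDerivAt_of_eq_integral {F f : ℝ → ℝ} {a b : ℝ} (hab : a ≤ b)
    (hf : IntervalIntegrable f volume a b)
    (hF : ∀ s ∈ Icc a b, F s = F b - ∫ σ in s..b, f σ) :
    ∀ᵐ s ∂(volume.restrict (Icc a b)), HasDerivAt F (f s) s := by
  have h1 : ∀ᵐ s ∂(volume.restrict (Icc a b)), HasDerivAt (fun x => ∫ σ in b..x, f σ) (f s) s := by
    rw [ae_restrict_iff' measurableSet_Icc]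
    filter_upwards [hf.ae_hasDerivAt_integral] with s hs hs'
    exact hs (by rwa [uIcc_of_le hab]) b (by simp)
  filter_upwards [h1, ae_mem_Ioo a b] with s hs hs'
  refine (hs.const_add (F b)).congr_of_eventuallyEq ?_
  filter_upwards [Ioo_mem_nhds hs'.1 hs'.2] with r hr
  rw [hF r (Ioo_subset_Icc_self hr), intervalIntegral.integral_symm]
  ring

theorem W12.of_eq_integral {F f : ℝ → ℝ} {a b : ℝ} (hab : a ≤ b)
    (hf : MemLp f 2 (volume.restrict (Icc a b)))
    (hF : ∀ s ∈ Icc a b, F s = F b - ∫ σ in s..b, f σ) : W12 a b F := by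
  have hi := intervalIntegrable_of_memLp_two hab hf
  refine ⟨?_, ?_⟩
  · refine absolutelyContinuousOnInterval_of_abs_sub_le (Finset.univ : Finset (Fin 1)) (C := 1)
      (g := fun _ x => ∫ σ in b..x, f σ) (fun _ _ =>
      hi.absolutelyContinuousOnInterval_intervalIntegral (by simp)) ?_
    rw [uIcc_of_le hab]
    intro s hs s' hs'
    rw [hF s hs, hF s' hs', intervalIntegral.integral_symm, intervalIntegral.integral_symm s']
    simp
  · refine hf.ae_eq ?_
    filter_upwards [ae_hasDerivAt_of_eq_integral hab hi hF] with s hs using hs.deriv.symm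

end MultiDelay

namespace MultiDelay

/-! ### A Hilbert space model of `Z` -/

/-- W is a bare set of representatives and A is not assumed linear or bounded. Symmetry tested
against the surjection J forces linearity and well-definedness on H, Hellinger–Toeplitz gives
continuity, and Lax–Milgram gives the inverse. -/
theorem exists_inverse_of_symmetric_coercive {H W : Type*} [NormedAddCommGroup H]
    [InnerProductSpace ℝ H] [CompleteSpace H] (J A : W → H) (hJ : Function.Surjective J)
    (hsymm : ∀ z z', inner ℝ (A z) (J z') = inner ℝ (J z) (A z')) {ε : ℝ} (hε : 0 < ε)
    (hco : ∀ z, ε * ‖J z‖ ^ 2 ≤ inner ℝ (J z) (A z)) :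
    ∃ Q : H →L[ℝ] H, (∀ h h', inner ℝ (Q h) h' = inner ℝ h (Q h')) ∧ (∀ z, Q (A z) = J z) ∧
      Function.Surjective A := by
  set r := Function.surjInv hJ with hr
  have hJr : ∀ h, J (r h) = h := Function.surjInv_eq hJ
  have hP : ∀ h h', inner ℝ (A (r h)) h' = inner ℝ h (A (r h')) := by
    intro h h'
    have := hsymm (r h) (r h')
    rwa [hJr, hJr] at this
  let P : H →ₗ[ℝ] H :=
    { toFun := fun h => A (r h)
      map_add' := fun h₁ h₂ => by
        refine ext_inner_right ℝ fun v => ?_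
        rw [inner_add_left, hP, hP, hP, inner_add_left]
      map_smul' := fun c h => by
        refine ext_inner_right ℝ fun v => ?_
        rw [RingHom.id_apply, real_inner_smul_left, hP, hP, real_inner_smul_left] }
  have hPs : P.IsSymmetric := hP
  -- Hellinger–Toeplitz: an everywhere defined symmetric operator is bounded.
  let Pc : H →L[ℝ] H := ⟨P, hPs.continuous⟩
  have hAP : ∀ z, A z = Pc (J z) := by
    intro z
    refine ext_inner_right ℝ fun v => ?_
    have h1 := hsymm z (r v)
    rw [hJr] at h1
    rw [h1]
    exact (hP (J z) v).symm
  let B : H →L[ℝ] H →L[ℝ] ℝ := (innerSL ℝ).comp Pc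
  have hB : IsCoercive B := by
    refine ⟨ε, hε, fun u => ?_⟩
    have h1 := hco (r u)
    rw [hJr] at h1
    have h2 : B u u = inner ℝ u (A (r u)) := hP u u
    rw [h2]
    linarith
  have he : ∀ h, hB.continuousLinearEquivOfBilin h = Pc h := fun h =>
    (hB.unique_continuousLinearEquivOfBilin (f := Pc h) fun w => rfl).symm
  have hQA : ∀ z, hB.continuousLinearEquivOfBilin.symm (A z) = J z := by
    intro z
    rw [hAP z, ← he, ContinuousLinearEquiv.symm_apply_apply]
  have hAs : Function.Surjective A := fun h =>
    ⟨r (hB.continuousLinearEquivOfBilin.symm h), by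
      rw [hAP, hJr, ← he, ContinuousLinearEquiv.apply_symm_apply]⟩
  refine ⟨hB.continuousLinearEquivOfBilin.symm, fun h h' => ?_, hQA, hAs⟩
  obtain ⟨z, rfl⟩ := hAs h
  obtain ⟨z', rfl⟩ := hAs h'
  simp only [ContinuousLinearEquiv.coe_coe, hQA]
  exact (hsymm z z').symm

variable {n K : ℕ} {τ : Fin K → ℝ}

theorem MemZ.eval {ι : Type*} {z : ZVec ι n K} (hz : MemZ τ z) (i : Fin K) (a : Fin n) :
    MemLp (fun s => z.2 i s a) 2 (volume.restrict (Icc (-τ i) 0)) :=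
  memLp_pi_iff.1 (hz i) a

theorem memZ_iff {ι : Type*} {z : ZVec ι n K} : MemZ τ z ↔
    ∀ i a, MemLp (fun s => z.2 i s a) 2 (volume.restrict (Icc (-τ i) 0)) :=
  ⟨fun hz => hz.eval, fun h i => memLp_pi_iff.2 (h i)⟩

theorem MemZ.sub {ι : Type*} {z z' : ZVec ι n K} (hz : MemZ τ z) (hz' : MemZ τ z') :
    MemZ τ (z - z') := fun i => (hz i).sub (hz' i)

/-- A Hilbert space isometric to `Z_{n,K}`. -/
abbrev ZHilbert (n : ℕ) {K : ℕ} (τ : Fin K → ℝ) : Type :=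
  WithLp 2 (EuclideanSpace ℝ (Fin n) ×
    PiLp 2 fun k : Fin K × Fin n => Lp ℝ 2 (volume.restrict (Icc (-τ k.1) 0)))

noncomputable section

variable [NeZero K]

/-- The element of the Hilbert space model given by an element of `Z_{n,K}`. -/
def toHilbert (z : ZVec (Fin n) n K) (hz : MemZ τ z) : ZHilbert n τ :=
  WithLp.toLp 2 (WithLp.toLp 2 (√(tauMax τ) • z.1),
    WithLp.toLp 2 fun k => (hz.eval k.1 k.2).toLp)

theorem inner_toHilbert (hτ : ∀ i, 0 < τ i) {z z' : ZVec (Fin n) n K} (hz : MemZ τ z)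
    (hz' : MemZ τ z') : inner ℝ (toHilbert z hz) (toHilbert z' hz') = innerZ τ z z' := by
  have hT : 0 ≤ tauMax τ := (hτ _).le
  rw [WithLp.prod_inner_apply, innerZ]
  congr 1
  · simp only [toHilbert, PiLp.inner_apply, dotProduct, Finset.mul_sum]
    refine Finset.sum_congr rfl fun a _ => ?_
    simp only [Pi.smul_apply, smul_eq_mul, RCLike.inner_apply, conj_trivial]
    calc _ = (√(tauMax τ) * √(tauMax τ)) * (z.1 a * z'.1 a) := by ring
      _ = _ := by rw [Real.mul_self_sqrt hT]
  · simp only [toHilbert, PiLp.inner_apply, Fintype.sum_prod_type]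
    refine Finset.sum_congr rfl fun i _ => ?_
    rw [intervalIntegral_eq_setIntegral_Icc (by linarith [hτ i])]
    simp only [dotProduct]
    rw [integral_finsetSum _ fun a _ => MemLp.integrable_mul_two (hz.eval i a) (hz'.eval i a)]
    refine Finset.sum_congr rfl fun a _ => ?_
    rw [L2.inner_def]
    refine integral_congr_ae ?_
    filter_upwards [(hz.eval i a).coeFn_toLp, (hz'.eval i a).coeFn_toLp] with s h1 h2
    simp only [h1, h2, RCLike.inner_apply, conj_trivial]
    ring

theorem toHilbert_sub {z z' : ZVec (Fin n) n K} (hz : MemZ τ z) (hz' : MemZ τ z') :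
    toHilbert z hz - toHilbert z' hz' = toHilbert (z - z') (hz.sub hz') := by
  simp only [toHilbert]
  rw [← WithLp.toLp_sub, Prod.mk_sub_mk, ← WithLp.toLp_sub, ← WithLp.toLp_sub, Prod.fst_sub,
    smul_sub]
  rfl

theorem toHilbert_surjective (hτ : ∀ i, 0 < τ i) (h : ZHilbert n τ) :
    ∃ (z : ZVec (Fin n) n K) (hz : MemZ τ z), toHilbert z hz = h := by
  have hT : 0 < √(tauMax τ) := Real.sqrt_pos.2 (hτ _)
  refine ⟨((√(tauMax τ))⁻¹ • h.fst.ofLp, fun i s a => h.snd (i, a) s),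
    memZ_iff.2 fun i a => Lp.memLp _, ?_⟩
  simp only [toHilbert, smul_smul, mul_inv_cancel₀ hT.ne', one_smul]
  have : (fun k : Fin K × Fin n => MemLp.toLp (fun s => h.snd (k.1, k.2) s)
      (Lp.memLp (h.snd (k.1, k.2)))) = h.snd.ofLp := by
    funext k
    exact Lp.toLp_coeFn _ _
  rw [this]
  rfl

theorem toHilbert_eq_iff (hτ : ∀ i, 0 < τ i) {z z' : ZVec (Fin n) n K} (hz : MemZ τ z)
    (hz' : MemZ τ z') : toHilbert z hz = toHilbert z' hz' ↔ EqZ τ z z' := by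
  have hT : 0 < √(tauMax τ) := Real.sqrt_pos.2 (hτ _)
  constructor
  · intro h
    have h1 : √(tauMax τ) • z.1 = √(tauMax τ) • z'.1 :=
      congrArg (fun g : ZHilbert n τ => g.fst.ofLp) h
    refine ⟨(smul_right_injective _ hT.ne') h1, fun i => ?_⟩
    have h2 : ∀ a, ∀ᵐ s ∂(volume.restrict (Icc (-τ i) 0)), z.2 i s a = z'.2 i s a := fun a =>
      (MemLp.toLp_eq_toLp_iff (hz.eval i a) (hz'.eval i a)).1
        (congrArg (fun g : ZHilbert n τ => g.snd.ofLp (i, a)) h)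
    filter_upwards [ae_all_iff.2 h2] with s hs using funext hs
  · rintro ⟨h1, h2⟩
    simp only [toHilbert, h1]
    congr 3
    funext k
    rw [MemLp.toLp_eq_toLp_iff]
    filter_upwards [h2 k.1] with s hs using congrFun hs k.2

theorem norm_sq_toHilbert (hτ : ∀ i, 0 < τ i) {z : ZVec (Fin n) n K} (hz : MemZ τ z) :
    ‖toHilbert z hz‖ ^ 2 = normSqZ τ z := by
  rw [← real_inner_self_eq_norm_sq, inner_toHilbert hτ, normSqZ]

end

end MultiDelay

namespace MultiDelay

/-! ### Integrals of vector valued functions -/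

section VectorIntegrals

open Matrix

variable {α : Type*} [MeasurableSpace α] {μ : Measure α} {ι κ : Type*} [Fintype ι] [Fintype κ]

theorem dotProduct_integral (c : ι → ℝ) {f : α → ι → ℝ} (hf : Integrable f μ) :
    c ⬝ᵥ ∫ x, f x ∂μ = ∫ x, c ⬝ᵥ f x ∂μ := by
  simp only [dotProduct]
  rw [integral_finsetSum _ fun a _ => (hf.eval a).const_mul _]
  refine Finset.sum_congr rfl fun a _ => ?_
  rw [eval_integral fun i => hf.eval i, integral_const_mul]

theorem integrable_dotProduct {f g : α → ι → ℝ} (hf : MemLp f 2 μ) (hg : MemLp g 2 μ) :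
    Integrable (fun x => f x ⬝ᵥ g x) μ :=
  integrable_finsetSum _ fun a _ =>
    MemLp.integrable_mul_two (memLp_pi_iff.1 hf a) (memLp_pi_iff.1 hg a)

theorem integrable_mulVec {M : α → Matrix κ ι ℝ} {f : α → ι → ℝ}
    (hM : ∀ a b, MemLp (fun x => M x a b) 2 μ) (hf : MemLp f 2 μ) :
    Integrable (fun x => M x *ᵥ f x) μ :=
  Integrable.of_eval fun a => integrable_dotProduct (f := fun x => M x a) (memLp_pi_iff.2 (hM a)) hf

theorem memLp_mulVec_const {M : α → Matrix κ ι ℝ} {p : ENNReal}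
    (hM : ∀ a b, MemLp (fun x => M x a b) p μ) (c : ι → ℝ) :
    MemLp (fun x => M x *ᵥ c) p μ :=
  memLp_pi_iff.2 fun a => memLp_finsetSum _ fun b _ => (hM a b).mul_const _

variable {β : Type*} [MeasurableSpace β] {ν : Measure β} [SFinite μ] [SFinite ν]

theorem memLp_integral_kernel_mulVec {R : α → β → Matrix κ ι ℝ} {f : β → ι → ℝ}
    (hR : ∀ a b, MemLp (fun p : α × β => R p.1 p.2 a b) 2 (μ.prod ν)) (hf : MemLp f 2 ν) :
    MemLp (fun x => ∫ y, R x y *ᵥ f y ∂ν) 2 μ := by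
  have hsl : ∀ᵐ x ∂μ, ∀ a b, MemLp (fun y => R x y a b) 2 ν := by
    simp only [ae_all_iff]
    exact fun a b => memLp_slice (hR a b)
  refine memLp_pi_iff.2 fun a => ?_
  have h1 : MemLp (fun x => ∑ b, ∫ y, R x y a b * f y b ∂ν) 2 μ :=
    memLp_finsetSum _ fun b _ => memLp_integral_kernel (hR a b) (memLp_pi_iff.1 hf b)
  refine h1.ae_eq ?_
  filter_upwards [hsl] with x hx
  rw [eval_integral fun i => (integrable_mulVec hx hf).eval i]
  simp only [mulVec, dotProduct]
  rw [integral_finsetSum _ fun b _ =>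
    MemLp.integrable_mul_two (hx a b) (memLp_pi_iff.1 hf b)]

theorem integrable_dotProduct_kernel_mulVec {R : α → β → Matrix κ ι ℝ} {f : β → ι → ℝ}
    {g : α → κ → ℝ} (hR : ∀ a b, MemLp (fun p : α × β => R p.1 p.2 a b) 2 (μ.prod ν))
    (hf : MemLp f 2 ν) (hg : MemLp g 2 μ) :
    Integrable (fun p : α × β => g p.1 ⬝ᵥ (R p.1 p.2 *ᵥ f p.2)) (μ.prod ν) := by
  simp only [mulVec, dotProduct, Finset.mul_sum]
  exact integrable_finsetSum _ fun a _ => integrable_finsetSum _ fun b _ =>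
    integrable_mul_kernel_mul (hR a b) (memLp_pi_iff.1 hg a) (memLp_pi_iff.1 hf b)

theorem integral_dotProduct_kernel_mulVec {R : α → β → Matrix κ ι ℝ} {f : β → ι → ℝ}
    {g : α → κ → ℝ} (hR : ∀ a b, MemLp (fun p : α × β => R p.1 p.2 a b) 2 (μ.prod ν))
    (hf : MemLp f 2 ν) (hg : MemLp g 2 μ) :
    ∫ x, g x ⬝ᵥ ∫ y, R x y *ᵥ f y ∂ν ∂μ
      = ∫ p, g p.1 ⬝ᵥ (R p.1 p.2 *ᵥ f p.2) ∂(μ.prod ν) := by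
  have hsl : ∀ᵐ x ∂μ, ∀ a b, MemLp (fun y => R x y a b) 2 ν := by
    simp only [ae_all_iff]
    exact fun a b => memLp_slice (hR a b)
  rw [integral_prod _ (integrable_dotProduct_kernel_mulVec hR hf hg)]
  refine integral_congr_ae ?_
  filter_upwards [hsl] with x hx
  exact dotProduct_integral _ (integrable_mulVec hx hf)

end VectorIntegrals

/-! ### General properties of the operators `P_{P,Q_i,S_i,R_ij}` -/

open Matrix

/-- Lebesgue measure on `[-τ_i,0]`. -/
noncomputable abbrev delayMeasure {K : ℕ} (τ : Fin K → ℝ) (i : Fin K) : Measure ℝ :=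
  volume.restrict (Icc (-τ i) 0)

theorem restrict_rect (a b c d : ℝ) :
    (volume : Measure (ℝ × ℝ)).restrict (Icc a b ×ˢ Icc c d)
      = (volume.restrict (Icc a b)).prod (volume.restrict (Icc c d)) := by
  rw [Measure.prod_restrict, Measure.volume_eq_prod]

namespace PQRS

variable {ι : Type*} {n K : ℕ} {τ : Fin K → ℝ}

/-- The entries of `Q_i` and `R_ij` are square integrable. -/
structure SquareIntegrable (τ : Fin K → ℝ) (ρ : PQRS ι n K) : Prop where
  Q : ∀ i a b, MemLp (fun s => ρ.Q i s a b) 2 (delayMeasure τ i)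
  R : ∀ i j a b, MemLp (fun p : ℝ × ℝ => ρ.R i j p.1 p.2 a b) 2
    ((delayMeasure τ i).prod (delayMeasure τ j))

variable {ρ : PQRS ι n K}

theorem SquareIntegrable.memLp_Q_transpose [Fintype ι] (hρ : ρ.SquareIntegrable τ) (c : ι → ℝ) (i : Fin K) :
    MemLp (fun s => (ρ.Q i s)ᵀ *ᵥ c) 2 (delayMeasure τ i) :=
  memLp_mulVec_const (fun a b => hρ.Q i b a) c

theorem SquareIntegrable.memLp_R {z : ZVec ι n K} (hτ : ∀ i, 0 < τ i)
    (hρ : ρ.SquareIntegrable τ) (hz : MemZ τ z) (i j : Fin K) :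
    MemLp (fun s => ∫ θ in (-τ j)..0, ρ.R i j s θ *ᵥ z.2 j θ) 2 (delayMeasure τ i) := by
  simp only [intervalIntegral_eq_setIntegral_Icc (neg_nonpos.2 (hτ j).le)]
  exact memLp_integral_kernel_mulVec (hρ.R i j) (hz j)

variable [Fintype ι] [NeZero K]

/-- Only the product S_i φ_i is required in L², so that the result also applies with Ṡ_i in the
place of S_i, which may be unbounded. -/
theorem SquareIntegrable.memZ_op (hτ : ∀ i, 0 < τ i) (hρ : ρ.SquareIntegrable τ)
    {z : ZVec ι n K} (hz : MemZ τ z)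
    (hS : ∀ i, MemLp (fun s => ρ.S i s *ᵥ z.2 i s) 2 (delayMeasure τ i)) :
    MemZ τ (ρ.op τ z) := fun i =>
  (((hρ.memLp_Q_transpose z.1 i).const_smul (tauMax τ)).add ((hS i).const_smul (tauMax τ))).add
    (memLp_finsetSum _ fun j _ => hρ.memLp_R hτ hz i j)

theorem SquareIntegrable.innerZ_op (hτ : ∀ i, 0 < τ i) (hρ : ρ.SquareIntegrable τ)
    {z z' : ZVec ι n K} (hz : MemZ τ z) (hz' : MemZ τ z')
    (hS : ∀ i, MemLp (fun s => ρ.S i s *ᵥ z'.2 i s) 2 (delayMeasure τ i)) :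
    innerZ τ z (ρ.op τ z') = tauMax τ * (z.1 ⬝ᵥ (ρ.P *ᵥ z'.1))
      + tauMax τ * ∑ i, ∫ s, z.1 ⬝ᵥ (ρ.Q i s *ᵥ z'.2 i s) ∂(delayMeasure τ i)
      + tauMax τ * ∑ i, ∫ s, z'.1 ⬝ᵥ (ρ.Q i s *ᵥ z.2 i s) ∂(delayMeasure τ i)
      + tauMax τ * ∑ i, ∫ s, z.2 i s ⬝ᵥ (ρ.S i s *ᵥ z'.2 i s) ∂(delayMeasure τ i)
      + ∑ i, ∑ j, ∫ p, z.2 i p.1 ⬝ᵥ (ρ.R i j p.1 p.2 *ᵥ z'.2 j p.2)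
          ∂((delayMeasure τ i).prod (delayMeasure τ j)) := by
  have h1 : z.1 ⬝ᵥ (ρ.op τ z').1 = z.1 ⬝ᵥ (ρ.P *ᵥ z'.1)
      + ∑ i, ∫ s, z.1 ⬝ᵥ (ρ.Q i s *ᵥ z'.2 i s) ∂(delayMeasure τ i) := by
    simp only [PQRS.op, dotProduct_add, dotProduct_sum,
      intervalIntegral_eq_setIntegral_Icc (neg_nonpos.2 (hτ _).le)]
    congr 1
    exact Finset.sum_congr rfl fun i _ => dotProduct_integral _ (integrable_mulVec (hρ.Q i) (hz' i))
  have h2 : ∀ i, ∫ s in (-τ i)..0, z.2 i s ⬝ᵥ (ρ.op τ z').2 i s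
      = tauMax τ * (∫ s, z'.1 ⬝ᵥ (ρ.Q i s *ᵥ z.2 i s) ∂(delayMeasure τ i))
      + tauMax τ * (∫ s, z.2 i s ⬝ᵥ (ρ.S i s *ᵥ z'.2 i s) ∂(delayMeasure τ i))
      + ∑ j, ∫ p, z.2 i p.1 ⬝ᵥ (ρ.R i j p.1 p.2 *ᵥ z'.2 j p.2)
          ∂((delayMeasure τ i).prod (delayMeasure τ j)) := by
    intro i
    have i1 : Integrable (fun s => tauMax τ * (z.2 i s ⬝ᵥ ((ρ.Q i s)ᵀ *ᵥ z'.1)))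
        (delayMeasure τ i) :=
      (integrable_dotProduct (hz i) (hρ.memLp_Q_transpose z'.1 i)).const_mul _
    have i2 : Integrable (fun s => tauMax τ * (z.2 i s ⬝ᵥ (ρ.S i s *ᵥ z'.2 i s)))
        (delayMeasure τ i) := (integrable_dotProduct (hz i) (hS i)).const_mul _
    have i3 : ∀ j ∈ Finset.univ, Integrable (fun s => z.2 i s ⬝ᵥ
        ∫ θ in (-τ j)..0, ρ.R i j s θ *ᵥ z'.2 j θ) (delayMeasure τ i) := fun j _ =>
      integrable_dotProduct (hz i) (hρ.memLp_R hτ hz' i j)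
    have i12 : Integrable (fun s => tauMax τ * (z.2 i s ⬝ᵥ ((ρ.Q i s)ᵀ *ᵥ z'.1))
        + tauMax τ * (z.2 i s ⬝ᵥ (ρ.S i s *ᵥ z'.2 i s))) (delayMeasure τ i) := i1.add i2
    rw [intervalIntegral_eq_setIntegral_Icc (neg_nonpos.2 (hτ _).le)]
    simp only [PQRS.op, dotProduct_add, dotProduct_sum, dotProduct_smul, smul_eq_mul]
    rw [integral_add i12 (integrable_finsetSum _ i3), integral_add i1 i2,
      integral_finsetSum _ i3, integral_const_mul, integral_const_mul]
    congr 1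
    · congr 2
      refine integral_congr_ae (Filter.Eventually.of_forall fun s => ?_)
      simp only
      rw [dotProduct_mulVec, vecMul_transpose, dotProduct_comm]
    · refine Finset.sum_congr rfl fun j _ => ?_
      simp only [intervalIntegral_eq_setIntegral_Icc (neg_nonpos.2 (hτ _).le)]
      exact integral_dotProduct_kernel_mulVec (hρ.R i j) (hz' j) (hz i)
  rw [innerZ, h1, Finset.sum_congr rfl fun i _ => h2 i]
  simp only [Finset.sum_add_distrib, mul_add, Finset.mul_sum]
  ring

end PQRS

end MultiDelay

namespace MultiDelay

open Matrix

/-! ### Square integrable kernels on small rectangles -/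

/-- Cauchy–Schwarz on the rectangle, combined with absolute continuity of r ↦ ∫∫ g² over the strip
[r,s₀] × [c,d]. The estimate is uniform in the second side, which allows squares shrinking to a
point. -/
theorem eventually_sq_setIntegral_le {g : ℝ × ℝ → ℝ} {a b c d s₀ δ : ℝ}
    (hg : MemLp g 2 ((volume.restrict (Icc a b)).prod (volume.restrict (Icc c d))))
    (hs₀ : s₀ ∈ Ioc a b) (hδ : 0 < δ) :
    ∀ᶠ r in nhdsWithin s₀ (Iio s₀), ∀ c' d', c' ≤ d' → Icc c' d' ⊆ Icc c d →
      (∫ p in Icc r s₀ ×ˢ Icc c' d', g p) ^ 2 ≤ δ * ((s₀ - r) * (d' - c')) := by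
  set N : ℝ → ℝ := fun s => ∫ θ in Icc c d, g (s, θ) ^ 2 with hN
  have hab : a ≤ b := (hs₀.1.trans_le hs₀.2).le
  have hNi : IntervalIntegrable N volume a b := by
    rw [intervalIntegrable_iff_integrableOn_Icc_of_le hab]
    exact hg.integrable_sq.integral_prod_left
  have hcont : ContinuousOn (fun r => ∫ s in s₀..r, N s) (Icc a b) := by
    have := (hNi.absolutelyContinuousOnInterval_intervalIntegral (c := s₀)
      (by rw [uIcc_of_le hab]; exact Ioc_subset_Icc_self hs₀)).continuousOn
    rwa [uIcc_of_le hab] at this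
  have hlim : Filter.Tendsto (fun r => ∫ s in s₀..r, N s) (nhdsWithin s₀ (Iio s₀)) (nhds 0) := by
    have h1 := hcont s₀ (Ioc_subset_Icc_self hs₀)
    rw [ContinuousWithinAt, intervalIntegral.integral_same] at h1
    refine h1.mono_left ?_
    rw [nhdsWithin_le_iff]
    filter_upwards [Ioo_mem_nhdsLT hs₀.1] with r hr using ⟨hr.1.le, hr.2.le.trans hs₀.2⟩
  have hsmall := hlim.eventually (lt_mem_nhds (neg_lt_zero.2 hδ))
  filter_upwards [hsmall, Ioo_mem_nhdsLT hs₀.1] with r hr hr' c' d' hcd hsub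
  have hJ : Icc r s₀ ⊆ Icc a b := Icc_subset_Icc hr'.1.le hs₀.2
  rw [restrict_rect .. |>.symm] at hg
  have hsub1 : Icc r s₀ ×ˢ Icc c' d' ⊆ Icc r s₀ ×ˢ Icc c d := prod_mono_right hsub
  have hsub2 : Icc r s₀ ×ˢ Icc c d ⊆ Icc a b ×ˢ Icc c d := prod_mono_left hJ
  have hg1 : MemLp g 2 (volume.restrict (Icc r s₀ ×ˢ Icc c d)) :=
    hg.mono_measure (Measure.restrict_mono hsub2 le_rfl)
  have hg2 : MemLp g 2 (volume.restrict (Icc r s₀ ×ˢ Icc c' d')) :=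
    hg1.mono_measure (Measure.restrict_mono hsub1 le_rfl)
  have hle : ∫ p in Icc r s₀ ×ˢ Icc c' d', g p ^ 2 ≤ δ := by
    calc ∫ p in Icc r s₀ ×ˢ Icc c' d', g p ^ 2 ≤ ∫ p in Icc r s₀ ×ˢ Icc c d, g p ^ 2 :=
          setIntegral_mono_set hg1.integrable_sq
            (Filter.Eventually.of_forall fun p => sq_nonneg _) hsub1.eventuallyLE
      _ = ∫ s in Icc r s₀, N s := by
          rw [Measure.volume_eq_prod]
          exact setIntegral_prod _ (by rw [← Measure.volume_eq_prod]; exact hg1.integrable_sq)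
      _ = ∫ s in r..s₀, N s := (intervalIntegral_eq_setIntegral_Icc hr'.2.le _).symm
      _ ≤ δ := by rw [intervalIntegral.integral_symm]; linarith
  have hfin : volume (Icc r s₀ ×ˢ Icc c' d') ≠ ⊤ :=
    (isCompact_Icc.prod isCompact_Icc).measure_lt_top.ne
  have : IsFiniteMeasure ((volume : Measure (ℝ × ℝ)).restrict (Icc r s₀ ×ˢ Icc c' d')) :=
    ⟨by rw [Measure.restrict_apply_univ]; exact hfin.lt_top⟩
  have hcs := sq_integral_mul_le hg2 (memLp_const (1 : ℝ))
  have hvol : ∫ _p in Icc r s₀ ×ˢ Icc c' d', (1 : ℝ) ^ 2 = (s₀ - r) * (d' - c') := by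
    simp only [one_pow, integral_const, smul_eq_mul, mul_one, measureReal_restrict_apply_univ]
    rw [Measure.volume_eq_prod, measureReal_prod_prod, Real.volume_real_Icc_of_le hr'.2.le,
      Real.volume_real_Icc_of_le hcd]
  rw [hvol] at hcs
  simp only [mul_one] at hcs
  refine hcs.trans (mul_le_mul_of_nonneg_right hle ?_)
  exact mul_nonneg (by linarith [hr'.2]) (by linarith)

/-! ### Kernels with a square integrable derivative -/

namespace W12Rect

variable {a b c d : ℝ} {k : ℝ → ℝ → ℝ}

theorem memLp_deriv (hk : W12Rect a b c d k) :
    MemLp (fun p : ℝ × ℝ => deriv (fun s => k s p.2) p.1) 2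
      ((volume.restrict (Icc a b)).prod (volume.restrict (Icc c d))) := by
  rw [← restrict_rect]; exact hk.2.2.2.1

theorem memLp_self (hk : W12Rect a b c d k) :
    MemLp (fun p : ℝ × ℝ => k p.1 p.2) 2
      ((volume.restrict (Icc a b)).prod (volume.restrict (Icc c d))) := by
  rw [← restrict_rect]; exact hk.2.2.1

theorem ae_eq_sub_integral (hk : W12Rect a b c d k) :
    ∀ᵐ θ ∂(volume.restrict (Icc c d)), ∀ s ∈ Icc a b,
      k s θ = k b θ - ∫ σ in Icc s b, deriv (fun s => k s θ) σ := by
  filter_upwards [hk.1] with θ hθ s hs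
  rw [← intervalIntegral_eq_setIntegral_Icc hs.2,
    (hθ.mono (c := s) (d := b) ?_).integral_deriv_eq_sub]
  · ring
  · rw [uIcc_of_le hs.2, uIcc_of_le (hs.1.trans hs.2)]
    exact Icc_subset_Icc_left hs.1

/-- Every slice is covered, not merely almost every one: it differs from the trace at b by an
integral of the L² derivative. This gives meaning to R_ij(-τ_i, ·). -/
theorem memLp_slice (hk : W12Rect a b c d k) (hb : MemLp (k b) 2 (volume.restrict (Icc c d)))
    {s : ℝ} (hs : s ∈ Icc a b) : MemLp (k s) 2 (volume.restrict (Icc c d)) := by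
  have h1 : MemLp (fun p : ℝ × ℝ => deriv (fun s => k s p.2) p.1) 2
      ((volume.restrict (Icc s b)).prod (volume.restrict (Icc c d))) := by
    have := hk.memLp_deriv
    rw [← restrict_rect] at this ⊢
    exact this.mono_measure (Measure.restrict_mono (prod_mono_left (Icc_subset_Icc_left hs.1))
      le_rfl)
  have h2 := memLp_integral_kernel (h1.comp_measurePreserving Measure.measurePreserving_swap)
    (memLp_const (1 : ℝ))
  refine (hb.sub h2).ae_eq ?_
  filter_upwards [hk.ae_eq_sub_integral] with θ hθ
  simp [hθ s hs]

/-- Fubini applied to the representation of k(s,θ) as its trace minus an integral. The outcome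
exhibits the integral operator as a primitive in s. -/
theorem integral_mul_eq (hk : W12Rect a b c d k)
    (hb : MemLp (k b) 2 (volume.restrict (Icc c d))) {f : ℝ → ℝ}
    (hf : MemLp f 2 (volume.restrict (Icc c d))) {s : ℝ} (hs : s ∈ Icc a b) :
    ∫ θ in Icc c d, k s θ * f θ = (∫ θ in Icc c d, k b θ * f θ)
      - ∫ σ in s..b, ∫ θ in Icc c d, deriv (fun s => k s θ) σ * f θ := by
  have h1 : MemLp (fun p : ℝ × ℝ => deriv (fun s => k s p.2) p.1) 2
      ((volume.restrict (Icc s b)).prod (volume.restrict (Icc c d))) := by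
    have := hk.memLp_deriv
    rw [← restrict_rect] at this ⊢
    exact this.mono_measure (Measure.restrict_mono (prod_mono_left (Icc_subset_Icc_left hs.1))
      le_rfl)
  have h2 : Integrable (Function.uncurry fun σ θ => deriv (fun s => k s θ) σ * f θ)
      ((volume.restrict (Icc s b)).prod (volume.restrict (Icc c d))) := by
    have := integrable_mul_kernel_mul h1 (memLp_const (1 : ℝ)) hf
    simp only [one_mul] at this
    exact this
  have h3 : Integrable (fun θ => ∫ σ in Icc s b, deriv (fun s => k s θ) σ * f θ)
      (volume.restrict (Icc c d)) := h2.integral_prod_right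
  rw [intervalIntegral_eq_setIntegral_Icc hs.2, integral_integral_swap h2,
    ← integral_sub (MemLp.integrable_mul_two hb hf) h3]
  refine integral_congr_ae ?_
  filter_upwards [hk.ae_eq_sub_integral] with θ hθ
  rw [hθ s hs, integral_mul_const]
  ring

end W12Rect

/-- If the traces of a function in `W^{1,2}` of a square and of its transpose on the edge
`s = 0` are continuous, then they agree in the corner. -/
theorem W12Rect.corner_eq {a : ℝ} (ha : a < 0) {k l : ℝ → ℝ → ℝ} {f g : ℝ → ℝ}
    (hk : W12Rect a 0 a 0 k) (hl : W12Rect a 0 a 0 l)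
    (hkl : ∀ᵐ p : ℝ × ℝ ∂(volume.restrict (Icc a 0 ×ˢ Icc a 0)), k p.1 p.2 = l p.2 p.1)
    (hf : ContinuousOn f (Icc a 0)) (hg : ContinuousOn g (Icc a 0))
    (hkf : ∀ᵐ θ ∂(volume.restrict (Icc a 0)), f θ = k 0 θ)
    (hlg : ∀ᵐ θ ∂(volume.restrict (Icc a 0)), g θ = l 0 θ) : f 0 = g 0 := by
  by_contra hne
  set D := |f 0 - g 0| with hD
  have hDpos : 0 < D := abs_pos.2 (sub_ne_zero.2 hne)
  set u : ℝ × ℝ → ℝ := fun p => |deriv (fun s => k s p.2) p.1| with hu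
  set v : ℝ × ℝ → ℝ := fun p => |deriv (fun s => l s p.2) p.1| with hv
  have hu2 : MemLp u 2 ((volume.restrict (Icc a 0)).prod (volume.restrict (Icc a 0))) :=
    hk.memLp_deriv.abs
  have hv2 : MemLp v 2 ((volume.restrict (Icc a 0)).prod (volume.restrict (Icc a 0))) :=
    hl.memLp_deriv.abs
  have h0 : (0 : ℝ) ∈ Ioc a 0 := ⟨ha, le_rfl⟩
  have h0' : (0 : ℝ) ∈ Icc a 0 := ⟨ha.le, le_rfl⟩
  have hfε : ∀ᶠ r in nhdsWithin 0 (Iio 0), ∀ s ∈ Icc r 0, |f s - f 0| ≤ D / 8 := by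
    obtain ⟨η, hη, h⟩ := Metric.continuousOn_iff.1 hf 0 h0' (D / 8) (by positivity)
    filter_upwards [Ioo_mem_nhdsLT (max_lt ha (neg_lt_zero.2 hη))] with r hr s hs
    refine (h s ⟨(le_max_left _ _).trans (hr.1.le.trans hs.1), hs.2⟩ ?_).le
    rw [Real.dist_eq, sub_zero, abs_lt]
    have := (le_max_right a (-η)).trans_lt hr.1
    constructor <;> linarith [hs.1, hs.2]
  have hgε : ∀ᶠ r in nhdsWithin 0 (Iio 0), ∀ s ∈ Icc r 0, |g s - g 0| ≤ D / 8 := by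
    obtain ⟨η, hη, h⟩ := Metric.continuousOn_iff.1 hg 0 h0' (D / 8) (by positivity)
    filter_upwards [Ioo_mem_nhdsLT (max_lt ha (neg_lt_zero.2 hη))] with r hr s hs
    refine (h s ⟨(le_max_left _ _).trans (hr.1.le.trans hs.1), hs.2⟩ ?_).le
    rw [Real.dist_eq, sub_zero, abs_lt]
    have := (le_max_right a (-η)).trans_lt hr.1
    constructor <;> linarith [hs.1, hs.2]
  obtain ⟨r, hfr, hgr, hur, hvr, hr⟩ := (hfε.and (hgε.and
    ((eventually_sq_setIntegral_le hu2 h0 (δ := D ^ 2 / 64) (by positivity)).and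
    ((eventually_sq_setIntegral_le hv2 h0 (δ := D ^ 2 / 64) (by positivity)).and
    (Ioo_mem_nhdsLT ha))))).exists
  have hsub : Icc r 0 ⊆ Icc a 0 := Icc_subset_Icc_left hr.1.le
  have hur' := hur r 0 hr.2.le hsub
  have hvr' := hvr r 0 hr.2.le hsub
  set J := Icc r 0 with hJ
  set μ := (volume : Measure ℝ).restrict J with hμ
  have hμle : μ ≤ volume.restrict (Icc a 0) := Measure.restrict_mono hsub le_rfl
  have hJJ : (volume : Measure (ℝ × ℝ)).restrict (J ×ˢ J) = μ.prod μ := restrict_rect _ _ _ _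
  have hui : Integrable u (μ.prod μ) := by
    refine (hu2.mono_measure ?_).integrable (by norm_num)
    exact Measure.prod_mono hμle hμle
  have hvi : Integrable v (μ.prod μ) := by
    refine (hv2.mono_measure ?_).integrable (by norm_num)
    exact Measure.prod_mono hμle hμle
  -- On the small square the deviation of k from its trace is bounded by the integral of |∂k| along
  -- the whole side, a bound independent of s.
  have key : ∀ {k : ℝ → ℝ → ℝ} {f : ℝ → ℝ}, W12Rect a 0 a 0 k →
      (∀ᵐ θ ∂(volume.restrict (Icc a 0)), f θ = k 0 θ) →
      ∀ᵐ θ ∂μ, ∀ s ∈ J, |k s θ - f θ| ≤ ∫ σ in J, |deriv (fun s => k s θ) σ| := by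
    intro k f hk hkf
    have h1 : ∀ᵐ θ ∂(volume.restrict (Icc a 0)), ∀ s ∈ J,
        |k s θ - f θ| ≤ ∫ σ in J, |deriv (fun s => k s θ) σ| := by
      filter_upwards [hk.ae_eq_sub_integral, hkf, hk.1] with θ h1 h2 h3 s hs
      have hi : IntegrableOn (deriv fun s => k s θ) (Icc a 0) := by
        rw [← intervalIntegrable_iff_integrableOn_Icc_of_le ha.le]
        exact h3.intervalIntegrable_deriv
      rw [h1 s (hsub hs), h2, sub_sub_cancel_left, abs_neg]
      refine (abs_integral_le_integral_abs).trans ?_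
      exact setIntegral_mono_set (hi.mono_set hsub).abs
        (Filter.Eventually.of_forall fun _ => abs_nonneg _)
        (Icc_subset_Icc_left hs.1).eventuallyLE
    exact ae_mono hμle h1
  have hUi : Integrable (fun θ => ∫ σ, u (σ, θ) ∂μ) μ := hui.integral_prod_right
  have hVi : Integrable (fun θ => ∫ σ, v (σ, θ) ∂μ) μ := hvi.integral_prod_right
  have hfin : μ.real univ = -r := by
    rw [hμ, measureReal_restrict_apply_univ, hJ, Real.volume_real_Icc_of_le hr.2.le]; ring
  -- Where k(s,θ) = l(θ,s), the gap D must be made up by the oscillation of f and g, at most D/4 in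
  -- total, and by the two deviations from the traces.
  have hpt : ∀ᵐ p ∂(μ.prod μ), D / 2 ≤ (∫ σ, u (σ, p.2) ∂μ) + ∫ σ, v (σ, p.1) ∂μ := by
    have e1 : ∀ᵐ p ∂(μ.prod μ), ∀ s ∈ J, |k s p.2 - f p.2| ≤ ∫ σ, u (σ, p.2) ∂μ :=
      Measure.quasiMeasurePreserving_snd.ae (key hk hkf)
    have e2 : ∀ᵐ p ∂(μ.prod μ), ∀ s ∈ J, |l s p.1 - g p.1| ≤ ∫ σ, v (σ, p.1) ∂μ :=
      Measure.quasiMeasurePreserving_fst.ae (key hl hlg)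
    have e3 : ∀ᵐ p ∂(μ.prod μ), k p.1 p.2 = l p.2 p.1 := by
      rw [← hJJ]
      exact ae_mono (Measure.restrict_mono (prod_mono hsub hsub) le_rfl) hkl
    have e4 : ∀ᵐ p ∂(μ.prod μ), p ∈ J ×ˢ J := by
      rw [← hJJ]
      exact ae_restrict_mem (measurableSet_Icc.prod measurableSet_Icc)
    filter_upwards [e1, e2, e3, e4] with p h1 h2 h3 h4
    have a1 := h1 p.1 h4.1
    have a2 := h2 p.2 h4.2
    rw [h3] at a1
    have a3 := hfr p.2 h4.2
    have a4 := hgr p.1 h4.1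
    have a5 : D ≤ |f 0 - f p.2| + |f p.2 - l p.2 p.1| + |l p.2 p.1 - g p.1| + |g p.1 - g 0| := by
      have e : f 0 - g 0 = (f 0 - f p.2) + (f p.2 - l p.2 p.1) + (l p.2 p.1 - g p.1)
        + (g p.1 - g 0) := by ring
      rw [hD, e]
      refine (abs_add_le _ _).trans (add_le_add_left ((abs_add_le _ _).trans
        (add_le_add_left (abs_add_le _ _) _)) _)
    rw [abs_sub_comm (f 0), abs_sub_comm (f p.2) (l p.2 p.1)] at a5
    linarith
  have hint := integral_mono_ae (integrable_const (D / 2)) ((hUi.comp_snd μ).add (hVi.comp_fst μ))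
    hpt
  have hsum : ∫ p : ℝ × ℝ, (∫ σ, u (σ, p.2) ∂μ) + ∫ σ, v (σ, p.1) ∂μ ∂(μ.prod μ)
      = -r * ((∫ p, u p ∂(μ.prod μ)) + ∫ p, v p ∂(μ.prod μ)) := by
    rw [integral_add (hUi.comp_snd μ) (hVi.comp_fst μ), integral_fun_snd (μ := μ) (ν := μ)
      (fun θ => ∫ σ, u (σ, θ) ∂μ), integral_fun_fst (μ := μ) (ν := μ)
      (fun θ => ∫ σ, v (σ, θ) ∂μ), hfin, integral_prod_symm _ hui, integral_prod_symm _ hvi]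
    simp only [smul_eq_mul]
    ring
  have hconst : ∫ _p : ℝ × ℝ, D / 2 ∂(μ.prod μ) = -r * -r * (D / 2) := by
    rw [integral_const, ← univ_prod_univ, measureReal_prod_prod, hfin, smul_eq_mul]
  simp only [Pi.add_apply] at hint
  rw [hsum, hconst] at hint
  rw [hJJ] at hur' hvr'
  have hrpos : 0 < -r := by linarith [hr.2]
  -- With side length -r, the averaged bound makes ∫u + ∫v at least D/2 times -r, while the
  -- small-square estimate allows at most D/8 times -r for each: a contradiction.
  have hint' : -r * (D / 2) ≤ (∫ p, u p ∂(μ.prod μ)) + ∫ p, v p ∂(μ.prod μ) := by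
    refine le_of_mul_le_mul_left ?_ hrpos
    linarith
  have b1 : (∫ p, u p ∂(μ.prod μ)) ≤ D / 8 * -r := by
    refine abs_le_of_sq_le_sq' ?_ (by positivity) |>.2
    nlinarith
  have b2 : (∫ p, v p ∂(μ.prod μ)) ≤ D / 8 * -r := by
    refine abs_le_of_sq_le_sq' ?_ (by positivity) |>.2
    nlinarith
  nlinarith

end MultiDelay

namespace MultiDelay

open Matrix

variable {n K : ℕ} {τ : Fin K → ℝ} {ρ : PQRS (Fin n) n K}

/-! ### Symmetry and positivity of `P_{P,Q_i,S_i,R_ij}` -/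

theorem PQRS.IsSobolev.squareIntegrable (hτ : ∀ i, 0 < τ i) (hρ : ρ.IsSobolev τ) :
    ρ.SquareIntegrable τ where
  Q i a b := (hρ.1 i a b).memLp (neg_nonpos.2 (hτ i).le)
  R i j a b := (hρ.2.2 i j a b).memLp_self

theorem memLp_continuousOn_mul {f g : ℝ → ℝ} {a b : ℝ} (hf : ContinuousOn f (Icc a b))
    (hg : MemLp g 2 (volume.restrict (Icc a b))) :
    MemLp (fun s => f s * g s) 2 (volume.restrict (Icc a b)) := by
  obtain ⟨C, hC⟩ := isCompact_Icc.exists_bound_of_continuousOn hf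
  refine MemLp.of_le_mul (c := C) hg ((hf.aestronglyMeasurable measurableSet_Icc).mul hg.1) ?_
  filter_upwards [ae_restrict_mem measurableSet_Icc] with s hs
  rw [norm_mul]
  exact mul_le_mul_of_nonneg_right (hC s hs) (norm_nonneg _)

theorem PQRS.IsSobolev.memLp_S {ι : Type*} (hτ : ∀ i, 0 < τ i) (hρ : ρ.IsSobolev τ)
    {z : ZVec ι n K} (hz : MemZ τ z) (i : Fin K) :
    MemLp (fun s => ρ.S i s *ᵥ z.2 i s) 2 (delayMeasure τ i) :=
  memLp_pi_iff.2 fun a => by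
    simp only [mulVec, dotProduct]
    exact memLp_finsetSum _ fun b _ => memLp_continuousOn_mul
      ((hρ.2.1 i a b).continuousOn (neg_nonpos.2 (hτ i).le)) (hz.eval i b)

theorem innerZ_comm {ι : Type*} [Fintype ι] [NeZero K] (z z' : ZVec ι n K) :
    innerZ τ z z' = innerZ τ z' z := by
  simp only [innerZ, dotProduct_comm]

theorem PQRS.IsSobolev.continuousOn_S (hτ : ∀ i, 0 < τ i) (hρ : ρ.IsSobolev τ) (i : Fin K)
    (v w : Fin n → ℝ) : ContinuousOn (fun s => v ⬝ᵥ (ρ.S i s *ᵥ w)) (Icc (-τ i) 0) := by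
  simp only [mulVec, dotProduct]
  exact continuousOn_finsetSum _ fun a _ => continuousOn_const.mul <|
    continuousOn_finsetSum _ fun b _ =>
      ((hρ.2.1 i a b).continuousOn (neg_nonpos.2 (hτ i).le)).mul continuousOn_const

variable [NeZero K]

/-- Since P = τ_K(Q_i(0)ᵀ + S_i(0)), the point is symmetry of Q_i(0). Both Q_i and Q_iᵀ are traces
of R_ii and its transpose, which agree in the corner; any i will do. -/
theorem PQRS.IsSobolev.P_symm (hτ : ∀ i, 0 < τ i) (hρ : ρ.IsSobolev τ) (hc : ρ.Compatible τ) :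
    ρ.Pᵀ = ρ.P := by
  set i : Fin K := ⊤
  have hQ : ∀ a b, ρ.Q i 0 a b = ρ.Q i 0 b a := by
    intro a b
    have h0 := neg_nonpos.2 (hτ i).le
    refine W12Rect.corner_eq (neg_lt_zero.2 (hτ i)) (hρ.2.2 i i a b) (hρ.2.2 i i b a) ?_
      (f := fun s => ρ.Q i s a b) (g := fun s => ρ.Q i s b a)
      ((hρ.1 i a b).continuousOn h0) ((hρ.1 i b a).continuousOn h0) ?_ ?_
    · filter_upwards [hc.R_symm i i] with p hp
      exact congrFun (congrFun hp a) b
    · filter_upwards [hc.Q_eq i i] with s hs using congrFun (congrFun hs a) b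
    · filter_upwards [hc.Q_eq i i] with s hs using congrFun (congrFun hs b) a
  have hS := hc.S_symm i 0 ⟨neg_nonpos.2 (hτ i).le, le_rfl⟩
  have hQ' : (ρ.Q i 0)ᵀ = ρ.Q i 0 := by
    ext a b
    exact hQ b a
  rw [hc.P_eq i, transpose_add, transpose_smul, transpose_smul, transpose_transpose, ← hS, hQ']

theorem dotProduct_mulVec_comm_of_eq {κ ι : Type*} [Fintype κ] [Fintype ι] {M : Matrix κ ι ℝ}
    {N : Matrix ι κ ℝ} (h : M = Nᵀ) (v : κ → ℝ) (w : ι → ℝ) :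
    v ⬝ᵥ (M *ᵥ w) = w ⬝ᵥ (N *ᵥ v) := by
  rw [h, dotProduct_mulVec, vecMul_transpose, dotProduct_comm]

theorem innerZ_op_comm (hτ : ∀ i, 0 < τ i) (hρ : ρ.IsSobolev τ) (hc : ρ.Compatible τ)
    {z z' : ZVec (Fin n) n K} (hz : MemZ τ z) (hz' : MemZ τ z') :
    innerZ τ z (ρ.op τ z') = innerZ τ z' (ρ.op τ z) := by
  rw [(hρ.squareIntegrable hτ).innerZ_op hτ hz hz' (hρ.memLp_S hτ hz'),
    (hρ.squareIntegrable hτ).innerZ_op hτ hz' hz (hρ.memLp_S hτ hz)]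
  have hP : z.1 ⬝ᵥ (ρ.P *ᵥ z'.1) = z'.1 ⬝ᵥ (ρ.P *ᵥ z.1) :=
    dotProduct_mulVec_comm_of_eq (hρ.P_symm hτ hc).symm _ _
  have hS : ∀ i, ∫ s, z.2 i s ⬝ᵥ (ρ.S i s *ᵥ z'.2 i s) ∂(delayMeasure τ i)
      = ∫ s, z'.2 i s ⬝ᵥ (ρ.S i s *ᵥ z.2 i s) ∂(delayMeasure τ i) := by
    intro i
    refine integral_congr_ae ?_
    filter_upwards [ae_restrict_mem measurableSet_Icc] with s hs
    exact dotProduct_mulVec_comm_of_eq (hc.S_symm i s hs) _ _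
  have hR : ∀ i j, ∫ p, z.2 i p.1 ⬝ᵥ (ρ.R i j p.1 p.2 *ᵥ z'.2 j p.2)
          ∂((delayMeasure τ i).prod (delayMeasure τ j))
      = ∫ p, z'.2 j p.1 ⬝ᵥ (ρ.R j i p.1 p.2 *ᵥ z.2 i p.2)
          ∂((delayMeasure τ j).prod (delayMeasure τ i)) := by
    intro i j
    rw [← integral_prod_swap]
    refine integral_congr_ae ?_
    rw [← restrict_rect]
    filter_upwards [hc.R_symm j i] with p hp
    exact (dotProduct_mulVec_comm_of_eq hp _ _).symm
  rw [hP, Finset.sum_congr rfl fun i _ => hS i,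
    Finset.sum_congr rfl fun i _ => Finset.sum_congr rfl fun j _ => hR i j, Finset.sum_comm]
  ring

theorem PQRS.IsSobolev.memZ_op (hτ : ∀ i, 0 < τ i) (hρ : ρ.IsSobolev τ)
    {z : ZVec (Fin n) n K} (hz : MemZ τ z) : MemZ τ (ρ.op τ z) :=
  (hρ.squareIntegrable hτ).memZ_op hτ hz (hρ.memLp_S hτ hz)

/-- Coercivity of the operator, tested on an element concentrated on a subinterval. -/
theorem le_integral_S_add_integral_R (hτ : ∀ i, 0 < τ i) (hρ : ρ.IsSobolev τ) {ε : ℝ}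
    (hco : ∀ z : ZVec (Fin n) n K, MemZ τ z → ε * normSqZ τ z ≤ innerZ τ z (ρ.op τ z))
    (i : Fin K) (v : Fin n → ℝ) {r s : ℝ} (hrs : r ≤ s) (hsub : Icc r s ⊆ Icc (-τ i) 0) :
    ε * ((s - r) * (v ⬝ᵥ v)) ≤ tauMax τ * (∫ t in Icc r s, v ⬝ᵥ (ρ.S i t *ᵥ v))
      + ∫ p in Icc r s ×ˢ Icc r s, v ⬝ᵥ (ρ.R i i p.1 p.2 *ᵥ v) := by
  set J := Icc r s with hJ
  have hJm : MeasurableSet J := measurableSet_Icc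
  set φ : ℝ → Fin n → ℝ := J.indicator fun _ => v with hφ
  set z : ZVec (Fin n) n K := (0, Pi.single i φ) with hz
  have hzi : z.2 i = φ := Pi.single_eq_same _ _
  have hzj : ∀ j, j ≠ i → z.2 j = 0 := fun j hj => Pi.single_eq_of_ne hj _
  have hzZ : MemZ τ z := by
    intro j
    by_cases hj : j = i
    · subst hj
      rw [hzi]
      exact (memLp_const v).indicator hJm
    · rw [hzj j hj]
      exact MemLp.zero
  have h := hco z hzZ
  rw [(hρ.squareIntegrable hτ).innerZ_op hτ hzZ hzZ (hρ.memLp_S hτ hzZ)] at h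
  have hn : normSqZ τ z = (s - r) * (v ⬝ᵥ v) := by
    rw [normSqZ, innerZ, Fintype.sum_eq_single i fun j hj => by simp [hzj j hj], hzi]
    have : ∀ t, φ t ⬝ᵥ φ t = J.indicator (fun _ => v ⬝ᵥ v) t := by
      intro t
      by_cases ht : t ∈ J <;> simp [hφ, ht]
    rw [intervalIntegral_eq_setIntegral_Icc (neg_nonpos.2 (hτ _).le)]
    simp only [this]
    rw [setIntegral_indicator hJm, inter_eq_self_of_subset_right hsub, setIntegral_const, hJ,
      Real.volume_real_Icc_of_le hrs]
    simp [hz]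
  have hSi : ∑ j, ∫ t, z.2 j t ⬝ᵥ (ρ.S j t *ᵥ z.2 j t) ∂(delayMeasure τ j)
      = ∫ t in J, v ⬝ᵥ (ρ.S i t *ᵥ v) := by
    rw [Fintype.sum_eq_single i fun j hj => by simp [hzj j hj], hzi]
    have : ∀ t, φ t ⬝ᵥ (ρ.S i t *ᵥ φ t) = J.indicator (fun t => v ⬝ᵥ (ρ.S i t *ᵥ v)) t := by
      intro t
      by_cases ht : t ∈ J <;> simp [hφ, ht]
    simp only [this]
    rw [setIntegral_indicator hJm, inter_eq_self_of_subset_right hsub]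
  have hRi : ∑ j, ∑ k, ∫ p, z.2 j p.1 ⬝ᵥ (ρ.R j k p.1 p.2 *ᵥ z.2 k p.2)
        ∂((delayMeasure τ j).prod (delayMeasure τ k))
      = ∫ p in J ×ˢ J, v ⬝ᵥ (ρ.R i i p.1 p.2 *ᵥ v) := by
    rw [Fintype.sum_eq_single i fun j hj => by simp [hzj j hj],
      Fintype.sum_eq_single i fun j hj => by simp [hzj j hj], hzi]
    have : ∀ p : ℝ × ℝ, φ p.1 ⬝ᵥ (ρ.R i i p.1 p.2 *ᵥ φ p.2)
        = (J ×ˢ J).indicator (fun p => v ⬝ᵥ (ρ.R i i p.1 p.2 *ᵥ v)) p := by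
      intro p
      by_cases h1 : p.1 ∈ J <;> by_cases h2 : p.2 ∈ J <;> simp [hφ, h1, h2, indicator, mem_prod]
    simp only [this]
    rw [← restrict_rect, setIntegral_indicator (hJm.prod hJm),
      inter_eq_self_of_subset_right (prod_mono hsub hsub)]
  rw [hn, hSi, hRi] at h
  simpa [hz] using h

/-- Testing with v times the indicator of [r,s], the S-term is of order s - r, whereas the R-term is
o(s - r) because R_ii is square integrable. Dividing by s - r leaves the pointwise bound. -/
theorem le_dotProduct_S (hτ : ∀ i, 0 < τ i) (hρ : ρ.IsSobolev τ) {ε : ℝ}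
    (hco : ∀ z : ZVec (Fin n) n K, MemZ τ z → ε * normSqZ τ z ≤ innerZ τ z (ρ.op τ z))
    (i : Fin K) (v : Fin n → ℝ) {s : ℝ} (hs : s ∈ Icc (-τ i) 0) :
    ε * (v ⬝ᵥ v) ≤ tauMax τ * (v ⬝ᵥ (ρ.S i s *ᵥ v)) := by
  have hcont : ContinuousOn (fun s => tauMax τ * (v ⬝ᵥ (ρ.S i s *ᵥ v))) (Icc (-τ i) 0) :=
    continuousOn_const.mul (hρ.continuousOn_S hτ i v v)
  have hR : MemLp (fun p : ℝ × ℝ => v ⬝ᵥ (ρ.R i i p.1 p.2 *ᵥ v)) 2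
      ((delayMeasure τ i).prod (delayMeasure τ i)) :=
    memLp_finsetSum _ fun a _ => (memLp_pi_iff.1 (memLp_mulVec_const
      (fun a b => (hρ.2.2 i i a b).memLp_self) v) a).const_mul _
  -- The test intervals extend to the left of s, so s = -τ_i is reached only afterwards, by
  -- continuity.
  have hIoc : ∀ s ∈ Ioc (-τ i) 0, ε * (v ⬝ᵥ v) ≤ tauMax τ * (v ⬝ᵥ (ρ.S i s *ᵥ v)) := by
    intro s hs
    by_contra! hlt
    -- A third of the supposed deficit: continuity of S_i uses up one δ, the R-term another, and a
    -- strict deficit of δ remains.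
    set δ := (ε * (v ⬝ᵥ v) - tauMax τ * (v ⬝ᵥ (ρ.S i s *ᵥ v))) / 3 with hδ
    have hδpos : 0 < δ := by rw [hδ]; linarith
    have hnear : ∀ᶠ r in nhdsWithin s (Iio s), ∀ t ∈ Icc r s,
        tauMax τ * (v ⬝ᵥ (ρ.S i t *ᵥ v)) ≤ ε * (v ⬝ᵥ v) - 2 * δ := by
      obtain ⟨η, hη, h⟩ := Metric.continuousOn_iff.1 hcont s (Ioc_subset_Icc_self hs) δ hδpos
      filter_upwards [Ioo_mem_nhdsLT (max_lt hs.1 (sub_lt_self s hη))] with r hr t ht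
      have h1 := h t ⟨(le_max_left _ _).trans (hr.1.le.trans ht.1), ht.2.trans hs.2⟩ (by
        rw [Real.dist_eq, abs_lt]
        have := (le_max_right (-τ i) (s - η)).trans_lt hr.1
        constructor <;> linarith [ht.1, ht.2])
      rw [Real.dist_eq, abs_lt] at h1
      linarith [h1.2]
    obtain ⟨r, h1, h2, hr⟩ := (hnear.and ((eventually_sq_setIntegral_le hR hs
      (δ := δ ^ 2) (by positivity)).and (Ioo_mem_nhdsLT hs.1))).exists
    have hsub : Icc r s ⊆ Icc (-τ i) 0 := Icc_subset_Icc hr.1.le hs.2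
    have h3 := le_integral_S_add_integral_R hτ hρ hco i v hr.2.le hsub
    have h4 := h2 r s hr.2.le hsub
    have h5 : tauMax τ * (∫ t in Icc r s, v ⬝ᵥ (ρ.S i t *ᵥ v))
        ≤ (s - r) * (ε * (v ⬝ᵥ v) - 2 * δ) := by
      rw [← integral_const_mul]
      refine (setIntegral_mono_on ((hcont.mono hsub).integrableOn_Icc)
        (integrableOn_const (by simp)) measurableSet_Icc h1).trans ?_
      rw [setIntegral_const, Real.volume_real_Icc_of_le hr.2.le, smul_eq_mul]
    have hrs : 0 < s - r := by linarith [hr.2]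
    have h6 : (∫ p in Icc r s ×ˢ Icc r s, v ⬝ᵥ (ρ.R i i p.1 p.2 *ᵥ v)) ≤ δ * (s - r) := by
      refine (abs_le_of_sq_le_sq' ?_ (by positivity)).2
      nlinarith
    nlinarith [mul_pos hδpos hrs]
  refine ContinuousWithinAt.closure_le (s := Ioc (-τ i) 0) (f := fun _ => ε * (v ⬝ᵥ v))
    (g := fun s => tauMax τ * (v ⬝ᵥ (ρ.S i s *ᵥ v))) ?_ continuousWithinAt_const
    ((hcont s hs).mono Ioc_subset_Icc_self) hIoc
  rw [closure_Ioc (neg_lt_zero.2 (hτ i)).ne]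
  exact hs

end MultiDelay

namespace MultiDelay

open Matrix

variable {n K : ℕ} {τ : Fin K → ℝ} {ρ : PQRS (Fin n) n K}

/-! ### Regularity of the image of the operator -/

theorem MemX.memZ {z : ZVec (Fin n) n K} (hτ : ∀ i, 0 < τ i) (hz : MemX τ z) : MemZ τ z :=
  memZ_iff.2 fun i a => ((hz i).1 a).memLp (neg_nonpos.2 (hτ i).le)

theorem EqZ.symm {ι : Type*} {z z' : ZVec ι n K} (h : EqZ τ z z') : EqZ τ z' z :=
  ⟨h.1.symm, fun i => (h.2 i).symm⟩

theorem EqZ.trans {ι : Type*} {z z' z'' : ZVec ι n K} (h : EqZ τ z z') (h' : EqZ τ z' z'') :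
    EqZ τ z z'' :=
  ⟨h.1.trans h'.1, fun i => (h.2 i).trans (h'.2 i)⟩

theorem EqZ.integral_mulVec_eq {ι κ : Type*} [Fintype κ] (hτ : ∀ i, 0 < τ i) {z z' : ZVec ι n K}
    (h : EqZ τ z z') (M : ℝ → Matrix κ (Fin n) ℝ) (i : Fin K) :
    ∫ s in (-τ i)..0, M s *ᵥ z.2 i s = ∫ s in (-τ i)..0, M s *ᵥ z'.2 i s := by
  simp only [intervalIntegral_eq_setIntegral_Icc (neg_nonpos.2 (hτ i).le)]
  refine integral_congr_ae ?_
  filter_upwards [h.2 i] with s hs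
  rw [hs]

/-- The part of the components of `P_{P,Q_i,S_i,R_ij} z` in which `φ_i` appears under an
integral. -/
noncomputable def PQRS.integralPart [NeZero K] (τ : Fin K → ℝ) (ρ : PQRS (Fin n) n K)
    (z : ZVec (Fin n) n K) (i : Fin K) (s : ℝ) : Fin n → ℝ :=
  tauMax τ • ((ρ.Q i s)ᵀ *ᵥ z.1) + ∑ j, ∫ θ in (-τ j)..0, ρ.R i j s θ *ᵥ z.2 j θ

theorem PQRS.op_snd [NeZero K] (z : ZVec (Fin n) n K) (i : Fin K) (s : ℝ) :
    (ρ.op τ z).2 i s = ρ.integralPart τ z i s + tauMax τ • (ρ.S i s *ᵥ z.2 i s) := by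
  simp only [PQRS.op, PQRS.integralPart]
  abel

theorem EqZ.integralPart_eq [NeZero K] (hτ : ∀ i, 0 < τ i) {z z' : ZVec (Fin n) n K}
    (h : EqZ τ z z') (i : Fin K) (s : ℝ) :
    ρ.integralPart τ z i s = ρ.integralPart τ z' i s := by
  simp only [PQRS.integralPart, h.1, h.integral_mulVec_eq hτ]

theorem EqZ.op [NeZero K] (hτ : ∀ i, 0 < τ i) {z z' : ZVec (Fin n) n K} (h : EqZ τ z z') :
    EqZ τ (ρ.op τ z) (ρ.op τ z') := by
  refine ⟨?_, fun i => ?_⟩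
  · simp only [PQRS.op, h.1, h.integral_mulVec_eq hτ]
  · filter_upwards [h.2 i] with s hs
    rw [PQRS.op_snd, PQRS.op_snd, h.integralPart_eq hτ, hs]

variable [NeZero K]

theorem PQRS.Compatible.memLp_R_zero (hτ : ∀ i, 0 < τ i) (hρ : ρ.IsSobolev τ)
    (hc : ρ.Compatible τ) (i j : Fin K) (a b : Fin n) :
    MemLp (fun θ => ρ.R i j 0 θ a b) 2 (delayMeasure τ j) := by
  refine ((hρ.1 j a b).memLp (neg_nonpos.2 (hτ j).le)).ae_eq ?_
  filter_upwards [hc.Q_eq i j] with s hs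
  rw [hs]

theorem PQRS.Compatible.memLp_R_slice (hτ : ∀ i, 0 < τ i) (hρ : ρ.IsSobolev τ)
    (hc : ρ.Compatible τ) (i j : Fin K) {s : ℝ} (hs : s ∈ Icc (-τ i) 0) (a b : Fin n) :
    MemLp (fun θ => ρ.R i j s θ a b) 2 (delayMeasure τ j) :=
  (hρ.2.2 i j a b).memLp_slice (hc.memLp_R_zero hτ hρ i j a b) hs

theorem integral_R_apply (hτ : ∀ i, 0 < τ i) (hρ : ρ.IsSobolev τ)
    (hc : ρ.Compatible τ) (i j : Fin K) {f : ℝ → Fin n → ℝ} (hf : MemLp f 2 (delayMeasure τ j))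
    {s : ℝ} (hs : s ∈ Icc (-τ i) 0) (a : Fin n) :
    (∫ θ in (-τ j)..0, ρ.R i j s θ *ᵥ f θ) a
      = ∑ b, ∫ θ in Icc (-τ j) 0, ρ.R i j s θ a b * f θ b := by
  have hR := hc.memLp_R_slice hτ hρ i j hs
  rw [intervalIntegral_eq_setIntegral_Icc (neg_nonpos.2 (hτ j).le),
    eval_integral fun a => (integrable_mulVec hR hf).eval a]
  simp only [mulVec, dotProduct]
  rw [integral_finsetSum _ fun b _ =>
    MemLp.integrable_mul_two (hR a b) (memLp_pi_iff.1 hf b)]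

/-- Integration against R_ij gains regularity: the integral is a primitive in s whatever the L²
function f is. -/
theorem w12_integral_R (hτ : ∀ i, 0 < τ i) (hρ : ρ.IsSobolev τ)
    (hc : ρ.Compatible τ) (i j : Fin K) {f : ℝ → Fin n → ℝ} (hf : MemLp f 2 (delayMeasure τ j))
    (a : Fin n) : W12 (-τ i) 0 (fun s => (∫ θ in (-τ j)..0, ρ.R i j s θ *ᵥ f θ) a) := by
  have h0 := neg_nonpos.2 (hτ i).le
  refine (W12.sum Finset.univ h0 (g := fun b s => ∫ θ in Icc (-τ j) 0, ρ.R i j s θ a b * f θ b)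
    fun b _ => ?_).congr h0 fun s hs => (integral_R_apply hτ hρ hc i j hf hs a).symm
  exact W12.of_eq_integral h0
    (memLp_integral_kernel (hρ.2.2 i j a b).memLp_deriv (memLp_pi_iff.1 hf b)) fun s hs =>
      (hρ.2.2 i j a b).integral_mul_eq (hc.memLp_R_zero hτ hρ i j a b) (memLp_pi_iff.1 hf b) hs

theorem ae_hasDerivAt_integral_R (hτ : ∀ i, 0 < τ i) (hρ : ρ.IsSobolev τ)
    (hc : ρ.Compatible τ) (i j : Fin K) {f : ℝ → Fin n → ℝ} (hf : MemLp f 2 (delayMeasure τ j)) :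
    ∀ᵐ s ∂(delayMeasure τ i), HasDerivAt (fun s => ∫ θ in (-τ j)..0, ρ.R i j s θ *ᵥ f θ)
      (∫ θ in (-τ j)..0, matDeriv (fun σ => ρ.R i j σ θ) s *ᵥ f θ) s := by
  have h0 := neg_nonpos.2 (hτ i).le
  have h1 : ∀ a b, ∀ᵐ s ∂(delayMeasure τ i),
      HasDerivAt (fun s => ∫ θ in Icc (-τ j) 0, ρ.R i j s θ a b * f θ b)
        (∫ θ in Icc (-τ j) 0, deriv (fun σ => ρ.R i j σ θ a b) s * f θ b) s := fun a b =>
    ae_hasDerivAt_of_eq_integral h0 (intervalIntegrable_of_memLp_two h0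
      (memLp_integral_kernel (hρ.2.2 i j a b).memLp_deriv (memLp_pi_iff.1 hf b))) fun s hs =>
      (hρ.2.2 i j a b).integral_mul_eq (hc.memLp_R_zero hτ hρ i j a b)
        (memLp_pi_iff.1 hf b) hs
  have h2 : ∀ a b, ∀ᵐ s ∂(delayMeasure τ i),
      MemLp (fun θ => deriv (fun σ => ρ.R i j σ θ a b) s) 2 (delayMeasure τ j) := fun a b =>
    memLp_slice (hρ.2.2 i j a b).memLp_deriv
  filter_upwards [ae_all_iff.2 fun a => ae_all_iff.2 (h1 a),
    ae_all_iff.2 fun a => ae_all_iff.2 (h2 a), ae_mem_Ioo (-τ i) 0] with s hs1 hs2 hs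
  rw [hasDerivAt_pi]
  intro a
  have e : (∫ θ in (-τ j)..0, matDeriv (fun σ => ρ.R i j σ θ) s *ᵥ f θ) a
      = ∑ b, ∫ θ in Icc (-τ j) 0, deriv (fun σ => ρ.R i j σ θ a b) s * f θ b := by
    rw [intervalIntegral_eq_setIntegral_Icc (neg_nonpos.2 (hτ j).le),
      eval_integral fun a => (integrable_mulVec (M := fun θ => matDeriv (fun σ => ρ.R i j σ θ) s)
        hs2 hf).eval a]
    simp only [mulVec, dotProduct, matDeriv, of_apply]
    rw [integral_finsetSum _ fun b _ =>
      MemLp.integrable_mul_two (hs2 a b) (memLp_pi_iff.1 hf b)]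
  rw [e]
  refine (HasDerivAt.fun_sum fun b _ => hs1 a b).congr_of_eventuallyEq ?_
  filter_upwards [Ioo_mem_nhds hs.1 hs.2] with r hr
  exact integral_R_apply hτ hρ hc i j hf (Ioo_subset_Icc_self hr) a

theorem w12_integralPart (hτ : ∀ i, 0 < τ i) (hρ : ρ.IsSobolev τ) (hc : ρ.Compatible τ)
    {z : ZVec (Fin n) n K} (hz : MemZ τ z) (i : Fin K) (a : Fin n) :
    W12 (-τ i) 0 (fun s => ρ.integralPart τ z i s a) := by
  have h0 := neg_nonpos.2 (hτ i).le
  simp only [PQRS.integralPart, Pi.add_apply, Pi.smul_apply, smul_eq_mul, Finset.sum_apply,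
    mulVec, dotProduct, transpose_apply]
  refine W12.add h0 (W12.const_mul h0 _ (W12.sum _ h0 fun b _ => ?_))
    (W12.sum _ h0 fun j _ => w12_integral_R hτ hρ hc i j (hz j) a)
  exact W12.mul h0 (hρ.1 i b a) (W12.const h0 _)

/-- This is where both boundary conditions enter: Q_j = R_ij(0,·) and the formula for P make the
value of the i-th component at s = 0 match the first component of the image. -/
theorem integralPart_zero (hτ : ∀ i, 0 < τ i) (hc : ρ.Compatible τ) (z : ZVec (Fin n) n K)
    (i : Fin K) : ρ.integralPart τ z i 0 + tauMax τ • (ρ.S i 0 *ᵥ z.1) = (ρ.op τ z).1 := by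
  have h : ∀ j, ∫ θ in (-τ j)..0, ρ.R i j 0 θ *ᵥ z.2 j θ
      = ∫ θ in (-τ j)..0, ρ.Q j θ *ᵥ z.2 j θ := by
    intro j
    simp only [intervalIntegral_eq_setIntegral_Icc (neg_nonpos.2 (hτ j).le)]
    refine integral_congr_ae ?_
    filter_upwards [hc.Q_eq i j] with s hs
    rw [hs]
  simp only [PQRS.integralPart, PQRS.op, h]
  rw [hc.P_eq i, add_mulVec, smul_mulVec, smul_mulVec]
  abel

/-! ### The operator is a bijection of `X` -/

omit [NeZero K] in
-- Estimate w·q by the largest entry of w times ∑|q_b|, and cancel that entry against |w|².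
theorem mul_abs_apply_le_of_coercive {ε : ℝ} (hε : 0 ≤ ε) {w q : Fin n → ℝ}
    (h : ε * (w ⬝ᵥ w) ≤ w ⬝ᵥ q) (a : Fin n) : ε * |w a| ≤ ∑ b, |q b| := by
  obtain ⟨c, -, hc⟩ := Finset.exists_max_image Finset.univ (fun b => |w b|) ⟨a, Finset.mem_univ a⟩
  have h1 : |w c| * |w c| ≤ w ⬝ᵥ w := by
    rw [abs_mul_abs_self]
    exact Finset.single_le_sum (f := fun b => w b * w b) (fun b _ => mul_self_nonneg _)
      (Finset.mem_univ c)
  have h2 : w ⬝ᵥ q ≤ |w c| * ∑ b, |q b| := by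
    rw [dotProduct, Finset.mul_sum]
    refine Finset.sum_le_sum fun b hb => (le_abs_self _).trans ?_
    rw [abs_mul]
    exact mul_le_mul_of_nonneg_right (hc b hb) (abs_nonneg _)
  have hs : 0 ≤ ∑ b, |q b| := Finset.sum_nonneg fun _ _ => abs_nonneg _
  refine (mul_le_mul_of_nonneg_left (hc a (Finset.mem_univ a)) hε).trans ?_
  rcases (abs_nonneg (w c)).eq_or_lt with h0 | h0
  · rw [← h0, mul_zero]; exact hs
  · refine le_of_mul_le_mul_left ?_ h0
    nlinarith [mul_le_mul_of_nonneg_left h1 hε]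

omit [NeZero K] in
theorem eq_of_coercive {ε : ℝ} (hε : 0 < ε) {M : Matrix (Fin n) (Fin n) ℝ}
    (hM : ∀ v, ε * (v ⬝ᵥ v) ≤ v ⬝ᵥ (M *ᵥ v)) {v w : Fin n → ℝ} (h : M *ᵥ v = M *ᵥ w) : v = w := by
  have h1 := hM (v - w)
  rw [mulVec_sub, h, sub_self, dotProduct_zero] at h1
  have h2 : (v - w) ⬝ᵥ (v - w) = 0 := le_antisymm (by nlinarith) (Finset.sum_nonneg fun _ _ =>
    mul_self_nonneg _)
  exact sub_eq_zero.1 (dotProduct_self_eq_zero.1 h2)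

omit [NeZero K] in
-- Coercivity bounds φ, and subtracting the equation at two points gives M(s)(φ(s) - φ(s')) = g(s) -
-- g(s') - (M(s) - M(s'))φ(s'). Increments of φ are thus controlled by those of g and M, with no
-- need to differentiate an inverse matrix.
theorem w12_of_mulVec_eq {ε c d : ℝ} (hε : 0 < ε) (hcd : c ≤ d)
    {M : ℝ → Matrix (Fin n) (Fin n) ℝ} {φ g : ℝ → Fin n → ℝ}
    (hM : ∀ s ∈ Icc c d, ∀ v, ε * (v ⬝ᵥ v) ≤ v ⬝ᵥ (M s *ᵥ v))
    (hMW : ∀ a b, W12 c d (fun s => M s a b)) (hg : ∀ a, W12 c d (fun s => g s a))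
    (h : ∀ s ∈ Icc c d, M s *ᵥ φ s = g s) (a : Fin n) : W12 c d (fun s => φ s a) := by
  choose B hB0 hB using fun a => (hg a).exists_bound hcd
  have hφ : ∀ s ∈ Icc c d, ∀ a, |φ s a| ≤ ε⁻¹ * ∑ b, B b := by
    intro s hs a
    have h1 := hM s hs (φ s)
    rw [h s hs] at h1
    rw [← div_eq_inv_mul, le_div_iff₀ hε, mul_comm]
    exact (mul_abs_apply_le_of_coercive hε.le h1 a).trans
      (Finset.sum_le_sum fun b _ => hB b s hs)
  set C := ε⁻¹ * ∑ b, B b with hC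
  have hC0 : 0 ≤ C := mul_nonneg (inv_nonneg.2 hε.le) (Finset.sum_nonneg fun b _ => hB0 b)
  refine W12.of_abs_sub_le (Finset.univ : Finset (Fin n ⊕ (Fin n × Fin n)))
    (g := Sum.elim (fun a s => g s a) (fun ab s => M s ab.1 ab.2)) (C := ε⁻¹ * (1 + C)) hcd
    (by positivity) ?_ fun s hs s' hs' => ?_
  · rintro (a | ab) -
    · exact hg a
    · exact hMW ab.1 ab.2
  · have e : M s *ᵥ (φ s - φ s') = g s - g s' - (M s - M s') *ᵥ φ s' := by
      rw [mulVec_sub, sub_mulVec, h s hs, h s' hs']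
      abel
    have h1 := hM s hs (φ s - φ s')
    rw [e] at h1
    have h2 := mul_abs_apply_le_of_coercive hε.le h1 a
    rw [mul_assoc, ← div_eq_inv_mul, le_div_iff₀ hε, mul_comm]
    refine h2.trans ?_
    rw [Fintype.sum_sum_type, Fintype.sum_prod_type]
    simp only [Sum.elim_inl, Sum.elim_inr]
    have h3 : ∀ b, |(g s - g s' - (M s - M s') *ᵥ φ s') b|
        ≤ |g s b - g s' b| + C * ∑ b', |M s b b' - M s' b b'| := by
      intro b
      simp only [Pi.sub_apply, mulVec, dotProduct, Matrix.sub_apply]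
      refine (abs_sub _ _).trans (add_le_add_right ?_ _)
      rw [Finset.mul_sum]
      refine (Finset.abs_sum_le_sum_abs _ _).trans (Finset.sum_le_sum fun b' _ => ?_)
      rw [abs_mul, mul_comm]
      exact mul_le_mul_of_nonneg_right (hφ s' hs' b') (abs_nonneg _)
    refine (Finset.sum_le_sum fun b _ => h3 b).trans ?_
    rw [Finset.sum_add_distrib, ← Finset.mul_sum]
    have p1 : 0 ≤ ∑ b, |g s b - g s' b| := Finset.sum_nonneg fun _ _ => abs_nonneg _
    have p2 : 0 ≤ ∑ b, ∑ b', |M s b b' - M s' b b'| :=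
      Finset.sum_nonneg fun _ _ => Finset.sum_nonneg fun _ _ => abs_nonneg _
    nlinarith [mul_nonneg hC0 p1]

theorem exists_hilbert_inverse (hτ : ∀ i, 0 < τ i) {ε : ℝ} (hε : 0 < ε) (hρ : ρ.IsSobolev τ)
    (hc : ρ.Compatible τ)
    (hco : ∀ z : ZVec (Fin n) n K, MemZ τ z → ε * normSqZ τ z ≤ innerZ τ z (ρ.op τ z)) :
    ∃ Q : ZHilbert n τ →L[ℝ] ZHilbert n τ, (∀ h h', inner ℝ (Q h) h' = inner ℝ h (Q h')) ∧
      (∀ z (hz : MemZ τ z), Q (toHilbert (ρ.op τ z) (hρ.memZ_op hτ hz)) = toHilbert z hz) ∧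
      ∀ z', MemZ τ z' → ∃ z, MemZ τ z ∧ EqZ τ (ρ.op τ z) z' := by
  obtain ⟨Q, h1, h2, h3⟩ := exists_inverse_of_symmetric_coercive
    (W := {z : ZVec (Fin n) n K // MemZ τ z}) (fun z => toHilbert z.1 z.2)
    (fun z => toHilbert (ρ.op τ z.1) (hρ.memZ_op hτ z.2))
    (fun h => by
      obtain ⟨z, hz, rfl⟩ := toHilbert_surjective hτ h
      exact ⟨⟨z, hz⟩, rfl⟩)
    (fun z z' => by
      rw [inner_toHilbert hτ, inner_toHilbert hτ, innerZ_comm, innerZ_op_comm hτ hρ hc z'.2 z.2])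
    hε (fun z => by
      rw [norm_sq_toHilbert hτ, inner_toHilbert hτ]
      exact hco z.1 z.2)
  refine ⟨Q, h1, fun z hz => h2 ⟨z, hz⟩, fun z' hz' => ?_⟩
  obtain ⟨z, hz⟩ := h3 (toHilbert z' hz')
  exact ⟨z.1, z.2, (toHilbert_eq_iff hτ _ hz').1 hz⟩

theorem exists_memX_op_eq (hτ : ∀ i, 0 < τ i) {ε : ℝ} (hε : 0 < ε) (hρ : ρ.IsSobolev τ)
    (hc : ρ.Compatible τ)
    (hco : ∀ z : ZVec (Fin n) n K, MemZ τ z → ε * normSqZ τ z ≤ innerZ τ z (ρ.op τ z))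
    {z' : ZVec (Fin n) n K} (hz' : MemX τ z') : ∃ z, MemX τ z ∧ EqZ τ (ρ.op τ z) z' := by
  obtain ⟨-, -, -, h3⟩ := exists_hilbert_inverse hτ hε hρ hc hco
  obtain ⟨z, hz, hzz'⟩ := h3 z' (hz'.memZ hτ)
  have hM : ∀ i, ∀ s ∈ Icc (-τ i) 0, ∀ v, ε * (v ⬝ᵥ v) ≤ v ⬝ᵥ ((tauMax τ • ρ.S i s) *ᵥ v) := by
    intro i s hs v
    rw [smul_mulVec, dotProduct_smul, smul_eq_mul]
    exact le_dotProduct_S hτ hρ hco i v hs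
  have hunit : ∀ i, ∀ s ∈ Icc (-τ i) 0, IsUnit (tauMax τ • ρ.S i s).det := fun i s hs =>
    (isUnit_iff_isUnit_det _).1 <| mulVec_injective_iff_isUnit.1 fun v w h =>
      eq_of_coercive hε (hM i s hs) h
  set g : Fin K → ℝ → Fin n → ℝ := fun i s => z'.2 i s - ρ.integralPart τ z i s with hg
  -- The Hilbert space solution z is only an L² class. Solving its equation pointwise for the
  -- component selects the continuous representative.
  set φ : Fin K → ℝ → Fin n → ℝ := fun i s => (tauMax τ • ρ.S i s)⁻¹ *ᵥ g i s with hφ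
  have hφg : ∀ i, ∀ s ∈ Icc (-τ i) 0, (tauMax τ • ρ.S i s) *ᵥ φ i s = g i s := by
    intro i s hs
    rw [hφ, mulVec_mulVec, mul_nonsing_inv _ (hunit i s hs), one_mulVec]
  have hW : ∀ i a, W12 (-τ i) 0 (fun s => φ i s a) := by
    intro i a
    have h0 := neg_nonpos.2 (hτ i).le
    refine w12_of_mulVec_eq hε h0 (hM i) (fun a b => ?_) (fun a => ?_) (hφg i) a
    · exact W12.const_mul h0 _ (hρ.2.1 i a b)
    · refine (W12.add h0 ((hz' i).1 a) (W12.const_mul h0 (-1)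
        (w12_integralPart hτ hρ hc hz i a))).congr h0 fun s _ => ?_
      simp only [hg, Pi.sub_apply]
      ring
  have heq : EqZ τ ((z.1, φ) : ZVec (Fin n) n K) z := by
    refine ⟨rfl, fun i => ?_⟩
    filter_upwards [hzz'.2 i, ae_restrict_mem measurableSet_Icc] with s hs hs'
    refine eq_of_coercive hε (hM i s hs') ?_
    rw [hφg i s hs', hg]
    simp only
    rw [← hs, PQRS.op_snd, smul_mulVec]
    abel
  refine ⟨(z.1, φ), fun i => ⟨hW i, ?_⟩, (heq.op hτ).trans hzz'⟩
  have h0 : (0 : ℝ) ∈ Icc (-τ i) 0 := ⟨neg_nonpos.2 (hτ i).le, le_rfl⟩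
  -- At s = 0 the pointwise equation has z.1 as a solution by `integralPart_zero`, and coercivity of
  -- S_i(0) makes it the only one; hence φ_i(0) = z.1.
  refine eq_of_coercive hε (hM i 0 h0) ?_
  simp only
  rw [hφg i 0 h0, hg]
  simp only
  rw [(hz' i).2, ← hzz'.1, ← integralPart_zero hτ hc z i, smul_mulVec]
  abel

end MultiDelay

namespace MultiDelay

open Matrix

/-! ### The quadratic form of the block matrices of the synthesis condition -/

section BlockForms

variable {α β : Type*} [Fintype α] [Fintype β]

theorem dotProduct_symBlocks_mulVec (a : Matrix α α ℝ) (b : Matrix α β ℝ) (c : Matrix β β ℝ)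
    (u : α → ℝ) (u' : β → ℝ) :
    Sum.elim u u' ⬝ᵥ (symBlocks a b c *ᵥ Sum.elim u u')
      = u ⬝ᵥ (a *ᵥ u) + 2 * (u ⬝ᵥ (b *ᵥ u')) + u' ⬝ᵥ (c *ᵥ u') := by
  have h : u' ⬝ᵥ (bᵀ *ᵥ u) = u ⬝ᵥ (b *ᵥ u') := dotProduct_mulVec_comm_of_eq rfl _ _
  rw [symBlocks, fromBlocks_mulVec, sumElim_dotProduct_sumElim, Sum.elim_comp_inl,
    Sum.elim_comp_inr, dotProduct_add, dotProduct_add, h]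
  ring

theorem dotProduct_blockRow_mulVec {r n K : ℕ} (M : Fin K → Matrix (Fin r) (Fin n) ℝ)
    (v : Fin r → ℝ) (y : Fin n × Fin K → ℝ) :
    v ⬝ᵥ (blockRow M *ᵥ y) = ∑ i, v ⬝ᵥ (M i *ᵥ fun a => y (a, i)) := by
  have h : blockRow M *ᵥ y = ∑ i, M i *ᵥ fun a => y (a, i) := by
    funext a
    simp only [blockRow, mulVec, dotProduct, of_apply, Fintype.sum_prod_type_right,
      Finset.sum_apply]
  rw [h, dotProduct_sum]

theorem dotProduct_blockDiagonal_mulVec {n K : ℕ} (M : Fin K → Matrix (Fin n) (Fin n) ℝ)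
    (y : Fin n × Fin K → ℝ) :
    y ⬝ᵥ (blockDiagonal M *ᵥ y)
      = ∑ i, (fun a => y (a, i)) ⬝ᵥ (M i *ᵥ fun a => y (a, i)) := by
  simp only [mulVec, dotProduct, blockDiagonal_apply, Fintype.sum_prod_type_right, ite_mul,
    zero_mul]
  refine Finset.sum_congr rfl fun i _ => Finset.sum_congr rfl fun a _ => ?_
  congr 1
  rw [Finset.sum_comm]
  simp

end BlockForms

variable {n m p q K : ℕ} [NeZero K] (sys : System n m p q K) {τ : Fin K → ℝ}
  {ρ : PQRS (Fin n) n K} (ζ : ZParam p n K)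

theorem dotProduct_Dmat_mulVec (γ : ℝ) (v : Fin q → ℝ) (w : Fin m → ℝ) (y₁ : Fin n → ℝ)
    (y₂ : Fin n × Fin K → ℝ) :
    Sum.elim v (Sum.elim w (Sum.elim y₁ y₂)) ⬝ᵥ
        (Dmat sys τ ρ ζ γ *ᵥ Sum.elim v (Sum.elim w (Sum.elim y₁ y₂)))
      = -(γ / tauMax τ) * (v ⬝ᵥ v) - (γ / tauMax τ) * (w ⬝ᵥ w)
        + 2 * ((1 / tauMax τ) * (v ⬝ᵥ (sys.D1 *ᵥ w))) + 2 * (v ⬝ᵥ (L1 sys τ ρ ζ *ᵥ y₁))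
        + 2 * ∑ i, v ⬝ᵥ (L2 sys τ ρ ζ i *ᵥ fun a => y₂ (a, i))
        + 2 * (y₁ ⬝ᵥ (sys.B1 *ᵥ w)) + 2 * (y₁ ⬝ᵥ (L0 sys τ ρ ζ *ᵥ y₁))
        + 2 * ∑ i, y₁ ⬝ᵥ (L3 sys τ ρ ζ i *ᵥ fun a => y₂ (a, i))
        - ∑ i, (fun a => y₂ (a, i)) ⬝ᵥ (ρ.S i (-τ i) *ᵥ fun a => y₂ (a, i)) := by
  have h1 : y₁ ⬝ᵥ ((L0 sys τ ρ ζ)ᵀ *ᵥ y₁) = y₁ ⬝ᵥ (L0 sys τ ρ ζ *ᵥ y₁) :=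
    dotProduct_mulVec_comm_of_eq rfl _ _
  have h2 : w ⬝ᵥ (sys.B1ᵀ *ᵥ y₁) = y₁ ⬝ᵥ (sys.B1 *ᵥ w) := dotProduct_mulVec_comm_of_eq rfl _ _
  rw [Dmat, dotProduct_symBlocks_mulVec, dotProduct_symBlocks_mulVec, dotProduct_symBlocks_mulVec]
  simp only [fromCols_mulVec, Sum.elim_comp_inl, Sum.elim_comp_inr, dotProduct_add,
    dotProduct_blockRow_mulVec, dotProduct_blockDiagonal_mulVec, smul_mulVec, neg_mulVec,
    one_mulVec, zero_mulVec, dotProduct_smul, dotProduct_neg, dotProduct_zero, smul_eq_mul,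
    add_mulVec, h1, h2, Finset.sum_neg_distrib]
  ring

/-- Moving the system matrices onto v and y₁ isolates the functions Q_i, R_ji(-τ_j,·) and Z_2i,
whose integrals reappear in 𝒫𝐳 and 𝒵𝐳. -/
theorem dotProduct_Emat_mulVec (hT : tauMax τ ≠ 0) (v : Fin q → ℝ) (w : Fin m → ℝ)
    (y₁ : Fin n → ℝ) (y₂ : Fin n × Fin K → ℝ) (i : Fin K) (s : ℝ) (f : Fin n → ℝ) :
    Sum.elim v (Sum.elim w (Sum.elim y₁ y₂)) ⬝ᵥ (Emat sys τ ρ ζ i s *ᵥ f)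
      = ((1 / tauMax τ) • (v ᵥ* sys.C0) + y₁ ᵥ* sys.A0) ⬝ᵥ (ρ.Q i s *ᵥ f)
        + y₁ ⬝ᵥ (matDeriv (ρ.Q i) s *ᵥ f)
        + ∑ j, ((1 / tauMax τ) • (v ᵥ* sys.C j) + y₁ ᵥ* sys.A j) ⬝ᵥ (ρ.R j i (-τ j) s *ᵥ f)
        + ((1 / tauMax τ) • (v ᵥ* sys.D2) + y₁ ᵥ* sys.B2) ⬝ᵥ (ζ.Z2 i s *ᵥ f) := by
  simp only [Emat, smul_mulVec, fromRows_mulVec, dotProduct_smul, sumElim_dotProduct_sumElim,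
    zero_mulVec, dotProduct_zero, add_zero, zero_add, add_mulVec, dotProduct_add, smul_eq_mul,
    sum_mulVec, dotProduct_sum, ← mulVec_mulVec, dotProduct_mulVec _ sys.C0,
    dotProduct_mulVec _ sys.D2, dotProduct_mulVec _ sys.A0, dotProduct_mulVec _ sys.B2,
    dotProduct_mulVec _ (sys.A _), dotProduct_mulVec _ (sys.C _), add_dotProduct, smul_dotProduct,
    Finset.sum_add_distrib, ← Finset.mul_sum]
  field_simp
  ring

end MultiDelay

namespace MultiDelay

open Matrix

/-! ### Integration by parts -/

/-- The componentwise derivative of a vector valued function. -/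
noncomputable def vecDeriv {n : ℕ} (f : ℝ → Fin n → ℝ) (s : ℝ) : Fin n → ℝ :=
  fun a => deriv (fun t => f t a) s

theorem integral_dotProduct_vecDeriv {n : ℕ} {c d : ℝ} (hcd : c ≤ d) {f g : ℝ → Fin n → ℝ}
    (hf : ∀ a, W12 c d (fun s => f s a)) (hg : ∀ a, W12 c d (fun s => g s a)) :
    ∫ s in Icc c d, f s ⬝ᵥ vecDeriv g s
      = f d ⬝ᵥ g d - f c ⬝ᵥ g c - ∫ s in Icc c d, vecDeriv f s ⬝ᵥ g s := by
  simp only [dotProduct, vecDeriv]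
  rw [integral_finsetSum _ fun a _ => MemLp.integrable_mul_two ((hf a).memLp hcd) (hg a).2,
    integral_finsetSum _ fun a _ => MemLp.integrable_mul_two (hf a).2 ((hg a).memLp hcd),
    ← Finset.sum_sub_distrib, ← Finset.sum_sub_distrib]
  refine Finset.sum_congr rfl fun a _ => ?_
  rw [← intervalIntegral_eq_setIntegral_Icc hcd, ← intervalIntegral_eq_setIntegral_Icc hcd]
  exact (hf a).1.integral_mul_deriv_eq_deriv_mul (hg a).1

/-- Integrate the derivative of fᵀMf; symmetry of M merges the two terms containing f'. -/
theorem integral_quadratic_deriv {n : ℕ} {c d : ℝ} (hcd : c ≤ d) {f : ℝ → Fin n → ℝ}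
    {M : ℝ → Matrix (Fin n) (Fin n) ℝ} (hf : ∀ a, W12 c d (fun s => f s a))
    (hM : ∀ a b, W12 c d (fun s => M s a b)) (hMs : ∀ s ∈ Icc c d, M s = (M s)ᵀ) :
    2 * ∫ s in Icc c d, (M s *ᵥ f s) ⬝ᵥ vecDeriv f s
      = f d ⬝ᵥ (M d *ᵥ f d) - f c ⬝ᵥ (M c *ᵥ f c)
        - ∫ s in Icc c d, f s ⬝ᵥ (matDeriv M s *ᵥ f s) := by
  have hMf : ∀ a, W12 c d (fun s => (M s *ᵥ f s) a) := by
    intro a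
    simp only [mulVec, dotProduct]
    exact W12.sum _ hcd fun b _ => W12.mul hcd (hM a b) (hf b)
  have h1 := integral_dotProduct_vecDeriv hcd hMf hf
  have hf2 : MemLp (fun s => vecDeriv f s) 2 (volume.restrict (Icc c d)) :=
    memLp_pi_iff.2 fun a => (hf a).2
  have hfL : MemLp f 2 (volume.restrict (Icc c d)) := memLp_pi_iff.2 fun a => (hf a).memLp hcd
  have hMfL : MemLp (fun s => M s *ᵥ f s) 2 (volume.restrict (Icc c d)) :=
    memLp_pi_iff.2 fun a => (hMf a).memLp hcd
  have hi : Integrable (fun s => (M s *ᵥ f s) ⬝ᵥ vecDeriv f s) (volume.restrict (Icc c d)) :=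
    integrable_dotProduct hMfL hf2
  have hi' : Integrable (fun s => vecDeriv (fun s => M s *ᵥ f s) s ⬝ᵥ f s)
      (volume.restrict (Icc c d)) :=
    integrable_dotProduct (memLp_pi_iff.2 fun a => (hMf a).2) hfL
  have h2 : ∫ s in Icc c d, vecDeriv (fun s => M s *ᵥ f s) s ⬝ᵥ f s
      = (∫ s in Icc c d, f s ⬝ᵥ (matDeriv M s *ᵥ f s))
        + ∫ s in Icc c d, (M s *ᵥ f s) ⬝ᵥ vecDeriv f s := by
    have hd : ∀ᵐ s ∂(volume.restrict (Icc c d)), vecDeriv (fun s => M s *ᵥ f s) s ⬝ᵥ f s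
        - (M s *ᵥ f s) ⬝ᵥ vecDeriv f s = f s ⬝ᵥ (matDeriv M s *ᵥ f s) := by
      filter_upwards [ae_all_iff.2 fun a => (hf a).ae_differentiableAt hcd,
        ae_all_iff.2 fun a => ae_all_iff.2 fun b => (hM a b).ae_differentiableAt hcd,
        ae_restrict_mem measurableSet_Icc] with s h1 h2 h3
      have e : vecDeriv (fun s => M s *ᵥ f s) s = matDeriv M s *ᵥ f s + M s *ᵥ vecDeriv f s := by
        funext a
        simp only [vecDeriv, mulVec, dotProduct, Pi.add_apply, matDeriv, of_apply]
        rw [← Finset.sum_add_distrib]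
        exact (HasDerivAt.fun_sum fun b _ => (h2 a b).hasDerivAt.mul (h1 b).hasDerivAt).deriv
      rw [e, add_dotProduct, dotProduct_comm (matDeriv M s *ᵥ f s), dotProduct_comm (M s *ᵥ _),
        dotProduct_mulVec_comm_of_eq (hMs s h3), dotProduct_comm (vecDeriv f s)]
      ring
    rw [← integral_congr_ae hd, integral_sub hi' hi]
    ring
  rw [h2] at h1
  have e1 : (M d *ᵥ f d) ⬝ᵥ f d = f d ⬝ᵥ (M d *ᵥ f d) := dotProduct_comm _ _
  have e2 : (M c *ᵥ f c) ⬝ᵥ f c = f c ⬝ᵥ (M c *ᵥ f c) := dotProduct_comm _ _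
  rw [e1, e2] at h1
  linarith

/-! ### Integration by parts for the components of 𝒫𝐳 -/

section Energy

variable {n K : ℕ} {τ : Fin K → ℝ} {ρ : PQRS (Fin n) n K} [NeZero K]

theorem integral_dotProduct_integralPart (hτ : ∀ i, 0 < τ i) (hρ : ρ.IsSobolev τ)
    (hc : ρ.Compatible τ) {z : ZVec (Fin n) n K} (hz : MemZ τ z) (i : Fin K) :
    ∫ s, vecDeriv (ρ.integralPart τ z i) s ⬝ᵥ z.2 i s ∂(delayMeasure τ i)
      = tauMax τ * (∫ s, z.1 ⬝ᵥ (matDeriv (ρ.Q i) s *ᵥ z.2 i s) ∂(delayMeasure τ i))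
        + ∑ j, ∫ p, z.2 i p.1 ⬝ᵥ (matDeriv (fun σ => ρ.R i j σ p.2) p.1 *ᵥ z.2 j p.2)
            ∂((delayMeasure τ i).prod (delayMeasure τ j)) := by
  have h0 := neg_nonpos.2 (hτ i).le
  have hR : ∀ j a b, MemLp (fun p : ℝ × ℝ => matDeriv (fun σ => ρ.R i j σ p.2) p.1 a b) 2
      ((delayMeasure τ i).prod (delayMeasure τ j)) := fun j a b => (hρ.2.2 i j a b).memLp_deriv
  have hQ : ∀ a b, MemLp (fun s => matDeriv (ρ.Q i) s a b) 2 (delayMeasure τ i) :=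
    fun a b => (hρ.1 i a b).2
  have hd : ∀ᵐ s ∂(delayMeasure τ i), vecDeriv (ρ.integralPart τ z i) s
      = tauMax τ • ((matDeriv (ρ.Q i) s)ᵀ *ᵥ z.1)
        + ∑ j, ∫ θ, matDeriv (fun σ => ρ.R i j σ θ) s *ᵥ z.2 j θ ∂(delayMeasure τ j) := by
    filter_upwards [ae_all_iff.2 fun j => ae_hasDerivAt_integral_R hτ hρ hc i j (hz j),
      ae_all_iff.2 fun a => ae_all_iff.2 fun b => (hρ.1 i a b).ae_differentiableAt h0] with s h1 h2
    funext a
    have e1 : HasDerivAt (fun s => ((ρ.Q i s)ᵀ *ᵥ z.1) a) (((matDeriv (ρ.Q i) s)ᵀ *ᵥ z.1) a) s := by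
      simp only [mulVec, dotProduct, transpose_apply, matDeriv, of_apply]
      exact HasDerivAt.fun_sum fun b _ => (h2 b a).hasDerivAt.mul_const _
    have e2 : HasDerivAt (fun s => ∑ j, (∫ θ in (-τ j)..0, ρ.R i j s θ *ᵥ z.2 j θ) a)
        (∑ j, (∫ θ in (-τ j)..0, matDeriv (fun σ => ρ.R i j σ θ) s *ᵥ z.2 j θ) a) s :=
      HasDerivAt.fun_sum fun j _ => hasDerivAt_pi.1 (h1 j) a
    have e3 := ((e1.const_mul (tauMax τ)).add e2).deriv
    simp only [intervalIntegral_eq_setIntegral_Icc (neg_nonpos.2 (hτ _).le)] at e3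
    simp only [vecDeriv, PQRS.integralPart, Pi.add_apply, Pi.smul_apply, smul_eq_mul,
      Finset.sum_apply, intervalIntegral_eq_setIntegral_Icc (neg_nonpos.2 (hτ _).le)]
    exact e3
  have i1 : Integrable (fun s => tauMax τ * (z.2 i s ⬝ᵥ ((matDeriv (ρ.Q i) s)ᵀ *ᵥ z.1)))
      (delayMeasure τ i) :=
    (integrable_dotProduct (hz i) (memLp_mulVec_const (fun a b => hQ b a) z.1)).const_mul _
  have i2 : ∀ j ∈ Finset.univ, Integrable (fun s => z.2 i s ⬝ᵥ
      ∫ θ, matDeriv (fun σ => ρ.R i j σ θ) s *ᵥ z.2 j θ ∂(delayMeasure τ j))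
      (delayMeasure τ i) := fun j _ =>
    integrable_dotProduct (hz i) (memLp_integral_kernel_mulVec (hR j) (hz j))
  have hd' : ∀ᵐ s ∂(delayMeasure τ i), vecDeriv (ρ.integralPart τ z i) s ⬝ᵥ z.2 i s
      = tauMax τ * (z.2 i s ⬝ᵥ ((matDeriv (ρ.Q i) s)ᵀ *ᵥ z.1)) + ∑ j, z.2 i s ⬝ᵥ
          ∫ θ, matDeriv (fun σ => ρ.R i j σ θ) s *ᵥ z.2 j θ ∂(delayMeasure τ j) := by
    filter_upwards [hd] with s hs
    rw [hs, dotProduct_comm, dotProduct_add, dotProduct_smul, dotProduct_sum, smul_eq_mul]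
  rw [integral_congr_ae hd', integral_add i1 (integrable_finsetSum _ i2), integral_finsetSum _ i2,
    integral_const_mul]
  congr 1
  · congr 1
    exact integral_congr_ae (Filter.Eventually.of_forall fun s =>
      dotProduct_mulVec_comm_of_eq rfl _ _)
  · exact Finset.sum_congr rfl fun j _ => integral_dotProduct_kernel_mulVec (hR j) (hz j) (hz i)

/-- The component splits into an integral part, handled by ordinary integration by parts, and τ_K
S_i φ_i, handled by the quadratic formula. The boundary values of S_i that survive are the source of
½S_i(0) in `L0` and of -S_i(-τ_i) in `Dmat`. -/
theorem boundary_sub_integral_op (hτ : ∀ i, 0 < τ i) (hρ : ρ.IsSobolev τ)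
    (hc : ρ.Compatible τ) {z : ZVec (Fin n) n K} (hz : MemX τ z) (i : Fin K) :
    (ρ.op τ z).2 i 0 ⬝ᵥ z.2 i 0 - (ρ.op τ z).2 i (-τ i) ⬝ᵥ z.2 i (-τ i)
        - ∫ s, (ρ.op τ z).2 i s ⬝ᵥ vecDeriv (z.2 i) s ∂(delayMeasure τ i)
      = tauMax τ * (∫ s, z.1 ⬝ᵥ (matDeriv (ρ.Q i) s *ᵥ z.2 i s) ∂(delayMeasure τ i))
        + tauMax τ / 2 * (∫ s, z.2 i s ⬝ᵥ (matDeriv (ρ.S i) s *ᵥ z.2 i s) ∂(delayMeasure τ i))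
        + tauMax τ / 2 * (z.1 ⬝ᵥ (ρ.S i 0 *ᵥ z.1)
            - z.2 i (-τ i) ⬝ᵥ (ρ.S i (-τ i) *ᵥ z.2 i (-τ i)))
        + ∑ j, ∫ p, z.2 i p.1 ⬝ᵥ (matDeriv (fun σ => ρ.R i j σ p.2) p.1 *ᵥ z.2 j p.2)
            ∂((delayMeasure τ i).prod (delayMeasure τ j)) := by
  have h0 := neg_nonpos.2 (hτ i).le
  have hzZ := hz.memZ hτ
  have hd2 : MemLp (fun s => vecDeriv (z.2 i) s) 2 (delayMeasure τ i) :=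
    memLp_pi_iff.2 fun a => ((hz i).1 a).2
  have i1 : Integrable (fun s => ρ.integralPart τ z i s ⬝ᵥ vecDeriv (z.2 i) s)
      (delayMeasure τ i) := integrable_dotProduct
    (memLp_pi_iff.2 fun a => (w12_integralPart hτ hρ hc hzZ i a).memLp h0) hd2
  have i2 : Integrable (fun s => tauMax τ * ((ρ.S i s *ᵥ z.2 i s) ⬝ᵥ vecDeriv (z.2 i) s))
      (delayMeasure τ i) := (integrable_dotProduct (hρ.memLp_S hτ hzZ i) hd2).const_mul _
  have h1 := integral_dotProduct_vecDeriv h0 (w12_integralPart hτ hρ hc hzZ i) (hz i).1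
  have h2 := integral_quadratic_deriv h0 (hz i).1 (hρ.2.1 i) (hc.S_symm i)
  rw [integral_dotProduct_integralPart hτ hρ hc hzZ i] at h1
  rw [(hz i).2] at h1 h2 ⊢
  simp only [PQRS.op_snd, add_dotProduct, smul_dotProduct, smul_eq_mul]
  rw [integral_add i1 i2, integral_const_mul, (hz i).2, dotProduct_comm (ρ.S i 0 *ᵥ z.1),
    dotProduct_comm (ρ.S i (-τ i) *ᵥ z.2 i (-τ i))]
  linear_combination (-1) * h1 - tauMax τ / 2 * h2

end Energy

end MultiDelay

namespace MultiDelay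

open Matrix

/-! ### The energy identity -/

section Synthesis

variable {n m p q K : ℕ} [NeZero K] (sys : System n m p q K) {τ : Fin K → ℝ}
  {ρ : PQRS (Fin n) n K} (ζ : ZParam p n K)

theorem memLp_const_mul_matrix {α : Type*} [MeasurableSpace α] {μ : Measure α} {ι κ r : Type*}
    [Fintype κ] (C : Matrix ι κ ℝ) {M : α → Matrix κ r ℝ} {e : ENNReal}
    (hM : ∀ a b, MemLp (fun x => M x a b) e μ) (a : ι) (b : r) :
    MemLp (fun x => (C * M x) a b) e μ := by
  simp only [Matrix.mul_apply]
  exact memLp_finsetSum _ fun c _ => (hM c b).const_mul _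

theorem squareIntegrable_synthesisParam (hτ : ∀ i, 0 < τ i) (hρ : ρ.IsSobolev τ)
    (hc : ρ.Compatible τ) (hζ : ∀ i a b, W12 (-τ i) 0 (fun s => ζ.Z2 i s a b)) (γ : ℝ) :
    (synthesisParam sys τ ρ ζ γ).SquareIntegrable τ where
  Q i a b := by
    have h0 := neg_nonpos.2 (hτ i).le
    have hQ : ∀ a b, MemLp (fun s => ρ.Q i s a b) 2 (delayMeasure τ i) := fun a b =>
      (hρ.1 i a b).memLp h0
    have hQ' : ∀ a b, MemLp (fun s => matDeriv (ρ.Q i) s a b) 2 (delayMeasure τ i) := fun a b =>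
      (hρ.1 i a b).2
    have hR : ∀ j a b, MemLp (fun s => ρ.R j i (-τ j) s a b) 2 (delayMeasure τ i) := fun j a b =>
      hc.memLp_R_slice hτ hρ j i ⟨le_rfl, neg_nonpos.2 (hτ j).le⟩ a b
    have hZ : ∀ a b, MemLp (fun s => ζ.Z2 i s a b) 2 (delayMeasure τ i) := fun a b =>
      (hζ i a b).memLp h0
    rcases a with a | a | a | a
    · have : MemLp (fun s => (1 / tauMax τ) * ((sys.C0 * ρ.Q i s) a b
          + ∑ j, (sys.C j * ρ.R j i (-τ j) s) a b + (sys.D2 * ζ.Z2 i s) a b)) 2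
          (delayMeasure τ i) :=
        (((memLp_const_mul_matrix _ hQ a b).add (memLp_finsetSum _ fun j _ =>
          memLp_const_mul_matrix _ (hR j) a b)).add (memLp_const_mul_matrix _ hZ a b)).const_mul _
      simpa [synthesisParam, Emat, Matrix.add_apply, Matrix.sum_apply] using this
    · simp [synthesisParam, Emat]
    · have : MemLp (fun s => (1 / tauMax τ) * (tauMax τ * ((sys.A0 * ρ.Q i s) a b
          + matDeriv (ρ.Q i) s a b
          + ∑ j, (sys.A j * ρ.R j i (-τ j) s) a b + (sys.B2 * ζ.Z2 i s) a b))) 2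
          (delayMeasure τ i) :=
        (((((memLp_const_mul_matrix _ hQ a b).add (hQ' a b)).add (memLp_finsetSum _ fun j _ =>
          memLp_const_mul_matrix _ (hR j) a b)).add
          (memLp_const_mul_matrix _ hZ a b)).const_mul _).const_mul _
      simpa only [synthesisParam, Emat, Matrix.add_apply, Matrix.sum_apply, Matrix.smul_apply,
        fromRows_apply_inl, fromRows_apply_inr, smul_eq_mul] using this
    · simp [synthesisParam, Emat]
  R i j a b := by
    have h1 := (hρ.2.2 i j a b).memLp_deriv
    have h2 := (hρ.2.2 j i b a).memLp_deriv.comp_measurePreserving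
      Measure.measurePreserving_swap
    exact h1.add h2

theorem sum_integral_dotProduct_Emat (hτ : ∀ i, 0 < τ i) (hρ : ρ.IsSobolev τ)
    (hc : ρ.Compatible τ) (hζ : ∀ i a b, W12 (-τ i) 0 (fun s => ζ.Z2 i s a b))
    {z : ZVec (Fin n) n K} (hz : MemZ τ z) (v : Fin q → ℝ) (w : Fin m → ℝ)
    (y₁ : Fin n → ℝ) (y₂ : Fin n × Fin K → ℝ) :
    ∑ i, ∫ s, Sum.elim v (Sum.elim w (Sum.elim y₁ y₂)) ⬝ᵥ (Emat sys τ ρ ζ i s *ᵥ z.2 i s)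
        ∂(delayMeasure τ i)
      = ((1 / tauMax τ) • (v ᵥ* sys.C0) + y₁ ᵥ* sys.A0) ⬝ᵥ
          (∑ i, ∫ s in (-τ i)..0, ρ.Q i s *ᵥ z.2 i s)
        + ∑ i, (∫ s, y₁ ⬝ᵥ (matDeriv (ρ.Q i) s *ᵥ z.2 i s) ∂(delayMeasure τ i))
        + ∑ j, ((1 / tauMax τ) • (v ᵥ* sys.C j) + y₁ ᵥ* sys.A j) ⬝ᵥ
          (∑ i, ∫ s in (-τ i)..0, ρ.R j i (-τ j) s *ᵥ z.2 i s)
        + ((1 / tauMax τ) • (v ᵥ* sys.D2) + y₁ ᵥ* sys.B2) ⬝ᵥ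
          (∑ i, ∫ s in (-τ i)..0, ζ.Z2 i s *ᵥ z.2 i s) := by
  have hT : tauMax τ ≠ 0 := (hτ _).ne'
  have iQ : ∀ i, Integrable (fun s => ρ.Q i s *ᵥ z.2 i s) (delayMeasure τ i) := fun i =>
    integrable_mulVec (fun a b => (hρ.1 i a b).memLp (neg_nonpos.2 (hτ i).le)) (hz i)
  have iQ' : ∀ i, Integrable (fun s => matDeriv (ρ.Q i) s *ᵥ z.2 i s) (delayMeasure τ i) :=
    fun i => integrable_mulVec (fun a b => (hρ.1 i a b).2) (hz i)
  have iR : ∀ i j, Integrable (fun s => ρ.R j i (-τ j) s *ᵥ z.2 i s) (delayMeasure τ i) :=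
    fun i j => integrable_mulVec
      (hc.memLp_R_slice hτ hρ j i ⟨le_rfl, neg_nonpos.2 (hτ j).le⟩) (hz i)
  have iZ : ∀ i, Integrable (fun s => ζ.Z2 i s *ᵥ z.2 i s) (delayMeasure τ i) := fun i =>
    integrable_mulVec (fun a b => (hζ i a b).memLp (neg_nonpos.2 (hτ i).le)) (hz i)
  have idot : ∀ {i : Fin K} {r : ℕ} (c : Fin r → ℝ) {f : ℝ → Fin r → ℝ},
      Integrable f (delayMeasure τ i) → Integrable (fun s => c ⬝ᵥ f s) (delayMeasure τ i) :=
    fun c f hf => integrable_finsetSum _ fun a _ => (hf.eval a).const_mul _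
  set c0 := (1 / tauMax τ) • (v ᵥ* sys.C0) + y₁ ᵥ* sys.A0 with hc0
  set c1 := fun j => (1 / tauMax τ) • (v ᵥ* sys.C j) + y₁ ᵥ* sys.A j with hc1
  set c2 := (1 / tauMax τ) • (v ᵥ* sys.D2) + y₁ ᵥ* sys.B2 with hc2
  have h : ∀ i, ∫ s, Sum.elim v (Sum.elim w (Sum.elim y₁ y₂)) ⬝ᵥ (Emat sys τ ρ ζ i s *ᵥ z.2 i s)
        ∂(delayMeasure τ i)
      = c0 ⬝ᵥ (∫ s in (-τ i)..0, ρ.Q i s *ᵥ z.2 i s)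
        + (∫ s, y₁ ⬝ᵥ (matDeriv (ρ.Q i) s *ᵥ z.2 i s) ∂(delayMeasure τ i))
        + ∑ j, c1 j ⬝ᵥ (∫ s in (-τ i)..0, ρ.R j i (-τ j) s *ᵥ z.2 i s)
        + c2 ⬝ᵥ (∫ s in (-τ i)..0, ζ.Z2 i s *ᵥ z.2 i s) := by
    intro i
    have j1 := idot c0 (iQ i)
    have j2 := idot y₁ (iQ' i)
    have j3 : ∀ j ∈ Finset.univ, Integrable (fun s => c1 j ⬝ᵥ (ρ.R j i (-τ j) s *ᵥ z.2 i s))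
      (delayMeasure τ i) := fun j _ => idot (c1 j) (iR i j)
    have j12 : Integrable (fun s => c0 ⬝ᵥ (ρ.Q i s *ᵥ z.2 i s)
        + y₁ ⬝ᵥ (matDeriv (ρ.Q i) s *ᵥ z.2 i s)) (delayMeasure τ i) := j1.add j2
    have j123 : Integrable (fun s => c0 ⬝ᵥ (ρ.Q i s *ᵥ z.2 i s)
        + y₁ ⬝ᵥ (matDeriv (ρ.Q i) s *ᵥ z.2 i s)
        + ∑ j, c1 j ⬝ᵥ (ρ.R j i (-τ j) s *ᵥ z.2 i s)) (delayMeasure τ i) :=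
      j12.add (integrable_finsetSum _ j3)
    simp only [dotProduct_Emat_mulVec sys ζ hT]
    rw [integral_add j123 (idot c2 (iZ i)), integral_add j12 (integrable_finsetSum _ j3),
      integral_add j1 j2, integral_finsetSum _ j3]
    simp only [intervalIntegral_eq_setIntegral_Icc (neg_nonpos.2 (hτ _).le)]
    rw [dotProduct_integral c0 (iQ i), dotProduct_integral c2 (iZ i),
      Finset.sum_congr rfl fun j _ => dotProduct_integral (c1 j) (iR i j)]
  rw [Finset.sum_congr rfl fun i _ => h i]
  simp only [Finset.sum_add_distrib, dotProduct_sum]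
  rw [Finset.sum_comm (f := fun j i => c1 j ⬝ᵥ (∫ s in (-τ i)..0, ρ.R j i (-τ j) s *ᵥ z.2 i s))]

omit [NeZero K] in
-- Exchanging the two variables together with i and j carries one summand of G_ij to the other, so
-- the two contribute equally.
theorem sum_integral_Gmat (hρ : ρ.IsSobolev τ) {φ : Fin K → ℝ → Fin n → ℝ}
    (hφ : ∀ i, MemLp (φ i) 2 (delayMeasure τ i)) :
    ∑ i, ∑ j, ∫ p, φ i p.1 ⬝ᵥ (Gmat ρ i j p.1 p.2 *ᵥ φ j p.2)
        ∂((delayMeasure τ i).prod (delayMeasure τ j))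
      = 2 * ∑ i, ∑ j, ∫ p, φ i p.1 ⬝ᵥ (matDeriv (fun σ => ρ.R i j σ p.2) p.1 *ᵥ φ j p.2)
        ∂((delayMeasure τ i).prod (delayMeasure τ j)) := by
  have hi : ∀ i j, Integrable (fun p : ℝ × ℝ => φ i p.1 ⬝ᵥ
      (matDeriv (fun σ => ρ.R i j σ p.2) p.1 *ᵥ φ j p.2))
      ((delayMeasure τ i).prod (delayMeasure τ j)) := fun i j =>
    integrable_dotProduct_kernel_mulVec (R := fun s θ => matDeriv (fun σ => ρ.R i j σ θ) s)
      (fun a b => (hρ.2.2 i j a b).memLp_deriv) (hφ j) (hφ i)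
  have h : ∀ i j, ∫ p, φ i p.1 ⬝ᵥ (Gmat ρ i j p.1 p.2 *ᵥ φ j p.2)
        ∂((delayMeasure τ i).prod (delayMeasure τ j))
      = (∫ p, φ i p.1 ⬝ᵥ (matDeriv (fun σ => ρ.R i j σ p.2) p.1 *ᵥ φ j p.2)
        ∂((delayMeasure τ i).prod (delayMeasure τ j)))
      + ∫ p, φ j p.1 ⬝ᵥ (matDeriv (fun σ => ρ.R j i σ p.2) p.1 *ᵥ φ i p.2)
        ∂((delayMeasure τ j).prod (delayMeasure τ i)) := by
    intro i j
    have hs : Integrable (fun p : ℝ × ℝ => φ j p.swap.1 ⬝ᵥ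
        (matDeriv (fun σ => ρ.R j i σ p.swap.2) p.swap.1 *ᵥ φ i p.swap.2))
        ((delayMeasure τ i).prod (delayMeasure τ j)) := (hi j i).swap
    rw [← integral_prod_swap (μ := delayMeasure τ j) (ν := delayMeasure τ i)
      (fun p => φ j p.1 ⬝ᵥ (matDeriv (fun σ => ρ.R j i σ p.2) p.1 *ᵥ φ i p.2)),
      ← integral_add (hi i j) hs]
    refine integral_congr_ae (Filter.Eventually.of_forall fun p => ?_)
    simp only [Gmat, add_mulVec, dotProduct_add, Prod.fst_swap, Prod.snd_swap]
    congr 1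
    exact dotProduct_mulVec_comm_of_eq rfl _ _
  rw [Finset.sum_congr rfl fun i _ => Finset.sum_congr rfl fun j _ => h i j]
  simp only [Finset.sum_add_distrib]
  rw [Finset.sum_comm (f := fun i j => ∫ p, φ j p.1 ⬝ᵥ
    (matDeriv (fun σ => ρ.R j i σ p.2) p.1 *ᵥ φ i p.2)
      ∂((delayMeasure τ j).prod (delayMeasure τ i)))]
  ring

omit [NeZero K] in
-- Although Ṡ_i is only square integrable, φ_i is continuous for elements of X. Hence vectors built
-- from X satisfy the domain restriction in the negativity hypothesis.
theorem memLp_matDeriv_S (hτ : ∀ i, 0 < τ i) (hρ : ρ.IsSobolev τ) {z : ZVec (Fin n) n K}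
    (hz : MemX τ z) (i : Fin K) :
    MemLp (fun s => matDeriv (ρ.S i) s *ᵥ z.2 i s) 2 (delayMeasure τ i) :=
  memLp_pi_iff.2 fun a => by
    simp only [mulVec, dotProduct, mul_comm (matDeriv _ _ _ _)]
    exact memLp_finsetSum _ fun b _ => memLp_continuousOn_mul
      (((hz i).1 b).continuousOn (neg_nonpos.2 (hτ i).le)) (hρ.2.1 i a b).2

/-- The element of the large space at which the synthesis condition is used. -/
noncomputable def synthesisVec (τ : Fin K → ℝ) (z : ZVec (Fin n) n K) (v : Fin q → ℝ)
    (w : Fin m → ℝ) : ZVec (HIdx n m q K) n K :=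
  bigVec v w z.1 (fun k => z.2 k.2 (-τ k.2) k.1) z.2

theorem memZ_synthesisVec_op (hτ : ∀ i, 0 < τ i) (hρ : ρ.IsSobolev τ)
    (hc : ρ.Compatible τ) (hζ : ∀ i a b, W12 (-τ i) 0 (fun s => ζ.Z2 i s a b)) (γ : ℝ)
    {z : ZVec (Fin n) n K} (hz : MemX τ z) (v : Fin q → ℝ) (w : Fin m → ℝ) :
    MemZ τ ((synthesisParam sys τ ρ ζ γ).op τ (synthesisVec τ z v w)) :=
  (squareIntegrable_synthesisParam sys ζ hτ hρ hc hζ γ).memZ_op hτ (hz.memZ hτ)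
    (memLp_matDeriv_S hτ hρ hz)

/-- The algebraic core: the blocks D, E_i, Ṡ_i, G_ij are those for which the form is a supply rate
plus twice the pairing of 𝐳 with the closed-loop velocity of 𝒫𝐳. The velocity of the history part is
transferred to 𝐳 by parts, which produces the boundary terms. -/
theorem innerZ_synthesisVec (hτ : ∀ i, 0 < τ i) (hρ : ρ.IsSobolev τ)
    (hc : ρ.Compatible τ) (hζ : ∀ i a b, W12 (-τ i) 0 (fun s => ζ.Z2 i s a b)) (γ : ℝ)
    {z : ZVec (Fin n) n K} (hz : MemX τ z) (v : Fin q → ℝ) (w : Fin m → ℝ) :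
    innerZ τ (synthesisVec τ z v w)
        ((synthesisParam sys τ ρ ζ γ).op τ (synthesisVec τ z v w))
      = 2 * (v ⬝ᵥ (sys.C0 *ᵥ (ρ.op τ z).1 + ∑ i, sys.C i *ᵥ (ρ.op τ z).2 i (-τ i)
          + sys.D1 *ᵥ w + sys.D2 *ᵥ ζ.op τ z)) - γ * (v ⬝ᵥ v) - γ * (w ⬝ᵥ w)
        + 2 * (tauMax τ * (z.1 ⬝ᵥ (sys.A0 *ᵥ (ρ.op τ z).1
            + ∑ i, sys.A i *ᵥ (ρ.op τ z).2 i (-τ i) + sys.B1 *ᵥ w + sys.B2 *ᵥ ζ.op τ z))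
          + ∑ i, ((ρ.op τ z).2 i 0 ⬝ᵥ z.2 i 0 - (ρ.op τ z).2 i (-τ i) ⬝ᵥ z.2 i (-τ i)
            - ∫ s, (ρ.op τ z).2 i s ⬝ᵥ vecDeriv (z.2 i) s ∂(delayMeasure τ i))) := by
  have hT : tauMax τ ≠ 0 := (hτ _).ne'
  have hzZ := hz.memZ hτ
  rw [(squareIntegrable_synthesisParam sys ζ hτ hρ hc hζ γ).innerZ_op hτ (z := synthesisVec τ z v w)
    (z' := synthesisVec τ z v w) hzZ hzZ (memLp_matDeriv_S hτ hρ hz)]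
  simp only [synthesisVec, bigVec, synthesisParam]
  rw [dotProduct_Dmat_mulVec, sum_integral_dotProduct_Emat sys ζ hτ hρ hc hζ hzZ,
    sum_integral_Gmat hρ hzZ]
  rw [Finset.sum_congr rfl fun i _ => boundary_sub_integral_op hτ hρ hc hz i]
  have hx0 : (ρ.op τ z).1 = ρ.P *ᵥ z.1 + ∑ i, ∫ s in (-τ i)..0, ρ.Q i s *ᵥ z.2 i s := rfl
  have hu : ζ.op τ z = ζ.Z0 *ᵥ z.1 + ∑ i, ζ.Z1 i *ᵥ z.2 i (-τ i)
    + ∑ i, ∫ s in (-τ i)..0, ζ.Z2 i s *ᵥ z.2 i s := rfl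
  have hxd : ∀ i, (ρ.op τ z).2 i (-τ i) = tauMax τ • ((ρ.Q i (-τ i))ᵀ *ᵥ z.1)
    + tauMax τ • (ρ.S i (-τ i) *ᵥ z.2 i (-τ i))
    + ∑ j, ∫ θ in (-τ j)..0, ρ.R i j (-τ i) θ *ᵥ z.2 j θ := fun i => rfl
  -- Both sides involve these sums of integrals only linearly; replaced by arbitrary vectors, they
  -- leave an identity between bilinear expressions.
  obtain ⟨q0, hq0⟩ : ∃ q0, q0 = ∑ i, ∫ s in (-τ i)..0, ρ.Q i s *ᵥ z.2 i s := ⟨_, rfl⟩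
  obtain ⟨q2, hq2⟩ : ∃ q2, q2 = ∑ i, ∫ s in (-τ i)..0, ζ.Z2 i s *ᵥ z.2 i s := ⟨_, rfl⟩
  obtain ⟨r, hr⟩ : ∃ r : Fin K → Fin n → ℝ, ∀ i,
      ∑ j, ∫ θ in (-τ j)..0, ρ.R i j (-τ i) θ *ᵥ z.2 j θ = r i := ⟨_, fun i => rfl⟩
  rw [hx0, hu]
  simp only [hxd, hr, ← hq0, ← hq2, L0, L1, L2, L3, add_mulVec, smul_mulVec, sum_mulVec, mulVec_add,
    mulVec_smul, mulVec_sum, dotProduct_add, dotProduct_smul, dotProduct_sum, ← mulVec_mulVec,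
    add_dotProduct, smul_dotProduct, smul_eq_mul, Finset.sum_add_distrib, ← dotProduct_mulVec,
    mul_add, Finset.sum_sub_distrib, mul_sub, ← Finset.mul_sum]
  field_simp
  ring

end Synthesis

end MultiDelay

namespace MultiDelay

/-! ### Translations -/

/-- Since X is merely continuous, the t-derivative cannot be put on it. Integration by parts with a
primitive Y of X makes the integrand differentiable in t, with derivative X. -/
theorem hasDerivAt_integral_translate_mul {X φ : ℝ → ℝ} (hX : Continuous X) {d : ℝ} (hd : 0 ≤ d)
    (hφ : W12 (-d) 0 φ) (t : ℝ) :
    HasDerivAt (fun r => ∫ s in Icc (-d) 0, X (r + s) * φ s)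
      (X t * φ 0 - X (t - d) * φ (-d) - ∫ s in Icc (-d) 0, X (t + s) * deriv φ s) t := by
  have hd0 : -d ≤ 0 := neg_nonpos.2 hd
  set Y : ℝ → ℝ := fun r => ∫ s in (0 : ℝ)..r, X s with hY
  have hYd : ∀ r, HasDerivAt Y (X r) r := fun r =>
    intervalIntegral.integral_hasDerivAt_right (hX.intervalIntegrable _ _)
      (hX.stronglyMeasurableAtFilter _ _) hX.continuousAt
  have hYc : Continuous Y := continuous_iff_continuousAt.2 fun r => (hYd r).continuousAt
  have hYr : ∀ r s, HasDerivAt (fun s => Y (r + s)) (X (r + s)) s := fun r s =>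
    HasDerivAt.comp_const_add r s (hYd (r + s))
  have hYderiv : ∀ r, deriv (fun s => Y (r + s)) = fun s => X (r + s) := fun r =>
    funext fun s => (hYr r s).deriv
  have hYac : ∀ r, AbsolutelyContinuousOnInterval (fun s => Y (r + s)) (-d) 0 := by
    intro r
    refine ContDiffOn.absolutelyContinuousOnInterval (ContDiff.contDiffOn ?_)
    rw [contDiff_one_iff_deriv, hYderiv]
    exact ⟨fun s => (hYr r s).differentiableAt, by fun_prop⟩
  have hibp : ∀ r, ∫ s in Icc (-d) 0, X (r + s) * φ s
      = Y r * φ 0 - Y (r - d) * φ (-d) - ∫ s in Icc (-d) 0, Y (r + s) * deriv φ s := by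
    intro r
    have h := (hYac r).integral_mul_deriv_eq_deriv_mul hφ.1
    rw [hYderiv, intervalIntegral_eq_setIntegral_Icc hd0, intervalIntegral_eq_setIntegral_Icc hd0,
      add_zero, ← sub_eq_add_neg] at h
    linarith
  simp only [hibp]
  have hφi : Integrable (deriv φ) (volume.restrict (Icc (-d) 0)) :=
    hφ.2.integrable (by norm_num)
  have h1 : HasDerivAt (fun r => Y (r - d)) (X (t - d)) t :=
    HasDerivAt.comp_sub_const t d (hYd (t - d))
  refine (((hYd t).mul_const _).sub (h1.mul_const _)).sub ?_
  -- This compact interval contains r + s for |r - t| < 1 and s in [-d,0], so B|φ'| dominates the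
  -- differentiated integrand.
  obtain ⟨B, hB⟩ := (isCompact_Icc (a := t - d - 1) (b := t + 1)).exists_bound_of_continuousOn
    hX.continuousOn
  have hm : ∀ Z : ℝ → ℝ, Continuous Z → ∀ r, AEStronglyMeasurable (fun s => Z (r + s) * deriv φ s)
      (volume.restrict (Icc (-d) 0)) := fun Z hZ r =>
    (hZ.comp (continuous_const.add continuous_id)).aestronglyMeasurable.mul hφi.1
  refine (hasDerivAt_integral_of_dominated_loc_of_deriv_le (μ := volume.restrict (Icc (-d) 0))
    (F := fun r s => Y (r + s) * deriv φ s) (F' := fun r s => X (r + s) * deriv φ s)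
    (bound := fun s => B * |deriv φ s|) (Ioo_mem_nhds (sub_one_lt t) (lt_add_one t))
    (Filter.Eventually.of_forall fun r => hm Y hYc r) ?_ (hm X hX t) ?_ (hφi.abs.const_mul B) ?_).2
  · obtain ⟨C, hC⟩ := (isCompact_Icc (a := t - d) (b := t)).exists_bound_of_continuousOn
      hYc.continuousOn
    refine (hφi.abs.const_mul C).mono' (hm Y hYc t) ?_
    filter_upwards [ae_restrict_mem measurableSet_Icc] with s hs
    rw [norm_mul]
    exact mul_le_mul_of_nonneg_right (hC _ ⟨by linarith [hs.1], by linarith [hs.2]⟩)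
      (abs_nonneg _)
  · filter_upwards [ae_restrict_mem measurableSet_Icc] with s hs r hr
    rw [norm_mul]
    exact mul_le_mul_of_nonneg_right (hB _ ⟨by linarith [hs.1, hr.1], by linarith [hs.2, hr.2]⟩)
      (abs_nonneg _)
  · refine Filter.Eventually.of_forall fun s r _ => ?_
    exact (HasDerivAt.comp_add_const r s (hYd (r + s))).mul_const _

/-- With G a primitive of |x'|², Cauchy–Schwarz bounds squared increments by (t - r)(G(t+s) -
G(r+s)). Integrating over the window telescopes and gives a second factor t - r: translation is
Lipschitz into L². -/
theorem exists_integral_sq_translate_sub_le {x : ℝ → ℝ} {T' : ℝ} (hT' : 0 ≤ T')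
    (hx : W12 0 T' x) {d : ℝ} (hd : 0 ≤ d) :
    ∃ M, 0 ≤ M ∧ ∀ r ∈ Icc 0 T', ∀ t ∈ Icc 0 T',
      ∫ s in Icc (-d) 0, (x (max (t + s) 0) - x (max (r + s) 0)) ^ 2 ≤ M * (t - r) ^ 2 := by
  set g : ℝ → ℝ := (Icc 0 T').indicator fun s => deriv x s ^ 2 with hg
  have hgi : Integrable g := by
    rw [hg, integrable_indicator_iff measurableSet_Icc]
    exact hx.2.integrable_sq
  have hg0 : ∀ s, 0 ≤ g s := fun s => indicator_nonneg (fun _ _ => sq_nonneg _) s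
  set G : ℝ → ℝ := fun t => ∫ s in (0 : ℝ)..t, g s with hG
  have hGc : Continuous G := intervalIntegral.continuous_primitive
    (fun _ _ => hgi.intervalIntegrable) 0
  have hGsub : ∀ a b, G b - G a = ∫ s in a..b, g s := fun a b =>
    intervalIntegral.integral_interval_sub_left hgi.intervalIntegrable hgi.intervalIntegrable
  have hGm : Monotone G := fun a b hab => by
    rw [← sub_nonneg, hGsub]
    exact intervalIntegral.integral_nonneg hab fun s _ => hg0 s
  have hxcont := hx.continuousOn hT'
  have hcs : ∀ a b, 0 ≤ a → a ≤ b → b ≤ T' → (x b - x a) ^ 2 ≤ (b - a) * (G b - G a) := by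
    intro a b ha hab hb
    have hsub : Icc a b ⊆ Icc 0 T' := Icc_subset_Icc ha hb
    have h1 : ∫ s in a..b, deriv x s = x b - x a := (hx.1.mono (by
      rwa [uIcc_of_le hab, uIcc_of_le hT'])).integral_deriv_eq_sub
    have h2 : ∫ s in Icc a b, deriv x s ^ 2 = G b - G a := by
      rw [hGsub, intervalIntegral_eq_setIntegral_Icc hab]
      exact setIntegral_congr_fun measurableSet_Icc fun s hs =>
        (indicator_of_mem (hsub hs) (fun s => deriv x s ^ 2)).symm
    have h3 := sq_integral_mul_le (hx.2.mono_measure (Measure.restrict_mono hsub le_rfl))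
      (memLp_const (1 : ℝ))
    simp only [mul_one, one_pow, setIntegral_const, Real.volume_real_Icc_of_le hab, smul_eq_mul]
      at h3
    rw [← intervalIntegral_eq_setIntegral_Icc hab, h1, h2] at h3
    linarith
  -- The constant extension to negative times preserves the estimate, because G is monotone.
  have hcs' : ∀ a b, a ≤ b → b ≤ T' →
      (x (max b 0) - x (max a 0)) ^ 2 ≤ (b - a) * (G b - G a) := by
    intro a b hab hb
    rcases le_total 0 a with ha | ha
    · rw [max_eq_left ha, max_eq_left (ha.trans hab)]
      exact hcs a b ha hab hb
    · rw [max_eq_right ha]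
      rcases le_total 0 b with hb0 | hb0
      · rw [max_eq_left hb0]
        refine (hcs 0 b le_rfl hb0 hb).trans ?_
        have := hGm ha
        have := hGm hb0
        exact mul_le_mul (by linarith) (by linarith) (by linarith) (by linarith)
      · rw [max_eq_right hb0, sub_self]
        have := mul_nonneg (sub_nonneg.2 hab) (sub_nonneg.2 (hGm hab))
        simpa using this
  refine ⟨G T' - G (-d), sub_nonneg.2 (hGm (by linarith)), ?_⟩
  have main : ∀ r ∈ Icc 0 T', ∀ t ∈ Icc 0 T', r ≤ t →
      ∫ s in Icc (-d) 0, (x (max (t + s) 0) - x (max (r + s) 0)) ^ 2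
        ≤ (G T' - G (-d)) * (t - r) ^ 2 := by
    intro r hr t ht hrt
    have hd0 : -d ≤ 0 := neg_nonpos.2 hd
    have hcx : ∀ t ∈ Icc 0 T', ContinuousOn (fun s => x (max (t + s) 0)) (Icc (-d) 0) := by
      intro t ht
      refine hxcont.comp (Continuous.continuousOn (by fun_prop)) fun s hs => ?_
      exact ⟨le_max_right _ _, max_le (by linarith [hs.2, ht.2]) hT'⟩
    have i1 : IntegrableOn (fun s => (x (max (t + s) 0) - x (max (r + s) 0)) ^ 2) (Icc (-d) 0) :=
      (((hcx t ht).sub (hcx r hr)).pow 2).integrableOn_Icc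
    have i2 : IntegrableOn (fun s => (t - r) * (G (t + s) - G (r + s))) (Icc (-d) 0) :=
      (Continuous.continuousOn (by fun_prop)).integrableOn_Icc
    refine (setIntegral_mono_on i1 i2 measurableSet_Icc fun s hs => ?_).trans ?_
    · have := hcs' (r + s) (t + s) (by linarith) (by linarith [hs.2, ht.2])
      simpa using this
    · rw [integral_const_mul, ← intervalIntegral_eq_setIntegral_Icc hd0,
        intervalIntegral.integral_sub ((by fun_prop : Continuous fun s => G (t + s)).intervalIntegrable
          _ _) ((by fun_prop : Continuous fun s => G (r + s)).intervalIntegrable _ _),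
        intervalIntegral.integral_comp_add_left, intervalIntegral.integral_comp_add_left,
        add_zero, add_zero]
      have b1 : ∫ s in r..t, G s ≤ (t - r) * G T' := by
        have := intervalIntegral.integral_mono_on hrt (hGc.intervalIntegrable (μ := volume) r t)
          (intervalIntegrable_const (c := G T')) fun s hs => hGm (hs.2.trans ht.2)
        simpa using this
      have b2 : (t - r) * G (-d) ≤ ∫ s in (r + -d)..(t + -d), G s := by
        have := intervalIntegral.integral_mono_on (by linarith : r + -d ≤ t + -d)
          (intervalIntegrable_const (c := G (-d)))
          (hGc.intervalIntegrable (μ := volume) (r + -d) (t + -d))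
          fun s hs => hGm (by linarith [hs.1, hr.1])
        simpa using this
      have e1 : (∫ s in (t + -d)..t, G s) - ∫ s in (r + -d)..r, G s
          = (∫ s in r..t, G s) - ∫ s in (r + -d)..(t + -d), G s := by
        have h1 := intervalIntegral.integral_add_adjacent_intervals
          (hGc.intervalIntegrable (μ := volume) (r + -d) r) (hGc.intervalIntegrable r t)
        have h2 := intervalIntegral.integral_add_adjacent_intervals
          (hGc.intervalIntegrable (μ := volume) (r + -d) (t + -d))
          (hGc.intervalIntegrable (t + -d) t)
        linarith
      rw [e1]
      nlinarith [mul_le_mul_of_nonneg_left (show (∫ s in r..t, G s)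
        - ∫ s in (r + -d)..(t + -d), G s ≤ (t - r) * (G T' - G (-d)) by linarith)
        (sub_nonneg.2 hrt)]
  intro r hr t ht
  rcases le_total r t with h | h
  · exact main r hr t ht h
  · have := main t ht r hr h
    rw [show (t - r) ^ 2 = (r - t) ^ 2 by ring]
    refine le_trans (le_of_eq ?_) this
    congr 1
    funext s
    ring

end MultiDelay

namespace MultiDelay

open Matrix

/-! ### Trajectories in the state space -/

section Trajectory

variable {n K : ℕ} {τ : Fin K → ℝ}

/-- The state at time `t` of the trajectory `x`, extended to negative times by `x 0`. -/
def extState (K : ℕ) (x : ℝ → Fin n → ℝ) (t : ℝ) : ZVec (Fin n) n K :=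
  (x (max t 0), fun _ s => x (max (t + s) 0))

/-- Clamping time at 0 replaces x, which is unrestricted before -τ_K, by a function continuous on
all of ℝ. Under zero history the two agree on [-τ_K, ∞). -/
theorem continuous_ext_of_absCont {x : ℝ → Fin n → ℝ}
    (hx : ∀ T > 0, ∀ a, AbsolutelyContinuousOnInterval (fun t => x t a) 0 T) :
    Continuous fun t => x (max t 0) := by
  refine continuous_pi fun a => ?_
  have hc : ContinuousOn (fun t => x t a) (Ici 0) := by
    intro t ht
    have h := (hx (t + 1) (by linarith [mem_Ici.1 ht]) a).continuousOn
    rw [uIcc_of_le (by linarith [mem_Ici.1 ht])] at h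
    refine (h t ⟨ht, by linarith⟩).mono_of_mem_nhdsWithin ?_
    exact Filter.mem_of_superset (inter_mem_nhdsWithin _ (Iio_mem_nhds (lt_add_one t)))
      fun s hs => ⟨hs.1, hs.2.le⟩
  exact hc.comp_continuous (by fun_prop) fun t => mem_Ici.2 (le_max_right _ _)

theorem memZ_extState {x : ℝ → Fin n → ℝ} (hX : Continuous fun t => x (max t 0)) (t : ℝ) :
    MemZ τ (extState K x t) :=
  memZ_iff.2 fun _ a => memLp_of_continuousOn_Icc (Continuous.continuousOn
    ((continuous_apply a).comp (hX.comp (continuous_const.add continuous_id)))) 2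

variable [NeZero K]

theorem le_tauMax (hτ : Monotone τ) (i : Fin K) : τ i ≤ tauMax τ := hτ le_top

theorem eq_ext_of_history {x : ℝ → Fin n → ℝ} (hτ : ∀ i, 0 < τ i)
    (h : ∀ s ∈ Icc (-tauMax τ) 0, x s = 0) {t : ℝ} (ht : -tauMax τ ≤ t) : x t = x (max t 0) := by
  rcases le_total t 0 with h0 | h0
  · rw [max_eq_right h0, h t ⟨ht, h0⟩, h 0 ⟨neg_nonpos.2 (hτ _).le, le_rfl⟩]
  · rw [max_eq_left h0]

theorem eqZ_stateAt_extState {x : ℝ → Fin n → ℝ} (hτ : ∀ i, 0 < τ i) (hm : Monotone τ)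
    (h : ∀ s ∈ Icc (-tauMax τ) 0, x s = 0) {t : ℝ} (ht : 0 ≤ t) :
    EqZ τ (stateAt K x t) (extState K x t) := by
  refine ⟨eq_ext_of_history hτ h (by linarith [hτ ⊤, show tauMax τ = τ ⊤ from rfl]), fun i => ?_⟩
  filter_upwards [ae_restrict_mem measurableSet_Icc] with s hs
  exact eq_ext_of_history hτ h (by linarith [hs.1, le_tauMax hm i])

/-- The trajectory in the Hilbert space model. -/
noncomputable def hilbertState (τ : Fin K → ℝ) {x : ℝ → Fin n → ℝ}
    (hX : Continuous fun t => x (max t 0)) (t : ℝ) : ZHilbert n τ :=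
  toHilbert (extState K x t) (memZ_extState hX t)

theorem norm_sq_hilbertState_sub (hτ : ∀ i, 0 < τ i) {x : ℝ → Fin n → ℝ}
    (hX : Continuous fun t => x (max t 0)) (t r : ℝ) :
    ‖hilbertState τ hX t - hilbertState τ hX r‖ ^ 2
      = tauMax τ * ∑ a, (x (max t 0) a - x (max r 0) a) ^ 2
        + ∑ i, ∫ s in (-τ i)..0, ∑ a, (x (max (t + s) 0) a - x (max (r + s) 0) a) ^ 2 := by
  rw [hilbertState, hilbertState, toHilbert_sub, norm_sq_toHilbert hτ, normSqZ, innerZ]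
  simp only [extState, dotProduct, Prod.fst_sub, Prod.snd_sub, Pi.sub_apply, sq]

theorem continuous_hilbertState (hτ : ∀ i, 0 < τ i) {x : ℝ → Fin n → ℝ}
    (hX : Continuous fun t => x (max t 0)) : Continuous (hilbertState τ hX) := by
  have hXa : ∀ a, Continuous fun t => x (max t 0) a := fun a => (continuous_apply a).comp hX
  refine continuous_iff_continuousAt.2 fun r => ?_
  rw [ContinuousAt, tendsto_iff_norm_sub_tendsto_zero]
  have h : (fun t => ‖hilbertState τ hX t - hilbertState τ hX r‖)
      = fun t => √(tauMax τ * ∑ a, (x (max t 0) a - x (max r 0) a) ^ 2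
        + ∑ i, ∫ s in (-τ i)..0, ∑ a, (x (max (t + s) 0) a - x (max (r + s) 0) a) ^ 2) := by
    funext t
    rw [← norm_sq_hilbertState_sub hτ hX, Real.sqrt_sq (norm_nonneg _)]
  have hc : Continuous fun t => √(tauMax τ * ∑ a, (x (max t 0) a - x (max r 0) a) ^ 2
        + ∑ i, ∫ s in (-τ i)..0, ∑ a, (x (max (t + s) 0) a - x (max (r + s) 0) a) ^ 2) := by
    refine Real.continuous_sqrt.comp (Continuous.add (continuous_const.mul
      (continuous_finsetSum _ fun a _ => ((hXa a).sub continuous_const).pow 2))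
      (continuous_finsetSum _ fun i _ => ?_))
    refine intervalIntegral.continuous_parametric_intervalIntegral_of_continuous' ?_ _ _
    refine continuous_finsetSum _ fun a _ => Continuous.pow (Continuous.sub ?_ ?_) 2
    · exact (hXa a).comp (continuous_fst.add continuous_snd)
    · exact (hXa a).comp (continuous_const.add continuous_snd)
  rw [h]
  have := hc.tendsto r
  simpa using this

theorem exists_norm_sq_hilbertState_sub_le (hτ : ∀ i, 0 < τ i) {x : ℝ → Fin n → ℝ}
    (hX : Continuous fun t => x (max t 0)) {T' : ℝ} (hT' : 0 ≤ T')
    (hx : ∀ a, W12 0 T' (fun t => x t a)) :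
    ∃ C, 0 ≤ C ∧ ∀ r ∈ Icc 0 T', ∀ t ∈ Icc 0 T',
      ‖hilbertState τ hX t - hilbertState τ hX r‖ ^ 2
        ≤ C * (∑ a, (x t a - x r a) ^ 2 + (t - r) ^ 2) := by
  have hXa : ∀ a, Continuous fun t => x (max t 0) a := fun a => (continuous_apply a).comp hX
  choose M hM0 hM using fun (i : Fin K) (a : Fin n) =>
    exists_integral_sq_translate_sub_le hT' (hx a) (hτ i).le
  have hT : 0 ≤ tauMax τ := (hτ _).le
  have hMs : 0 ≤ ∑ i, ∑ a, M i a := Finset.sum_nonneg fun i _ => Finset.sum_nonneg fun a _ => hM0 i a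
  refine ⟨tauMax τ + ∑ i, ∑ a, M i a, by positivity, fun r hr t ht => ?_⟩
  rw [norm_sq_hilbertState_sub hτ, max_eq_left hr.1, max_eq_left ht.1]
  have h : ∀ i, ∫ s in (-τ i)..0, ∑ a, (x (max (t + s) 0) a - x (max (r + s) 0) a) ^ 2
      ≤ (∑ a, M i a) * (t - r) ^ 2 := by
    intro i
    rw [intervalIntegral_eq_setIntegral_Icc (neg_nonpos.2 (hτ i).le), integral_finsetSum,
      Finset.sum_mul]
    · exact Finset.sum_le_sum fun a _ => hM i a r hr t ht
    · intro a _
      refine (Continuous.continuousOn (Continuous.pow (Continuous.sub ?_ ?_) 2)).integrableOn_Icc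
      · exact (hXa a).comp (continuous_const.add continuous_id)
      · exact (hXa a).comp (continuous_const.add continuous_id)
  have h1 := Finset.sum_le_sum fun i (_ : i ∈ Finset.univ) => h i
  rw [← Finset.sum_mul] at h1
  have h2 : 0 ≤ ∑ a, (x t a - x r a) ^ 2 := Finset.sum_nonneg fun a _ => sq_nonneg _
  nlinarith [mul_nonneg hMs h2, mul_nonneg hT (sq_nonneg (t - r))]

/-- The test element is fixed in X, so the derivative of the history falls on 𝐳 and the trajectory
needs differentiability only at the single time t. -/
theorem hasDerivAt_innerZ_extState (hτ : ∀ i, 0 < τ i) {x : ℝ → Fin n → ℝ}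
    (hX : Continuous fun t => x (max t 0)) {z : ZVec (Fin n) n K} (hz : MemX τ z) {t : ℝ}
    {x' : Fin n → ℝ} (hx : HasDerivAt (fun t => x (max t 0)) x' t) :
    HasDerivAt (fun r => innerZ τ (extState K x r) z)
      (tauMax τ * (z.1 ⬝ᵥ x') + ∑ i, (x (max t 0) ⬝ᵥ z.2 i 0
        - x (max (t - τ i) 0) ⬝ᵥ z.2 i (-τ i)
        - ∫ s, x (max (t + s) 0) ⬝ᵥ vecDeriv (z.2 i) s ∂(delayMeasure τ i))) t := by
  have hXa : ∀ a, Continuous fun t => x (max t 0) a := fun a => (continuous_apply a).comp hX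
  have hXs : ∀ a r i, MemLp (fun s => x (max (r + s) 0) a) 2 (delayMeasure τ i) := fun a r i =>
    memLp_of_continuousOn_Icc (Continuous.continuousOn
      ((hXa a).comp (continuous_const.add continuous_id))) 2
  have hzZ := hz.memZ hτ
  have h1 : HasDerivAt (fun r => x (max r 0) ⬝ᵥ z.1) (z.1 ⬝ᵥ x') t := by
    simp only [dotProduct, mul_comm (z.1 _)]
    exact HasDerivAt.fun_sum fun a _ => (hasDerivAt_pi.1 hx a).mul_const _
  have h2 : ∀ i, HasDerivAt (fun r => ∫ s in (-τ i)..0, x (max (r + s) 0) ⬝ᵥ z.2 i s)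
      (x (max t 0) ⬝ᵥ z.2 i 0 - x (max (t - τ i) 0) ⬝ᵥ z.2 i (-τ i)
        - ∫ s, x (max (t + s) 0) ⬝ᵥ vecDeriv (z.2 i) s ∂(delayMeasure τ i)) t := by
    intro i
    have e1 : (fun r => ∫ s in (-τ i)..0, x (max (r + s) 0) ⬝ᵥ z.2 i s)
        = fun r => ∑ a, ∫ s in Icc (-τ i) 0, x (max (r + s) 0) a * z.2 i s a := by
      funext r
      rw [intervalIntegral_eq_setIntegral_Icc (neg_nonpos.2 (hτ i).le)]
      simp only [dotProduct]
      exact integral_finsetSum _ fun a _ =>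
        MemLp.integrable_mul_two (hXs a r i) (hzZ.eval i a)
    have e2 : ∫ s, x (max (t + s) 0) ⬝ᵥ vecDeriv (z.2 i) s ∂(delayMeasure τ i)
        = ∑ a, ∫ s in Icc (-τ i) 0, x (max (t + s) 0) a * deriv (fun s => z.2 i s a) s := by
      simp only [dotProduct, vecDeriv]
      exact integral_finsetSum _ fun a _ =>
        MemLp.integrable_mul_two (hXs a t i) ((hz i).1 a).2
    rw [e1, e2]
    simp only [dotProduct]
    rw [← Finset.sum_sub_distrib, ← Finset.sum_sub_distrib]
    exact HasDerivAt.fun_sum fun a _ =>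
      hasDerivAt_integral_translate_mul (hXa a) (hτ i).le ((hz i).1 a) t
  exact (h1.const_mul _).add (HasDerivAt.fun_sum fun i _ => h2 i)

/-! ### Continuity of the control -/

theorem continuousOn_const_mulVec {ι κ : Type*} [Fintype ι] (M : Matrix κ ι ℝ) {f : ℝ → ι → ℝ}
    {U : Set ℝ} (hf : ContinuousOn f U) : ContinuousOn (fun t => M *ᵥ f t) U :=
  (Continuous.matrix_mulVec continuous_const continuous_id).comp_continuousOn hf

section Functionals

variable {z : ℝ → ZVec (Fin n) n K} {U : Set ℝ}
  (hz : ∀ ℓ : ZVec (Fin n) n K, MemZ τ ℓ → ContinuousOn (fun t => innerZ τ ℓ (z t)) U)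

include hz in
theorem continuousOn_fst_of_innerZ (hτ : ∀ i, 0 < τ i) : ContinuousOn (fun t => (z t).1) U := by
  have hT : tauMax τ ≠ 0 := (hτ _).ne'
  refine continuousOn_pi.2 fun a => ?_
  refine (hz (Pi.single a (tauMax τ)⁻¹, 0) fun i => MemLp.zero).congr fun t _ => ?_
  simp [innerZ, hT]

include hz in
-- Each component of the integral is the inner product with a fixed element of Z supported in the
-- i-th slot.
theorem continuousOn_integral_mulVec_of_innerZ {κ : Type*} [Fintype κ] (hτ : ∀ i, 0 < τ i)
    (hZ : ∀ t ∈ U, MemZ τ (z t)) (i : Fin K) {M : ℝ → Matrix κ (Fin n) ℝ}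
    (hM : ∀ a b, MemLp (fun s => M s a b) 2 (delayMeasure τ i)) :
    ContinuousOn (fun t => ∫ s in (-τ i)..0, M s *ᵥ (z t).2 i s) U := by
  refine continuousOn_pi.2 fun a => ?_
  have hℓ : MemZ τ ((0, Pi.single i fun s => M s a) : ZVec (Fin n) n K) := by
    intro j
    by_cases hj : j = i
    · subst hj
      simp only [Pi.single_eq_same]
      exact memLp_pi_iff.2 (hM a)
    · simp only [Pi.single_eq_of_ne hj]
      exact MemLp.zero
  refine (hz _ hℓ).congr fun t ht => ?_
  beta_reduce
  rw [innerZ, Fintype.sum_eq_single i fun j hj => by simp [hj],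
    intervalIntegral_eq_setIntegral_Icc (neg_nonpos.2 (hτ i).le),
    intervalIntegral_eq_setIntegral_Icc (neg_nonpos.2 (hτ i).le),
    eval_integral fun b => (integrable_mulVec hM (hZ t ht i)).eval b]
  simp [mulVec]

end Functionals

end Trajectory

end MultiDelay

namespace MultiDelay

open Matrix

/-! ### The closed loop -/

section ClosedLoop

variable {n m p q K : ℕ} [NeZero K] {τ : Fin K → ℝ} {ρ : PQRS (Fin n) n K} {ζ : ZParam p n K}
  {x : ℝ → Fin n → ℝ}

/-- For 𝐳 in X both sides are continuous in s, so almost everywhere equality holds at every point,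
in particular at -τ_i and 0. -/
theorem op_snd_eq_ext (hτ : ∀ i, 0 < τ i) (hρ : ρ.IsSobolev τ) (hc : ρ.Compatible τ)
    (hX : Continuous fun t => x (max t 0)) {z : ZVec (Fin n) n K} (hz : MemX τ z) {t : ℝ}
    (h : EqZ τ (ρ.op τ z) (extState K x t)) (i : Fin K) {s : ℝ} (hs : s ∈ Icc (-τ i) 0) :
    (ρ.op τ z).2 i s = x (max (t + s) 0) := by
  have h0 := neg_nonpos.2 (hτ i).le
  refine Measure.eqOn_Icc_of_ae_eq volume (neg_lt_zero.2 (hτ i)).ne (h.2 i) ?_ ?_ hs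
  · refine continuousOn_pi.2 fun a => ?_
    have : W12 (-τ i) 0 (fun s => ρ.integralPart τ z i s a
        + tauMax τ * ∑ b, ρ.S i s a b * z.2 i s b) :=
      W12.add h0 (w12_integralPart hτ hρ hc (hz.memZ hτ) i a)
        (W12.const_mul h0 _ (W12.sum _ h0 fun b _ => W12.mul h0 (hρ.2.1 i a b) ((hz i).1 b)))
    refine (this.continuousOn h0).congr fun s _ => ?_
    rw [PQRS.op_snd]
    rfl
  · exact (hX.comp (continuous_const.add continuous_id)).continuousOn

/-- Weak continuity of 𝐳(t) takes care of z and of the integrals, but evaluation at -τ_i is not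
continuous on L². The equation 𝒫𝐳 = 𝐱 at s = -τ_i expresses φ_i(-τ_i) through x(t - τ_i) and
integrals, as S_i(-τ_i) is invertible. -/
theorem continuousOn_feedback (hτ : ∀ i, 0 < τ i) {ε : ℝ} (hε : 0 < ε) (hρ : ρ.IsSobolev τ)
    (hc : ρ.Compatible τ)
    (hco : ∀ z : ZVec (Fin n) n K, MemZ τ z → ε * normSqZ τ z ≤ innerZ τ z (ρ.op τ z))
    (hζ : ∀ i a b, W12 (-τ i) 0 (fun s => ζ.Z2 i s a b))
    (hX : Continuous fun t => x (max t 0)) {z : ℝ → ZVec (Fin n) n K} {U : Set ℝ}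
    (hz : ∀ t ∈ U, MemX τ (z t)) (hzx : ∀ t ∈ U, EqZ τ (ρ.op τ (z t)) (extState K x t))
    (hzc : ∀ ℓ : ZVec (Fin n) n K, MemZ τ ℓ → ContinuousOn (fun t => innerZ τ ℓ (z t)) U) :
    ContinuousOn (fun t => ζ.op τ (z t)) U := by
  have hZ : ∀ t ∈ U, MemZ τ (z t) := fun t ht => (hz t ht).memZ hτ
  have h1 := continuousOn_fst_of_innerZ hzc hτ
  have hp : ∀ i, ContinuousOn (fun t => (z t).2 i (-τ i)) U := by
    intro i
    have hi : -τ i ∈ Icc (-τ i) 0 := ⟨le_rfl, neg_nonpos.2 (hτ i).le⟩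
    have hI : ContinuousOn (fun t => ρ.integralPart τ (z t) i (-τ i)) U :=
      ((continuousOn_const_mulVec _ h1).const_smul (tauMax τ)).add
        (continuousOn_finsetSum _ fun j _ => continuousOn_integral_mulVec_of_innerZ hzc hτ hZ j
          (hc.memLp_R_slice hτ hρ i j hi))
    have hunit : IsUnit (tauMax τ • ρ.S i (-τ i)).det :=
      (isUnit_iff_isUnit_det _).1 <| mulVec_injective_iff_isUnit.1 fun v w h =>
        eq_of_coercive hε (fun v => by
          rw [smul_mulVec, dotProduct_smul, smul_eq_mul]
          exact le_dotProduct_S hτ hρ hco i v hi) h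
    have hXc : ContinuousOn (fun t => x (max (t + -τ i) 0)) U :=
      (hX.comp (continuous_id.add continuous_const)).continuousOn
    refine (continuousOn_const_mulVec (tauMax τ • ρ.S i (-τ i))⁻¹ (hXc.sub hI)).congr
      fun t ht => ?_
    have e : x (max (t + -τ i) 0) - ρ.integralPart τ (z t) i (-τ i)
        = (tauMax τ • ρ.S i (-τ i)) *ᵥ (z t).2 i (-τ i) := by
      rw [← op_snd_eq_ext hτ hρ hc hX (hz t ht) (hzx t ht) i hi, PQRS.op_snd, smul_mulVec]
      abel
    simp only [Pi.sub_apply]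
    rw [e, mulVec_mulVec, nonsing_inv_mul _ hunit, one_mulVec]
  exact ((continuousOn_const_mulVec _ h1).add (continuousOn_finsetSum _ fun i _ =>
    continuousOn_const_mulVec _ (hp i))).add (continuousOn_finsetSum _ fun i _ =>
      continuousOn_integral_mulVec_of_innerZ hzc hτ hZ i fun a b =>
        (hζ i a b).memLp (neg_nonpos.2 (hτ i).le))

omit [NeZero K] in
theorem MemL2.eval {r : ℕ} {f : ℝ → Fin r → ℝ} (hf : MemL2 f) (a : Fin r) :
    MemLp (fun t => f t a) 2 (volume.restrict (Ici (0 : ℝ))) :=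
  hf.eval_piLp a

theorem hasDerivAt_zero_of_abs_le {e b : ℝ → ℝ} {t c : ℝ} (hb : HasDerivAt b 0 t) (hbt : b t = 0)
    (h : ∀ᶠ r in nhds t, |e r| ≤ c * b r) : HasDerivAt e 0 t := by
  have het : e t = 0 := by
    have := h.self_of_nhds
    rw [hbt, mul_zero] at this
    exact abs_nonpos_iff.1 this
  rw [hasDerivAt_iff_isLittleO] at hb ⊢
  simp only [hbt, het, sub_zero, smul_zero] at hb ⊢
  refine (Asymptotics.IsBigO.of_bound |c| ?_).trans_isLittleO hb
  filter_upwards [h] with r hr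
  rw [Real.norm_eq_abs, Real.norm_eq_abs, ← abs_mul]
  exact hr.trans (le_abs_self _)

/-- The storage function `⟨𝐱, P⁻¹ 𝐱⟩` along a trajectory. -/
noncomputable def storage {hX : Continuous fun t => x (max t 0)}
    (Q : ZHilbert n τ →L[ℝ] ZHilbert n τ) (t : ℝ) : ℝ :=
  inner ℝ (hilbertState τ hX t) (Q (hilbertState τ hX t))

/-- Symmetry of Q factors the increment as ⟨σ - σ', Q(σ + σ')⟩. The second factor is bounded, and
the first is controlled by increments of t and of x. -/
theorem absCont_storage (hτ : ∀ i, 0 < τ i) {hX : Continuous fun t => x (max t 0)}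
    {Q : ZHilbert n τ →L[ℝ] ZHilbert n τ} (hQ : ∀ h h', inner ℝ (Q h) h' = inner ℝ h (Q h'))
    {T' : ℝ} (hT' : 0 ≤ T') (hx : ∀ a, W12 0 T' (fun t => x t a)) :
    AbsolutelyContinuousOnInterval (storage (hX := hX) Q) 0 T' := by
  obtain ⟨C, hC0, hC⟩ := exists_norm_sq_hilbertState_sub_le hτ hX hT' hx
  obtain ⟨B, hB⟩ := (isCompact_Icc (a := (0 : ℝ)) (b := T')).exists_bound_of_continuousOn
    (continuous_hilbertState hτ hX).continuousOn
  have hB0 : 0 ≤ B := (norm_nonneg _).trans (hB 0 ⟨le_rfl, hT'⟩)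
  have hid : AbsolutelyContinuousOnInterval (fun t : ℝ => t) 0 T' :=
    ContDiffOn.absolutelyContinuousOnInterval contDiff_id.contDiffOn
  refine absolutelyContinuousOnInterval_of_abs_sub_le (Finset.univ : Finset (Option (Fin n)))
    (g := fun k => k.elim (fun t => t) fun a t => x t a) (C := √C * (‖Q‖ * (B + B))) ?_ ?_
  · rintro (_ | a) -
    · exact hid
    · exact (hx a).1
  · rw [uIcc_of_le hT']
    intro t ht r hr
    set σ := hilbertState τ hX t
    set σ' := hilbertState τ hX r
    have e : storage (hX := hX) Q t - storage (hX := hX) Q r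
        = inner ℝ (σ - σ') (Q (σ + σ')) := by
      simp only [storage, map_add, inner_sub_left, inner_add_right]
      have h1 : inner ℝ σ' (Q σ) = inner ℝ σ (Q σ') := by rw [← hQ, real_inner_comm]
      linarith
    rw [e, Fintype.sum_option]
    simp only [Option.elim]
    set d := |t - r| + ∑ a, |x t a - x r a| with hd
    have hd0 : 0 ≤ ∑ a, |x t a - x r a| := Finset.sum_nonneg fun _ _ => abs_nonneg _
    have hsq : ∑ a, (x t a - x r a) ^ 2 ≤ (∑ a, |x t a - x r a|) ^ 2 := by
      rw [sq (∑ a, _), Finset.sum_mul]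
      refine Finset.sum_le_sum fun a ha => ?_
      rw [← sq_abs, sq]
      exact mul_le_mul_of_nonneg_left (Finset.single_le_sum (f := fun a => |x t a - x r a|)
        (fun _ _ => abs_nonneg _) ha) (abs_nonneg _)
    have hn : ‖σ - σ'‖ ≤ √C * d := by
      refine le_of_sq_le_sq ?_ (by positivity)
      rw [mul_pow, Real.sq_sqrt hC0]
      refine (hC r hr t ht).trans (mul_le_mul_of_nonneg_left ?_ hC0)
      rw [hd, ← sq_abs (t - r)]
      nlinarith [mul_nonneg (abs_nonneg (t - r)) hd0]
    have hs : ‖Q (σ + σ')‖ ≤ ‖Q‖ * (B + B) :=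
      (Q.le_opNorm _).trans (mul_le_mul_of_nonneg_left ((norm_add_le _ _).trans
        (add_le_add (hB t ht) (hB r hr))) (norm_nonneg _))
    refine (abs_real_inner_le_norm _ _).trans ((mul_le_mul hn hs (norm_nonneg _)
      (by positivity)).trans (le_of_eq ?_))
    ring

/-- Expanding around t, V(r) = 2⟨σ(r), Qσ(t)⟩ - V(t) + ⟨σ(r) - σ(t), Q(σ(r) - σ(t))⟩. The first term
pairs the state with a fixed element of X. The last is O(|x(r) - x(t)|² + (r - t)²), so its
derivative at t vanishes, and σ itself need not be differentiable. -/
theorem hasDerivAt_storage (hτ : ∀ i, 0 < τ i) {hX : Continuous fun t => x (max t 0)}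
    {Q : ZHilbert n τ →L[ℝ] ZHilbert n τ} (hQ : ∀ h h', inner ℝ (Q h) h' = inner ℝ h (Q h'))
    {t : ℝ} (ht : 0 < t) (hx : ∀ a, W12 0 (t + 1) (fun t => x t a)) {x' : Fin n → ℝ}
    (hx' : HasDerivAt x x' t) {z : ZVec (Fin n) n K} (hz : MemX τ z)
    (hQz : Q (hilbertState τ hX t) = toHilbert z (hz.memZ hτ)) :
    HasDerivAt (storage (hX := hX) Q) (2 * (tauMax τ * (z.1 ⬝ᵥ x') + ∑ i, (x (max t 0) ⬝ᵥ z.2 i 0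
        - x (max (t - τ i) 0) ⬝ᵥ z.2 i (-τ i)
        - ∫ s, x (max (t + s) 0) ⬝ᵥ vecDeriv (z.2 i) s ∂(delayMeasure τ i)))) t := by
  obtain ⟨C, hC0, hC⟩ := exists_norm_sq_hilbertState_sub_le hτ hX (by linarith) hx
  have hext : HasDerivAt (fun r => x (max r 0)) x' t := by
    refine hx'.congr_of_eventuallyEq ?_
    filter_upwards [lt_mem_nhds ht] with r hr
    rw [max_eq_left hr.le]
  have h1 := hasDerivAt_innerZ_extState hτ hX hz hext
  set σ := hilbertState τ hX with hσ
  have e : storage (hX := hX) Q = fun r => (2 * innerZ τ (extState K x r) z - inner ℝ (σ t) (Q (σ t)))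
      + inner ℝ (σ r - σ t) (Q (σ r - σ t)) := by
    funext r
    have h2 : innerZ τ (extState K x r) z = inner ℝ (σ r) (Q (σ t)) := by
      rw [hQz, hσ, hilbertState, inner_toHilbert hτ]
    have h3 : inner ℝ (σ t) (Q (σ r)) = inner ℝ (σ r) (Q (σ t)) := by
      rw [← hQ, real_inner_comm]
    rw [h2]
    simp only [storage, map_sub, inner_sub_left, inner_sub_right]
    rw [h3]
    ring
  rw [e]
  have hb : HasDerivAt (fun r => ∑ a, (x r a - x t a) ^ 2 + (r - t) ^ 2) 0 t := by
    have h1 : ∀ a, HasDerivAt (fun r => (x r a - x t a) ^ 2) 0 t := by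
      intro a
      have := ((hasDerivAt_pi.1 hx' a).sub_const (x t a)).fun_pow 2
      simpa using this
    have h2 : HasDerivAt (fun r : ℝ => (r - t) ^ 2) 0 t := by
      have := ((hasDerivAt_id t).sub_const t).fun_pow 2
      simpa using this
    have := (HasDerivAt.fun_sum fun a (_ : a ∈ Finset.univ) => h1 a).fun_add h2
    simpa using this
  have hrem : HasDerivAt (fun r => inner ℝ (σ r - σ t) (Q (σ r - σ t))) 0 t := by
    refine hasDerivAt_zero_of_abs_le (c := ‖Q‖ * C) hb (by simp) ?_
    filter_upwards [Icc_mem_nhds ht (lt_add_one t)] with r hr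
    have h2 := hC t ⟨ht.le, by linarith⟩ r hr
    calc |inner ℝ (σ r - σ t) (Q (σ r - σ t))| ≤ ‖σ r - σ t‖ * ‖Q (σ r - σ t)‖ :=
          abs_real_inner_le_norm _ _
      _ ≤ ‖σ r - σ t‖ * (‖Q‖ * ‖σ r - σ t‖) :=
          mul_le_mul_of_nonneg_left (Q.le_opNorm _) (norm_nonneg _)
      _ = ‖Q‖ * ‖σ r - σ t‖ ^ 2 := by ring
      _ ≤ ‖Q‖ * (C * (∑ a, (x r a - x t a) ^ 2 + (r - t) ^ 2)) :=
          mul_le_mul_of_nonneg_left h2 (norm_nonneg _)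
      _ = _ := by ring
  simpa only [add_zero] using
    ((h1.const_mul 2).sub_const (inner ℝ (σ t) (Q (σ t)))).fun_add hrem

end ClosedLoop

end MultiDelay

namespace MultiDelay

open Matrix

/-! ### Signals in `L²` -/

theorem norm_sq_toLp {r : ℕ} (v : Fin r → ℝ) : ‖WithLp.toLp 2 v‖ ^ 2 = v ⬝ᵥ v := by
  rw [EuclideanSpace.real_norm_sq_eq]
  simp only [dotProduct, sq]

theorem l2Norm_eq {r : ℕ} {f : ℝ → Fin r → ℝ} (hf : MemL2 f) :
    l2Norm f = ENNReal.ofReal √(∫ t in Ici (0 : ℝ), f t ⬝ᵥ f t) := by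
  rw [l2Norm, MemLp.eLpNorm_eq_integral_rpow_norm (by norm_num) (by norm_num) hf,
    Real.sqrt_eq_rpow]
  simp [← norm_sq_toLp]

theorem memL2_iff_integrable {r : ℕ} {f : ℝ → Fin r → ℝ}
    (hf : AEStronglyMeasurable (fun t => WithLp.toLp 2 (f t)) (volume.restrict (Ici (0 : ℝ)))) :
    MemL2 f ↔ IntegrableOn (fun t => f t ⬝ᵥ f t) (Ici 0) := by
  rw [MemL2, memLp_two_iff_integrable_sq_norm hf]
  simp only [norm_sq_toLp, IntegrableOn]

theorem memL2_of_intervalIntegral_le {r : ℕ} {f : ℝ → Fin r → ℝ} {I : ℝ}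
    (hm : ∀ T', 0 ≤ T' → ∀ a, MemLp (fun t => f t a) 2 (volume.restrict (Icc 0 T')))
    (h : ∀ T', 0 ≤ T' → ∫ t in 0..T', f t ⬝ᵥ f t ≤ I) :
    MemL2 f ∧ ∫ t in Ici (0 : ℝ), f t ⬝ᵥ f t ≤ I := by
  have hmeas : AEStronglyMeasurable (fun t => WithLp.toLp 2 (f t))
      (volume.restrict (Ici (0 : ℝ))) := by
    have hU : ⋃ k : ℕ, Icc (0 : ℝ) k = Ici 0 := by
      ext t
      simp only [mem_iUnion, mem_Icc, mem_Ici, exists_and_left]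
      exact and_iff_left (exists_nat_ge t)
    rw [← hU, aestronglyMeasurable_iUnion_iff]
    intro k
    exact (MemLp.of_eval_piLp (f := fun t => WithLp.toLp 2 (f t)) (p := 2)
      fun a => hm k k.cast_nonneg a).aestronglyMeasurable
  have hi : ∀ k : ℕ, IntegrableOn (fun t => f t ⬝ᵥ f t) (Ioc 0 (k : ℝ)) := fun k =>
    IntegrableOn.mono_set (integrable_finsetSum _ fun a _ =>
      MemLp.integrable_mul_two (hm k k.cast_nonneg a) (hm k k.cast_nonneg a)) Ioc_subset_Icc_self
  have hint : IntegrableOn (fun t => f t ⬝ᵥ f t) (Ioi 0) := by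
    refine integrableOn_Ioi_of_intervalIntegral_norm_bounded I 0 hi tendsto_natCast_atTop_atTop
      (Filter.Eventually.of_forall fun k => ?_)
    have h0 : ∀ t, ‖f t ⬝ᵥ f t‖ = f t ⬝ᵥ f t := fun t =>
      Real.norm_of_nonneg (Finset.sum_nonneg fun _ _ => mul_self_nonneg _)
    simp only [h0]
    exact h k k.cast_nonneg
  rw [memL2_iff_integrable hmeas, integrableOn_Ici_iff_integrableOn_Ioi,
    integral_Ici_eq_integral_Ioi]
  exact ⟨hint, le_of_tendsto' (intervalIntegral_tendsto_integral_Ioi 0 hint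
    tendsto_natCast_atTop_atTop) fun k => h k k.cast_nonneg⟩

theorem memLp_continuousOn_add_mulVec {r m : ℕ} {T' : ℝ} {g : ℝ → Fin r → ℝ}
    (hg : ContinuousOn g (Ici 0)) (M : Matrix (Fin r) (Fin m) ℝ) {w : ℝ → Fin m → ℝ}
    (hw : MemL2 w) (a : Fin r) :
    MemLp (fun t => (g t + M *ᵥ w t) a) 2 (volume.restrict (Icc 0 T')) := by
  refine MemLp.add (memLp_of_continuousOn_Icc
    ((continuousOn_pi.1 hg a).mono Icc_subset_Ici_self) 2) ?_
  exact memLp_finsetSum Finset.univ fun b _ =>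
    ((hw.eval b).mono_measure (Measure.restrict_mono_set _ Icc_subset_Ici_self)).const_mul (M a b)

/-! ### The dissipation inequality -/

section Dissipation

variable {n m p q K : ℕ} [NeZero K] (sys : System n m p q K) {τ : Fin K → ℝ}
  {ρ : PQRS (Fin n) n K} {ζ : ZParam p n K} {x : ℝ → Fin n → ℝ} {γ : ℝ}

/-- The right-hand side of the state equation in closed loop, without the disturbance. -/
noncomputable def drift (τ : Fin K → ℝ) (x : ℝ → Fin n → ℝ) (u : ℝ → Fin p → ℝ) (t : ℝ) :
    Fin n → ℝ :=
  sys.A0 *ᵥ x (max t 0) + ∑ i, sys.A i *ᵥ x (max (t - τ i) 0) + sys.B2 *ᵥ u t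

/-- The output in closed loop, without the disturbance. -/
noncomputable def readout (τ : Fin K → ℝ) (x : ℝ → Fin n → ℝ) (u : ℝ → Fin p → ℝ) (t : ℝ) :
    Fin q → ℝ :=
  sys.C0 *ᵥ x (max t 0) + ∑ i, sys.C i *ᵥ x (max (t - τ i) 0) + sys.D2 *ᵥ u t

omit [NeZero K] in
theorem continuousOn_drift (hX : Continuous fun t => x (max t 0)) {u : ℝ → Fin p → ℝ}
    (hu : ContinuousOn u (Ici 0)) : ContinuousOn (drift sys τ x u) (Ici 0) :=
  ((continuousOn_const_mulVec _ hX.continuousOn).add (continuousOn_finsetSum _ fun _ _ =>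
    continuousOn_const_mulVec _ (hX.comp (continuous_id.sub continuous_const)).continuousOn)).add
    (continuousOn_const_mulVec _ hu)

omit [NeZero K] in
theorem continuousOn_readout (hX : Continuous fun t => x (max t 0)) {u : ℝ → Fin p → ℝ}
    (hu : ContinuousOn u (Ici 0)) : ContinuousOn (readout sys τ x u) (Ici 0) :=
  ((continuousOn_const_mulVec _ hX.continuousOn).add (continuousOn_finsetSum _ fun _ _ =>
    continuousOn_const_mulVec _ (hX.comp (continuous_id.sub continuous_const)).continuousOn)).add
    (continuousOn_const_mulVec _ hu)

/-- The left side is V̇ for the closed loop; after 𝒫𝐳 is identified with the state, this is the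
nonpositivity of the form of `innerZ_synthesisVec`. -/
theorem dissipation_inequality (hτ : ∀ i, 0 < τ i) (hρ : ρ.IsSobolev τ) (hc : ρ.Compatible τ)
    (hζ : ∀ i a b, W12 (-τ i) 0 (fun s => ζ.Z2 i s a b))
    (hX : Continuous fun t => x (max t 0)) {z : ZVec (Fin n) n K} (hz : MemX τ z) {t : ℝ}
    (h : EqZ τ (ρ.op τ z) (extState K x t)) {u : ℝ → Fin p → ℝ} (hu : u t = ζ.op τ z)
    (v : Fin q → ℝ) (w : Fin m → ℝ)
    (hneg : innerZ τ (synthesisVec τ z v w)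
      ((synthesisParam sys τ ρ ζ γ).op τ (synthesisVec τ z v w)) ≤ 0) :
    2 * (tauMax τ * (z.1 ⬝ᵥ (drift sys τ x u t + sys.B1 *ᵥ w)) + ∑ i, (x (max t 0) ⬝ᵥ z.2 i 0
        - x (max (t - τ i) 0) ⬝ᵥ z.2 i (-τ i)
        - ∫ s, x (max (t + s) 0) ⬝ᵥ vecDeriv (z.2 i) s ∂(delayMeasure τ i)))
      ≤ γ * (v ⬝ᵥ v) + γ * (w ⬝ᵥ w) - 2 * (v ⬝ᵥ (readout sys τ x u t + sys.D1 *ᵥ w)) := by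
  have h0 : (ρ.op τ z).1 = x (max t 0) := h.1
  have h1 : ∀ i, (ρ.op τ z).2 i 0 = x (max t 0) := fun i => by
    rw [op_snd_eq_ext hτ hρ hc hX hz h i ⟨neg_nonpos.2 (hτ i).le, le_rfl⟩, add_zero]
  have h2 : ∀ i, (ρ.op τ z).2 i (-τ i) = x (max (t - τ i) 0) := fun i => by
    rw [op_snd_eq_ext hτ hρ hc hX hz h i ⟨le_rfl, neg_nonpos.2 (hτ i).le⟩, sub_eq_add_neg]
  have h3 : ∀ i, ∫ s, (ρ.op τ z).2 i s ⬝ᵥ vecDeriv (z.2 i) s ∂(delayMeasure τ i)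
      = ∫ s, x (max (t + s) 0) ⬝ᵥ vecDeriv (z.2 i) s ∂(delayMeasure τ i) := fun i =>
    setIntegral_congr_fun measurableSet_Icc fun s hs => by
      rw [op_snd_eq_ext hτ hρ hc hX hz h i hs]
  rw [innerZ_synthesisVec sys ζ hτ hρ hc hζ γ hz v w, ← hu] at hneg
  simp only [h0, h1, h2, h3] at hneg
  rw [drift, readout, add_right_comm, add_right_comm (_ + _) (sys.D2 *ᵥ _)]
  linarith

/-- The supply rate bound obtained by optimizing the dissipation inequality over `v`. -/
theorem dotProduct_self_le_of_forall {r : ℕ} (hγ : 0 ≤ γ) {V' b : ℝ} {y : Fin r → ℝ}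
    (h : ∀ v : Fin r → ℝ, V' ≤ γ * (v ⬝ᵥ v) + γ * b - 2 * (v ⬝ᵥ y)) :
    y ⬝ᵥ y ≤ γ ^ 2 * b - γ * V' := by
  have h' : ∀ c : ℝ, V' ≤ γ * (c ^ 2 * (y ⬝ᵥ y)) + γ * b - 2 * (c * (y ⬝ᵥ y)) := fun c => by
    have := h (c • y)
    simp only [smul_dotProduct, dotProduct_smul, smul_eq_mul] at this
    linarith
  rcases hγ.eq_or_lt with rfl | hγ
  · by_contra! hy
    -- At γ = 0 the inequality is linear in v; this multiple of y would give V' ≤ V' - 1.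
    have := h' ((1 - V') / (2 * (y ⬝ᵥ y)))
    have e : 2 * ((1 - V') / (2 * (y ⬝ᵥ y)) * (y ⬝ᵥ y)) = 1 - V' := by
      have : y ⬝ᵥ y ≠ 0 := by linarith
      field_simp
    rw [e] at this
    linarith
  -- v = y/γ minimizes γ|v|² - 2vᵀy, with value -|y|²/γ.
  · have := mul_le_mul_of_nonneg_left (h' γ⁻¹) hγ.le
    have e : γ * (γ * (γ⁻¹ ^ 2 * (y ⬝ᵥ y)) + γ * b - 2 * (γ⁻¹ * (y ⬝ᵥ y)))
        = γ ^ 2 * b - y ⬝ᵥ y := by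
      field_simp
      ring
    linarith

end Dissipation

end MultiDelay

namespace MultiDelay

open Matrix

/-! ### Closed-loop trajectories and the gain estimate -/

section Solution

variable {n m p q K : ℕ} [NeZero K] {sys : System n m p q K} {τ : Fin K → ℝ}
  {ρ : PQRS (Fin n) n K} {ζ : ZParam p n K} {γ ε : ℝ}
  {w : ℝ → Fin m → ℝ} {u : ℝ → Fin p → ℝ} {x : ℝ → Fin n → ℝ} {y : ℝ → Fin q → ℝ}

theorem System.IsSolution.sub_eq_ext (hτ : ∀ i, 0 < τ i) (hm : Monotone τ)
    (h : sys.IsSolution τ w u x y) {t : ℝ} (ht : 0 ≤ t) (i : Fin K) :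
    x (t - τ i) = x (max (t - τ i) 0) :=
  eq_ext_of_history hτ h.history (by linarith [le_tauMax hm i])

theorem System.IsSolution.ae_hasDerivAt (hτ : ∀ i, 0 < τ i) (hm : Monotone τ)
    (h : sys.IsSolution τ w u x y) : ∀ᵐ t ∂(volume.restrict (Ici (0 : ℝ))),
      HasDerivAt x (drift sys τ x u t + sys.B1 *ᵥ w t) t := by
  filter_upwards [h.state_eq, ae_restrict_mem measurableSet_Ici] with t ht ht0
  simp only [h.sub_eq_ext hτ hm ht0] at ht
  rwa [drift, max_eq_left (mem_Ici.1 ht0), add_right_comm]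

theorem System.IsSolution.ae_output_eq (hτ : ∀ i, 0 < τ i) (hm : Monotone τ)
    (h : sys.IsSolution τ w u x y) : ∀ᵐ t ∂(volume.restrict (Ici (0 : ℝ))),
      y t = readout sys τ x u t + sys.D1 *ᵥ w t := by
  filter_upwards [h.output_eq, ae_restrict_mem measurableSet_Ici] with t ht ht0
  simp only [h.sub_eq_ext hτ hm ht0] at ht
  rwa [readout, max_eq_left (mem_Ici.1 ht0), add_right_comm]

/-- With u continuous, x' is a continuous function plus B₁w, hence locally square integrable. -/
theorem System.IsSolution.w12 (hτ : ∀ i, 0 < τ i) (hm : Monotone τ)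
    (h : sys.IsSolution τ w u x y) (hw : MemL2 w) (hu : ContinuousOn u (Ici 0)) {T' : ℝ}
    (hT' : 0 < T') (a : Fin n) : W12 0 T' (fun t => x t a) := by
  refine ⟨h.absCont T' hT' a, (memLp_continuousOn_add_mulVec (continuousOn_drift sys (τ := τ)
    (continuous_ext_of_absCont h.absCont) hu) sys.B1 hw a).ae_eq ?_⟩
  filter_upwards [ae_restrict_of_ae_restrict_of_subset Icc_subset_Ici_self
    (h.ae_hasDerivAt hτ hm)] with t ht
  exact (hasDerivAt_pi.1 ht a).deriv.symm

/-- The `L²` gain of a closed-loop trajectory, for a nonnegative gain bound. -/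
theorem System.IsSolution.memL2_output (hτ : ∀ i, 0 < τ i) (hm : Monotone τ) (hγ : 0 ≤ γ)
    (hε : 0 < ε) (hρ : ρ.IsSobolev τ) (hc : ρ.Compatible τ)
    (hζ : ∀ i a b, W12 (-τ i) 0 (fun s => ζ.Z2 i s a b))
    (hco : ∀ z : ZVec (Fin n) n K, MemZ τ z → ε * normSqZ τ z ≤ innerZ τ z (ρ.op τ z))
    (hneg : ∀ z : ZVec (Fin n) n K, MemX τ z → ∀ (v : Fin q → ℝ) (w : Fin m → ℝ),
      innerZ τ (synthesisVec τ z v w)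
        ((synthesisParam sys τ ρ ζ γ).op τ (synthesisVec τ z v w)) ≤ 0)
    (h : sys.IsSolution τ w u x y) (hw : MemL2 w) (hfb : IsFeedback τ ρ ζ x u) :
    MemL2 y ∧ ∫ t in Ici (0 : ℝ), y t ⬝ᵥ y t ≤ γ ^ 2 * ∫ t in Ici (0 : ℝ), w t ⬝ᵥ w t := by
  have hX := continuous_ext_of_absCont h.absCont
  obtain ⟨Q, hQs, hQ, -⟩ := exists_hilbert_inverse hτ hε hρ hc hco
  -- The preimages are chosen separately at each time; all regularity in t is recovered from the
  -- bounded operator Q, which determines 𝐳(t) from the state.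
  choose! z hz hzx huz using hfb
  replace hzx : ∀ t, 0 ≤ t → EqZ τ (ρ.op τ (z t)) (extState K x t) := fun t ht =>
    (hzx t ht).trans (eqZ_stateAt_extState hτ hm h.history ht)
  have hZ : ∀ t, 0 ≤ t → MemZ τ (z t) := fun t ht => (hz t ht).memZ hτ
  have hσ : ∀ t (ht : 0 ≤ t), Q (hilbertState τ hX t) = toHilbert (z t) (hZ t ht) := by
    intro t ht
    rw [← hQ _ (hZ t ht)]
    congr 1
    exact (toHilbert_eq_iff hτ _ _).2 (hzx t ht).symm
  have hzc : ∀ ℓ : ZVec (Fin n) n K, MemZ τ ℓ →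
      ContinuousOn (fun t => innerZ τ ℓ (z t)) (Ici 0) := by
    intro ℓ hℓ
    refine ((continuous_const.inner (𝕜 := ℝ) (f := fun _ => toHilbert ℓ hℓ)
      (Q.continuous.comp (continuous_hilbertState hτ hX))).continuousOn).congr fun t ht => ?_
    simp only [Function.comp_apply]
    rw [hσ t ht, inner_toHilbert hτ]
  have hu : ContinuousOn u (Ici 0) :=
    (continuousOn_feedback hτ hε hρ hc hco hζ hX hz hzx hzc).congr huz
  have hxw : ∀ T', 0 < T' → ∀ a, W12 0 T' (fun t => x t a) := fun T' hT' a =>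
    h.w12 hτ hm hw hu hT' a
  have hV : ∀ t (ht : 0 ≤ t), storage (hX := hX) Q t = innerZ τ (z t) (ρ.op τ (z t)) := by
    intro t ht
    have e : hilbertState τ hX t = toHilbert (ρ.op τ (z t)) (hρ.memZ_op hτ (hZ t ht)) :=
      (toHilbert_eq_iff hτ _ _).2 (hzx t ht).symm
    rw [storage, hσ t ht, e, inner_toHilbert hτ, innerZ_comm]
  -- V = ⟨𝐳, 𝒫𝐳⟩, so coercivity of 𝒫 itself gives the sign.
  have hV0 : ∀ t, 0 ≤ t → 0 ≤ storage (hX := hX) Q t := fun t ht => by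
    rw [hV t ht]
    refine le_trans (mul_nonneg hε.le ?_) (hco _ (hZ t ht))
    rw [← norm_sq_toHilbert hτ (hZ t ht)]
    positivity
  have hV00 : storage (hX := hX) Q 0 = 0 := by
    have e : hilbertState τ hX 0 = 0 := by
      have hx0 : ∀ s ≤ 0, x (max s 0) = 0 := fun s hs => by
        rw [max_eq_right hs]
        exact h.history 0 ⟨neg_nonpos.2 (hτ _).le, le_rfl⟩
      rw [← norm_eq_zero, ← sq_eq_zero_iff, hilbertState, norm_sq_toHilbert hτ, normSqZ, innerZ]
      simp only [extState, hx0 0 le_rfl, dotProduct_zero, mul_zero, zero_add]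
      refine Finset.sum_eq_zero fun i _ => ?_
      rw [intervalIntegral_eq_setIntegral_Icc (neg_nonpos.2 (hτ i).le)]
      refine setIntegral_eq_zero_of_forall_eq_zero fun s hs => ?_
      rw [hx0 _ hs.2, dotProduct_zero]
    rw [storage, e, inner_zero_left]
  have hder : ∀ᵐ t ∂(volume.restrict (Ici (0 : ℝ))),
      y t ⬝ᵥ y t ≤ γ ^ 2 * (w t ⬝ᵥ w t) - γ * deriv (storage (hX := hX) Q) t := by
    rw [← restrict_Ioi_eq_restrict_Ici]
    have hsub : Ioi (0 : ℝ) ⊆ Ici 0 := Ioi_subset_Ici_self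
    filter_upwards [ae_restrict_of_ae_restrict_of_subset hsub (h.ae_hasDerivAt hτ hm),
      ae_restrict_of_ae_restrict_of_subset hsub (h.ae_output_eq hτ hm),
      ae_restrict_mem measurableSet_Ioi] with t h1 h2 ht
    have ht0 : 0 ≤ t := (mem_Ioi.1 ht).le
    rw [(hasDerivAt_storage hτ hQs ht (hxw _ (by linarith)) h1 (hz t ht0) (hσ t ht0)).deriv]
    refine dotProduct_self_le_of_forall hγ fun v => ?_
    rw [h2]
    exact dissipation_inequality sys hτ hρ hc hζ hX (hz t ht0) (hzx t ht0) (huz t ht0) v (w t)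
      (hneg _ (hz t ht0) v (w t))
  have hwI : IntegrableOn (fun t => w t ⬝ᵥ w t) (Ici 0) :=
    (memL2_iff_integrable hw.aestronglyMeasurable).1 hw
  have hyT : ∀ T', 0 ≤ T' → ∀ a, MemLp (fun t => y t a) 2 (volume.restrict (Icc 0 T')) := by
    intro T' _ a
    refine (memLp_continuousOn_add_mulVec (continuousOn_readout sys (τ := τ) hX hu) sys.D1 hw
      a).ae_eq ?_
    filter_upwards [ae_restrict_of_ae_restrict_of_subset Icc_subset_Ici_self
      (h.ae_output_eq hτ hm)] with t ht
    rw [ht]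
  refine memL2_of_intervalIntegral_le hyT fun T' hT' => ?_
  -- The solution is assumed absolutely continuous on [0,T] for T > 0, so the degenerate interval is
  -- treated apart.
  rcases hT'.eq_or_lt with rfl | hT
  · rw [intervalIntegral.integral_same]
    exact mul_nonneg (sq_nonneg _) (integral_nonneg fun t =>
      Finset.sum_nonneg fun _ _ => mul_self_nonneg _)
  have hac := absCont_storage hτ (hX := hX) hQs hT' (hxw T' hT)
  have hi1 : IntervalIntegrable (fun t => y t ⬝ᵥ y t) volume 0 T' := by
    rw [intervalIntegrable_iff_integrableOn_Icc_of_le hT']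
    exact integrable_finsetSum _ fun a _ =>
      MemLp.integrable_mul_two (hyT T' hT' a) (hyT T' hT' a)
  have hi2 : IntervalIntegrable (fun t => w t ⬝ᵥ w t) volume 0 T' := by
    rw [intervalIntegrable_iff_integrableOn_Icc_of_le hT']
    exact hwI.mono_set Icc_subset_Ici_self
  have hi3 := hac.intervalIntegrable_deriv
  have hle : ∫ t in 0..T', y t ⬝ᵥ y t
      ≤ ∫ t in 0..T', (γ ^ 2 * (w t ⬝ᵥ w t) - γ * deriv (storage (hX := hX) Q) t) :=
    intervalIntegral.integral_mono_ae_restrict hT' hi1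
      ((hi2.const_mul _).sub (hi3.const_mul _))
      (ae_restrict_of_ae_restrict_of_subset Icc_subset_Ici_self hder)
  rw [intervalIntegral.integral_sub (hi2.const_mul _) (hi3.const_mul _),
    intervalIntegral.integral_const_mul, intervalIntegral.integral_const_mul,
    hac.integral_deriv_eq_sub, hV00, sub_zero] at hle
  have hwle : ∫ t in 0..T', w t ⬝ᵥ w t ≤ ∫ t in Ici (0 : ℝ), w t ⬝ᵥ w t := by
    rw [intervalIntegral_eq_setIntegral_Icc hT']
    exact setIntegral_mono_set hwI (ae_of_all _ fun t =>
      Finset.sum_nonneg fun _ _ => mul_self_nonneg _)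
      (ae_of_all _ fun _ ht => Icc_subset_Ici_self ht)
  have := mul_le_mul_of_nonneg_left hwle (sq_nonneg γ)
  have := mul_nonneg hγ (hV0 T' hT')
  linarith

end Solution

end MultiDelay

theorem mainTheorem2 {n m p q K : ℕ} [NeZero K] (sys : System n m p q K)
    (τ : Fin K → ℝ) (hτ_pos : ∀ i, 0 < τ i) (hτ_mono : Monotone τ)
    (γ ε : ℝ) (hε : 0 < ε)
    (ρ : PQRS (Fin n) n K) (hρ : ρ.IsSobolev τ) (hρ_compat : ρ.Compatible τ)
    (ζ : ZParam p n K) (hζ : ∀ i a b, W12 (-τ i) 0 (fun s => ζ.Z2 i s a b))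
    (h_coercive : ∀ z : ZVec (Fin n) n K, MemZ τ z →
      ε * normSqZ τ z ≤ innerZ τ z (ρ.op τ z))
    (h_negative : ∀ (v : Fin q → ℝ) (w : Fin m → ℝ) (y₁ : Fin n → ℝ) (y₂ : Fin n × Fin K → ℝ)
      (φ : Fin K → ℝ → Fin n → ℝ),
      MemZ τ (bigVec v w y₁ y₂ φ) →
      MemZ τ ((synthesisParam sys τ ρ ζ γ).op τ (bigVec v w y₁ y₂ φ)) →
      innerZ τ (bigVec v w y₁ y₂ φ)
          ((synthesisParam sys τ ρ ζ γ).op τ (bigVec v w y₁ y₂ φ))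
        ≤ -ε * normSqZ τ ((y₁, φ) : ZVec (Fin n) n K)) :
    (∀ z', MemX τ z' → ∃ z, MemX τ z ∧ EqZ τ (ρ.op τ z) z' ∧
      ∀ z₂, MemX τ z₂ → EqZ τ (ρ.op τ z₂) z' → EqZ τ z₂ z) ∧
    ∀ (w : ℝ → Fin m → ℝ) (u : ℝ → Fin p → ℝ) (x : ℝ → Fin n → ℝ) (y : ℝ → Fin q → ℝ),
      MemL2 w → sys.IsSolution τ w u x y → IsFeedback τ ρ ζ x u →
      MemL2 y ∧ l2Norm y ≤ ENNReal.ofReal γ * l2Norm w := by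
  have hneg : ∀ z : ZVec (Fin n) n K, MemX τ z → ∀ (v : Fin q → ℝ) (w : Fin m → ℝ),
      innerZ τ (synthesisVec τ z v w)
        ((synthesisParam sys τ ρ ζ γ).op τ (synthesisVec τ z v w)) ≤ 0 := by
    intro z hz v w
    refine (h_negative v w z.1 (fun k => z.2 k.2 (-τ k.2) k.1) z.2 (hz.memZ hτ_pos)
      (memZ_synthesisVec_op sys ζ hτ_pos hρ hρ_compat hζ γ hz v w)).trans ?_
    rw [neg_mul, neg_nonpos]
    refine mul_nonneg hε.le ?_
    change 0 ≤ normSqZ τ z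
    rw [← norm_sq_toHilbert hτ_pos (hz.memZ hτ_pos)]
    positivity
  refine ⟨fun z' hz' => ?_, fun w u x y hw hsol hfb => ?_⟩
  · obtain ⟨z, hz, hzz'⟩ := exists_memX_op_eq hτ_pos hε hρ hρ_compat h_coercive hz'
    refine ⟨z, hz, hzz', fun z₂ hz₂ h₂ => ?_⟩
    -- Q is a left inverse of 𝒫, which gives uniqueness in Z and so in X.
    obtain ⟨Q, -, hQ, -⟩ := exists_hilbert_inverse hτ_pos hε hρ hρ_compat h_coercive
    rw [← toHilbert_eq_iff hτ_pos (hz₂.memZ hτ_pos) (hz.memZ hτ_pos),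
      ← hQ z₂, ← hQ z]
    congr 1
    exact (toHilbert_eq_iff hτ_pos _ _).2 (h₂.trans hzz'.symm)
  rcases le_or_gt 0 γ with hγ | hγ
  · obtain ⟨hy, hle⟩ := hsol.memL2_output hτ_pos hτ_mono hγ hε hρ hρ_compat hζ h_coercive hneg hw hfb
    refine ⟨hy, ?_⟩
    rw [l2Norm_eq hy, l2Norm_eq hw, ← ENNReal.ofReal_mul hγ]
    refine ENNReal.ofReal_le_ofReal ((Real.sqrt_le_sqrt hle).trans_eq ?_)
    rw [Real.sqrt_mul (sq_nonneg γ), Real.sqrt_sq hγ]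
  · have hz0 : MemX τ (0 : ZVec (Fin n) n K) := fun i =>
      ⟨fun a => W12.const (neg_nonpos.2 (hτ_pos i).le) 0, rfl⟩
    -- At 𝐳 = 0 and w = 0 the form reduces to -γ|v|², positive at a unit vector when γ < 0. Hence
    -- there are no outputs and both claims are trivial.
    have hq : IsEmpty (Fin q) := by
      refine ⟨fun a => ?_⟩
      have := hneg 0 hz0 (Pi.single a 1) 0
      rw [innerZ_synthesisVec sys ζ hτ_pos hρ hρ_compat hζ γ hz0] at this
      simp [PQRS.op, ZParam.op, vecDeriv, dotProduct, Pi.single_apply] at this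
      linarith
    have hy : (fun t => WithLp.toLp 2 (y t)) = fun _ => 0 := by
      funext t
      exact Subsingleton.elim _ _
    rw [MemL2, l2Norm, hy]
    exact ⟨MemLp.zero, by simp⟩
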